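/- **Theorem (Sum of nondiagonal terms vanishes).** Let $d\ge 3$, let $W\in\mathcal S(\mathbb R^d)$ and $a,b\in\mathcal S(\mathbb R^d\times\mathbb R^d)$ be Schwartz functions, and let $\alpha,t>0$. Write $\mathrm e(x)=\mathrm e^{2\pi\mathrm i x}$, $\widehat W(y)=\int W(x)\,\mathrm e(-x\cdot y)\,\mathrm dx$ and $\tilde a(\xi,y)=\int a(x,y)\,\mathrm e(-x\cdot\xi)\,\mathrm dx$, similarly $\tilde b$. Let $\Gamma\in C_c^\infty(\mathbb R^d)$ take values in $[0,1]$, with $\Gamma=1$ near the origin and $\Gamma(y)=0$ for $\|y\|>1$. Let $\chi\in C_c^\infty(\mathbb R^d)$ be real-valued and decreasing in $\|z\|$, with $\chi(z)=1$ for $\|z\|<1$ and $\chi(z)=0$ for $\|z\|>2$. Let $\mathcal P\subset\mathbb R^d$ and $b_{\mathcal P},c_{\mathcal P}>0$ be such that $\|q-q'\|>b_{\mathcal P}$ for all distinct $q,q'\in\mathcal P$ and, for every $g\in C_c^\infty(\mathbb R^d)$ and $0<\epsilon<1$, $$\epsilon^d\sum_{q\in\mathcal P}g(\epsilon q)=\int_{\mathbb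 R^d}g(x)\,\mathrm dx+O(\epsilon^{c_{\mathcal P}}\|\nabla g\|),$$ where the implied constant may depend on $g$. Let $\lambda:\mathbb R^d\to\mathbb R$ be smooth with compact support contained in the closed unit ball, and put $\|\lambda\|_{1,\infty}=\max\{\|\lambda\|_{L^1},\|\lambda\|_{L^\infty}\}$. For $m\ge 1$ let $\Pi_m$ be the set of all $S=\{s_1<\dots<s_p\}\subset\{0,\dots,m\}$ with $s_1=0$ and $s_p=m$. For $S\in\Pi_m$, $\gamma\in\{0,1\}^m$ and $r>0$, put $\bar\gamma_i=1-\gamma_i$, $Z_j=\sum_{i=1}^j z_i$, $$\xi_j=\tfrac12\Big(\big\|y+\sum_{i=1}^j\bar\gamma_iz_i+r^d\eta\big\|^2-\big\|y-\sum_{i=1}^j\gamma_iz_i\big\|^2\Big),\qquad \chi^S(v_1,\dots,v_{m-1})=\prod_{j\in S\setminus\{0,m\}}\chi(v_j)\prod_{j\notin S}(1-\chi(v_j)),$$ and, for $q_1,\dots,q_m\in\mathcal P$, $$\begin{aligned}I_{\gamma,S}(q_1,\dots,q_m)={}&\lambda(r^{d-1}q_1)\cdots\lambda(r^{d-1}q_m)\int_{\mathbb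 R^{(m+2)d}}\mathrm dy\,\mathrm d\eta\,\mathrm dz_1\cdots\mathrm dz_m\ \prod_{i=1}^m\widehat W(z_i)\,\mathrm e(-r^{-1}q_i\cdot z_i)\\&\times\int_{\triangle_m(r^{-d}t)}\mathrm du_0\cdots\mathrm du_m\prod_{j=0}^m\mathrm e(\xi_ju_j)\,\mathrm e^{-\alpha^d(1-\Gamma(\alpha(\eta+r^{-d}Z_j)))u_j}\\&\times\chi^S\big(\alpha(\eta+r^{-d}Z_1),\dots,\alpha(\eta+r^{-d}Z_{m-1})\big)\\&\times\tilde a\Big(-\eta-r^{-d}Z_m,\ y-\sum_{i=1}^m\gamma_iz_i+\tfrac12(r^d\eta+Z_m)\Big)\,\tilde b\big(\eta,y+\tfrac12r^d\eta\big),\end{aligned}$$ where $\triangle_m(T)=\{u\in\mathbb R_{+}^{m+1}:u_0+\cdots+u_m=T\}$ carries the measure $\delta(u_0+\cdots+u_m-T)\,\mathrm du_0\cdots\mathrm du_m$. Call $(q_1,\dots,q_m)$ *diagonal* with respect to $S$ if $q_k=q_{s_{i+1}}$ whenever $s_i<k\le s_{i+1}$, and let $$\mathcal A_{\mathrm{nd},\gamma,S}^{\alpha,r}(t)=\sum_{\substack{(q_1,\dots,q_m)\in\mathcal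 P^m\\ \text{not diagonal with respect to }S}}I_{\gamma,S}(q_1,\dots,q_m).$$ There is a constant $\lambda_0>0$, depending only on $d,\alpha,t,W,a$ and $b$, such that for all $\Gamma,\chi,\mathcal P,b_{\mathcal P}$ as above and all $\lambda$ as above with $\|\lambda\|_{1,\infty}<\lambda_0$: for all sufficiently small $r>0$ the series over $m$ below converges absolutely, and as $r\to0$ $$\sum_{m=1}^\infty(2\pi\mathrm i)^m\sum_{\gamma\in\{0,1\}^m}(-1)^{\gamma_1+\cdots+\gamma_m}\sum_{S\in\Pi_m}\mathcal A_{\mathrm{nd},\gamma,S}^{\alpha,r}(t)=O\big(r\log_2(1+r^{1-d}b_{\mathcal P}^{-1})\big).$$ In particular, this sum tends to $0$ as $r\to0$. -/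

import Mathlib

open MeasureTheory Filter Topology Asymptotics
open scoped FourierTransform ContDiff

noncomputable section

namespace LorentzGas

/-- The Euclidean space `ℝ^d`. -/
abbrev Space (d : ℕ) : Type := EuclideanSpace ℝ (Fin d)

/-- The shorthand `e(x) = exp(2 π i x)`. -/
def expi (x : ℝ) : ℂ := Complex.exp (2 * Real.pi * Complex.I * x)

/-- The damping profile: `Γ ∈ C_c^∞(ℝ^d)` with values in `[0,1]`, equal to `1` in a neighbourhood of
the origin and to `0` at every point of norm larger than one. -/
structure IsDampingProfile {d : ℕ} (Γ : Space d → ℝ) : Prop where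
  smooth : ContDiff ℝ ∞ Γ
  compact : HasCompactSupport Γ
  nonneg : ∀ y, 0 ≤ Γ y
  le_one : ∀ y, Γ y ≤ 1
  eq_one : ∀ᶠ y in 𝓝 (0 : Space d), Γ y = 1
  eq_zero : ∀ y, 1 < ‖y‖ → Γ y = 0

/-- The cut-off that separates damped and undamped regions: `χ ∈ C_c^∞(ℝ^d)`, decreasing in the
norm, equal to `1` on `‖z‖ < 1` and to `0` on `‖z‖ > 2`. -/
structure IsRegionCutoff {d : ℕ} (χ : Space d → ℝ) : Prop where
  smooth : ContDiff ℝ ∞ χ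
  compact : HasCompactSupport χ
  antitone : ∀ z w, ‖z‖ ≤ ‖w‖ → χ w ≤ χ z
  eq_one : ∀ z, ‖z‖ < 1 → χ z = 1
  eq_zero : ∀ z, 2 < ‖z‖ → χ z = 0

/-- A uniformly discrete point set (with separation constant `b`) of asymptotic density one: Riemann
sums over `ε P` converge to the integral with error `O(ε^c ‖∇g‖)`. The implied constant `K` may
depend on the test function `g`. -/
structure IsScattererConfiguration {d : ℕ} (P : Set (Space d)) (b : ℝ) : Prop where
  sep_pos : 0 < b
  separated : ∀ q ∈ P, ∀ q' ∈ P, q ≠ q' → b < ‖q - q'‖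
  density : ∃ c : ℝ, 0 < c ∧ ∀ g : Space d → ℝ, ContDiff ℝ ∞ g → HasCompactSupport g →
    ∃ K : ℝ, ∀ ε : ℝ, 0 < ε → ε < 1 →
      |ε ^ d * (∑' q : P, g (ε • (q : Space d))) - ∫ x, g x| ≤ K * (ε ^ c * ⨆ x, ‖fderiv ℝ g x‖)

/-- The cut-off of the potential on the macroscopic scale: smooth, with (compact) support in the
unit ball. -/
structure IsMacroscopicCutoff {d : ℕ} (lam : Space d → ℝ) : Prop where
  smooth : ContDiff ℝ ∞ lam
  support : tsupport lam ⊆ Metric.closedBall 0 1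

/-- `‖λ‖_{1,∞} = max {‖λ‖_{L^1}, ‖λ‖_{L^∞}}`. -/
def norm1inf {d : ℕ} (lam : Space d → ℝ) : ℝ :=
  max (eLpNorm lam 1 volume).toReal (eLpNorm lam ⊤ volume).toReal

/-- The partial Fourier transform `ã(ξ, y) = ∫ a(x, y) e(-x·ξ) dx`. -/
def tildeTransform {d : ℕ} (a : SchwartzMap (Space d × Space d) ℂ) (ξ y : Space d) : ℂ :=
  𝓕 (fun x : Space d => a (x, y)) ξ

/-- `Π_m`: the subsets of `{0, …, m}` that contain `0` and `m`. -/
def markedSets (m : ℕ) : Finset (Finset (Fin (m + 1))) :=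
  Finset.univ.filter fun S => 0 ∈ S ∧ Fin.last m ∈ S

/-- The partial sum `z_1 + ⋯ + z_j`, for `0 ≤ j ≤ m`; the vector `z_k` is stored at the index
`k - 1` of `Fin m`. -/
def partialSum {d m : ℕ} (z : Fin m → Space d) (j : Fin (m + 1)) : Space d :=
  ∑ i ∈ Finset.univ.filter (fun i : Fin m => i.castSucc < j), z i

/-- The `0`-`1` variable `γ_i` as a real number. -/
def coeff {m : ℕ} (γ : Fin m → Fin 2) (i : Fin m) : ℝ := ((γ i : ℕ) : ℝ)

/-- `γ_1 z_1 + ⋯ + γ_j z_j`. -/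
def gammaSum {d m : ℕ} (γ : Fin m → Fin 2) (z : Fin m → Space d) (j : Fin (m + 1)) : Space d :=
  partialSum (fun i => coeff γ i • z i) j

/-- `(1 - γ_1) z_1 + ⋯ + (1 - γ_j) z_j`. -/
def gammaBarSum {d m : ℕ} (γ : Fin m → Fin 2) (z : Fin m → Space d) (j : Fin (m + 1)) : Space d :=
  partialSum (fun i => (1 - coeff γ i) • z i) j

/-- The phase `ξ_j`, half the difference of the two kinetic energies after `j` collisions. -/
def xi {d m : ℕ} (r : ℝ) (γ : Fin m → Fin 2) (y η : Space d) (z : Fin m → Space d)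
    (j : Fin (m + 1)) : ℝ :=
  (1 / 2) * (‖y + gammaBarSum γ z j + r ^ d • η‖ ^ 2 - ‖y - gammaSum γ z j‖ ^ 2)

/-- The rescaled momentum difference `η + r^{-d} (z_1 + ⋯ + z_j)`. -/
def momentumDiff {d m : ℕ} (r : ℝ) (η : Space d) (z : Fin m → Space d) (j : Fin (m + 1)) :
    Space d :=
  η + (r ^ d)⁻¹ • partialSum z j

/-- The partition function `χ^S`, evaluated at vectors `v_1, …, v_{m-1}` (the entries `v_0` and
`v_m` are not used when `S` contains `0` and `m`). -/
def chiSet {d m : ℕ} (χ : Space d → ℝ) (S : Finset (Fin (m + 1))) (v : Fin (m + 1) → Space d) : ℝ :=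
  (∏ j ∈ S \ {0, Fin.last m}, χ (v j)) * ∏ j ∈ Sᶜ, (1 - χ (v j))

/-- The integral over the simplex `{u ∈ ℝ_+^{m+1} : u_0 + ⋯ + u_m = T}`, with respect to
`δ(u_0 + ⋯ + u_m - T) du_0 ⋯ du_m`: the variables `u_1, …, u_m` are integrated over, and
`u_0 = T - u_1 - ⋯ - u_m`. -/
def simplexIntegral (m : ℕ) (T : ℝ) (f : (Fin (m + 1) → ℝ) → ℂ) : ℂ :=
  ∫ u in {u : Fin m → ℝ | (∀ i, 0 ≤ u i) ∧ ∑ i, u i ≤ T},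
    f (Fin.cons (T - ∑ i, u i) u)

/-- The contribution of the time variables to a collision history: the integral over the simplex of
size `r^{-d} t` of `∏_j e(ξ_j u_j) exp(-α^d (1 - Γ(α (η + r^{-d} (z_1 + ⋯ + z_j)))) u_j)`. -/
def timeFactor {d m : ℕ} (Γ : Space d → ℝ) (α r t : ℝ) (γ : Fin m → Fin 2) (y η : Space d)
    (z : Fin m → Space d) : ℂ :=
  simplexIntegral m ((r ^ d)⁻¹ * t) fun u =>
    ∏ j : Fin (m + 1), expi (xi r γ y η z j * u j) *
      (Real.exp (-(α ^ d * (1 - Γ (α • momentumDiff r η z j)) * u j)) : ℂ)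

/-- The summand of `A_{γ,S}^{α,r}(t)` that belongs to the scatterers `q_1, …, q_m`. -/
def collisionTerm {d m : ℕ} (Γ χ : Space d → ℝ) (W : SchwartzMap (Space d) ℂ)
    (a b : SchwartzMap (Space d × Space d) ℂ) (lam : Space d → ℝ) (α r t : ℝ)
    (γ : Fin m → Fin 2)
    (S : Finset (Fin (m + 1))) (q : Fin m → Space d) : ℂ :=
  (∏ i, (lam (r ^ (d - 1) • q i) : ℂ)) *
    ∫ p : Space d × Space d × (Fin m → Space d),
      let y := p.1
      let η := p.2.1
      let z := p.2.2
      (∏ i, 𝓕 (W : Space d → ℂ) (z i)) * expi (-∑ i, r⁻¹ * inner ℝ (q i) (z i)) *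
        timeFactor Γ α r t γ y η z *
        (chiSet χ S (fun j => α • momentumDiff r η z j) : ℂ) *
        tildeTransform a (-momentumDiff r η z (Fin.last m))
          (y - gammaSum γ z (Fin.last m)
            + (1 / 2 : ℝ) • (r ^ d • η + partialSum z (Fin.last m))) *
        tildeTransform b η (y + (1 / 2 : ℝ) • (r ^ d • η))

/-- The scatterers `q_1, …, q_m` are diagonal with respect to `S = {s_1 < ⋯ < s_p}`: whenever
`s_i < k ≤ s_{i+1}`, the scatterers `q_k` and `q_{s_{i+1}}` coincide. (The scatterer `q_k` is stored
at the index `k - 1` of `Fin m`, the successor of which is `k`.) -/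
def IsDiagonal {d m : ℕ} (S : Finset (Fin (m + 1))) (q : Fin m → Space d) : Prop :=
  ∀ k l : Fin m, k ≤ l → l.succ ∈ S → (∀ n : Fin m, k ≤ n → n < l → n.succ ∉ S) → q k = q l

/-- The `m`-tuples of scatterers that are not diagonal with respect to `S`. -/
def nondiagonalTuples {d m : ℕ} (P : Set (Space d)) (S : Finset (Fin (m + 1))) :
    Set (Fin m → Space d) :=
  {q | (∀ i, q i ∈ P) ∧ ¬ IsDiagonal S q}

/-- The nondiagonal term `A_{nd,γ,S}^{α,r}(t)`. -/
def nondiagonalTerm {d m : ℕ} (Γ χ : Space d → ℝ) (W : SchwartzMap (Space d) ℂ)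
    (a b : SchwartzMap (Space d × Space d) ℂ)
    (P : Set (Space d)) (lam : Space d → ℝ) (α r t : ℝ)
    (γ : Fin m → Fin 2) (S : Finset (Fin (m + 1))) : ℂ :=
  ∑' q : nondiagonalTuples P S, collisionTerm Γ χ W a b lam α r t γ S (q : Fin m → Space d)

/-- The `m`-th term of the nondiagonal series:
`(2 π i)^m ∑_{γ ∈ {0,1}^m} (-1)^{γ_1 + ⋯ + γ_m} ∑_{S ∈ Π_m} A_{nd,γ,S}^{α,r}(t)`. -/
def nondiagonalOrder {d : ℕ} (Γ χ : Space d → ℝ) (W : SchwartzMap (Space d) ℂ)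
    (a b : SchwartzMap (Space d × Space d) ℂ)
    (P : Set (Space d)) (lam : Space d → ℝ) (α r t : ℝ)
    (m : ℕ) : ℂ :=
  (2 * Real.pi * Complex.I) ^ m *
    ∑ γ : Fin m → Fin 2, (-1 : ℂ) ^ (∑ i, (γ i : ℕ)) *
      ∑ S ∈ markedSets m, nondiagonalTerm Γ χ W a b P lam α r t γ S

end LorentzGas

end

/-!
The two momenta of a collision history are collected in a pair `x = (A, B)`. In a collision one of
them is changed by the momentum transfer `z`, which is integrated against the kernel
`λ(r^{d-1} q) e(-r⁻¹ q·z) Ŵ(z)`; between two collisions the history is multiplied by the free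
evolution factor `e(½ (‖A‖² - ‖B‖²) u)` and by damping and cut-off factors, which depend only on the
difference `A - B` on the scale `ε = r^d`. For fixed durations `u`, the sum over the scatterers is
thus a composition of convolutions and multiplications (`chain`, `collisionTerm_eq`).

The nondiagonal terms are small because of the following. In a nondiagonal tuple, two consecutive
collisions with distinct scatterers `q`, `q'` are separated by an unmarked state. The multiplier of
that state is a constant times `1 - χ`, since damping is fully effective where `χ ≠ 1`.

* For the part `1`, nothing but free evolution separates the two collisions. Moving the two momentum
  transfers by `s ν` and `-s ν`, with `ν` the direction of `q - q'`, multiplies the integrand by the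
  phase `e(-r⁻¹ ‖q - q'‖ s)`, and everything else is smooth at unit scale, up to a power of the
  duration, which the damping compensates. Integration by parts gains any power of `r / b`
  (`exists_norm_collide_collide_le`). It is carried out with finite differences rather than
  derivatives: bounds on them (`DiffBound`, `ShiftBound`) pass through products and parameter
  integrals.
* The part `χ` is supported in the strip `‖A - B‖ ≤ 2 ε / α`, and the sum over all scatterers
  `q ≠ q'` is a collision with a full potential; the strip gains its volume `ε^d`.

Both gains exceed the number `κ² = O(r^{-d(d-1)})` of scatterers by a factor `r`
(`exists_leaving_le`). The later collisions are then estimated by absolute values: the number of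
tuples that are diagonal with respect to the marked set is a power of `κ²`, with one factor for each
marked state and one for the final state, and each of these states gains the volume `ε^d`
(`exists_chain_eq_collide`, `sum_diag_weight_le`). In the earlier collisions the sum over the
scatterers must not be estimated term by term, since the tuple is arbitrary there. The sum of the
kernels is the Fourier transform of the total potential, which is bounded independently of the
number of scatterers because these are separated. By Plancherel, a collision with it is bounded on
`L²`. In a norm dual to test functions (`TestBound`), this makes every collision bounded, and the
loss `κ²` in the passage to the supremum norm is incurred only where the multiplier is supported in
the strip, the volume of which makes up for it (`TestBound.collide`, `TestBound.of_strip`). An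
induction on the number of collisions (`exists_nondiagSum_le`) combines these bounds.

As `ε^d κ² = r^d`, each marked state contributes `r^d` times the length `r^{-d} t` of its time
interval, and each unmarked one a convergent integral of the damping factor, so that the terms of
order `m` are `O(m B^m ‖λ‖_{1,∞}^m r)`. The number of choices of `γ` and `S` is exponential in `m`,
and the series converges geometrically for small potentials.
-/

namespace LorentzGas

/-! ### Finite differences -/

/-- The weight `(1 + ‖x‖)^{-K}`. -/
noncomputable def decay {E : Type*} [NormedAddCommGroup E] (K : ℕ) (x : E) : ℝ := ((1 + ‖x‖) ^ K)⁻¹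

/-- The bound `‖Δ_h^k f(s)‖ ≤ c h^k` on the forward differences of order `k ≤ N` of a function on
the line, for all nodes in the unit interval. In contrast to bounds on derivatives it passes through
integrals in a parameter without any differentiation under the integral sign. -/
def DiffBound (N : ℕ) (c : ℝ) (f : ℝ → ℂ) : Prop :=
  ∀ k ≤ N, ∀ h s : ℝ, 0 ≤ h → 0 ≤ s → s + k * h ≤ 1 → ‖(fwdDiff h)^[k] f s‖ ≤ c * h ^ k

lemma DiffBound.norm_zero_le {N : ℕ} {c : ℝ} {f : ℝ → ℂ} (hf : DiffBound N c f) : ‖f 0‖ ≤ c := by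
  simpa using hf 0 (Nat.zero_le _) 0 0 le_rfl le_rfl (by simp)

lemma DiffBound.nonneg {N : ℕ} {c : ℝ} {f : ℝ → ℂ} (hf : DiffBound N c f) : 0 ≤ c :=
  (norm_nonneg _).trans hf.norm_zero_le

lemma DiffBound.mono {N : ℕ} {c c' : ℝ} {f : ℝ → ℂ} (hf : DiffBound N c f) (h : c ≤ c') :
    DiffBound N c' f := fun k hk t s ht hs hst =>
  (hf k hk t s ht hs hst).trans (by gcongr)

lemma DiffBound.const_mul {N : ℕ} {c : ℝ} {f : ℝ → ℂ} (hf : DiffBound N c f) (w : ℂ) :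
    DiffBound N (‖w‖ * c) (fun s => w * f s) := by
  intro k hk h s hh hs hs1
  have h1 : (fun s => w * f s) = w • f := rfl
  rw [h1, fwdDiff_iter_const_smul, Pi.smul_apply, norm_smul, mul_assoc]
  gcongr
  exact hf k hk h s hh hs hs1

/-- The Leibniz rule for iterated forward differences, with the translated nodes at which they are
taken. -/
lemma norm_fwdDiff_iter_mul_le {h : ℝ} (k : ℕ) :
    ∀ (f g : ℝ → ℂ) (c₁ c₂ s : ℝ),
      (∀ i j : ℕ, i + j ≤ k → ‖(fwdDiff h)^[j] f (s + i * h)‖ ≤ c₁ * h ^ j) →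
      (∀ i j : ℕ, i + j ≤ k → ‖(fwdDiff h)^[j] g (s + i * h)‖ ≤ c₂ * h ^ j) →
      ‖(fwdDiff h)^[k] (fun x => f x * g x) s‖ ≤ 2 ^ k * c₁ * c₂ * h ^ k := by
  induction k with
  | zero =>
    intro f g c₁ c₂ s hf hg
    have h1 := hf 0 0 le_rfl
    have h2 := hg 0 0 le_rfl
    simp only [Function.iterate_zero, id_eq, Nat.cast_zero, zero_mul, add_zero, pow_zero,
      mul_one] at h1 h2
    simp only [Function.iterate_zero, id_eq, pow_zero, mul_one, one_mul, norm_mul]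
    exact mul_le_mul h1 h2 (norm_nonneg _) ((norm_nonneg _).trans h1)
  | succ k ih =>
    intro f g c₁ c₂ s hf hg
    have key : fwdDiff h (fun x => f x * g x) =
        (fun x => fwdDiff h f x * g (x + h)) + (fun x => f x * fwdDiff h g x) := by
      funext x
      simp only [fwdDiff, Pi.add_apply]
      ring
    rw [Function.iterate_succ_apply, key, fwdDiff_iter_add, Pi.add_apply]
    have h1 := ih (fwdDiff h f) (fun x => g (x + h)) (c₁ * h) c₂ s
      (fun i j hij => by
        have := hf i (j + 1) (by omega)
        rw [Function.iterate_succ_apply] at this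
        rwa [mul_assoc, ← pow_succ'])
      (fun i j hij => by
        have := hg (i + 1) j (by omega)
        rw [fwdDiff_iter_comp_add]
        convert this using 3
        push_cast
        ring)
    have h2 := ih f (fwdDiff h g) c₁ (c₂ * h) s
      (fun i j hij => hf i j (by omega))
      (fun i j hij => by
        have := hg i (j + 1) (by omega)
        rw [Function.iterate_succ_apply] at this
        rwa [mul_assoc, ← pow_succ'])
    refine (norm_add_le _ _).trans ((add_le_add h1 h2).trans (le_of_eq ?_))
    ring

lemma DiffBound.mul {N : ℕ} {c₁ c₂ : ℝ} {f g : ℝ → ℂ} (hf : DiffBound N c₁ f)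
    (hg : DiffBound N c₂ g) : DiffBound N (2 ^ N * c₁ * c₂) (fun s => f s * g s) := by
  intro k hk h s hh hs hs1
  have aux : ∀ {c : ℝ} {f : ℝ → ℂ}, DiffBound N c f → ∀ i j : ℕ, i + j ≤ k →
      ‖(fwdDiff h)^[j] f (s + i * h)‖ ≤ c * h ^ j := fun hf i j hij =>
    hf j (by omega) h _ hh (by positivity) (by
      have : ((i : ℝ) + j) * h ≤ k * h := by
        gcongr
        exact_mod_cast hij
      linarith)
  have h1 := norm_fwdDiff_iter_mul_le k f g c₁ c₂ s (aux hf) (aux hg)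
  refine h1.trans ?_
  have := hf.nonneg
  have := hg.nonneg
  gcongr
  norm_num

lemma DiffBound.integral {Z : Type*} [MeasurableSpace Z] {μ : Measure Z} {N : ℕ} {c : Z → ℝ}
    {F : Z → ℝ → ℂ} (hF : ∀ z, DiffBound N (c z) (F z)) (hint : ∀ s, Integrable (fun z => F z s) μ)
    (hc : Integrable c μ) : DiffBound N (∫ z, c z ∂μ) (fun s => ∫ z, F z s ∂μ) := by
  intro k hk h s hh hs hs1
  have h1 : (fwdDiff h)^[k] (fun s => ∫ z, F z s ∂μ) s = ∫ z, (fwdDiff h)^[k] (F z) s ∂μ := by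
    simp only [fwdDiff_iter_eq_sum_shift]
    rw [integral_finsetSum _ (fun i _ => ?_)]
    · refine Finset.sum_congr rfl fun i _ => ?_
      simp only [zsmul_eq_mul]
      rw [integral_const_mul]
    · simp only [zsmul_eq_mul]
      exact (hint _).const_mul _
  rw [h1, ← integral_mul_const]
  exact norm_integral_le_of_norm_le (hc.mul_const _)
    (Eventually.of_forall fun z => hF z k hk h s hh hs hs1)

lemma hasDerivAt_fwdDiff_iter (h : ℝ) (k : ℕ) : ∀ (f f' : ℝ → ℂ), (∀ x, HasDerivAt f (f' x) x) →
    ∀ x, HasDerivAt ((fwdDiff h)^[k] f) ((fwdDiff h)^[k] f' x) x := by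
  induction k with
  | zero => intro f f' hf x; simpa using hf x
  | succ k ih =>
    intro f f' hf x
    simp only [Function.iterate_succ_apply]
    refine ih _ _ (fun y => ?_) x
    exact ((hf (y + h)).comp_add_const y h).sub (hf y)

/-- The mean value inequality, applied once for each difference. -/
lemma norm_fwdDiff_iter_le_of_iteratedDeriv {h : ℝ} (hh : 0 ≤ h) (k : ℕ) :
    ∀ (f : ℝ → ℂ) (c s : ℝ), ContDiff ℝ ∞ f →
      (∀ y ∈ Set.Icc s (s + k * h), ‖iteratedDeriv k f y‖ ≤ c) →
      ‖(fwdDiff h)^[k] f s‖ ≤ c * h ^ k := by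
  induction k with
  | zero =>
    intro f c s _ hf
    simpa using hf s (by simp)
  | succ k ih =>
    intro f c s hsm hf
    have hd : ∀ x, HasDerivAt f (deriv f x) x := fun x =>
      ((hsm.differentiable (by simp)) x).hasDerivAt
    have hsm' : ContDiff ℝ ∞ (deriv f) := by
      have := hsm.iterate_deriv 1
      simpa using this
    have h1 : ∀ y ∈ Set.Ico s (s + h), ‖(fwdDiff h)^[k] (deriv f) y‖ ≤ c * h ^ k := by
      intro y hy
      refine ih _ c y hsm' fun w hw => ?_
      rw [← iteratedDeriv_succ']
      refine hf w ⟨hy.1.trans hw.1, hw.2.trans ?_⟩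
      have := hy.2
      push_cast
      nlinarith
    have h2 := norm_image_sub_le_of_norm_deriv_le_segment'
      (fun y _ => (hasDerivAt_fwdDiff_iter h k f _ hd y).hasDerivWithinAt) h1 (s + h)
      (by simp [hh])
    rw [Function.iterate_succ_apply']
    refine h2.trans (le_of_eq ?_)
    ring

lemma diffBound_of_iteratedDeriv {N : ℕ} {c : ℝ} {f : ℝ → ℂ} (hsm : ContDiff ℝ ∞ f)
    (hf : ∀ k ≤ N, ∀ s ∈ Set.Icc (0 : ℝ) 1, ‖iteratedDeriv k f s‖ ≤ c) : DiffBound N c f :=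
  fun k hk _ s hh hs hs1 => norm_fwdDiff_iter_le_of_iteratedDeriv hh k f c s hsm fun y hy =>
    hf k hk y ⟨hs.trans hy.1, hy.2.trans hs1⟩

lemma expi_add (x y : ℝ) : expi (x + y) = expi x * expi y := by
  simp only [expi, ← Complex.exp_add]
  push_cast
  ring_nf

lemma norm_expi (x : ℝ) : ‖expi x‖ = 1 := by
  rw [expi, Complex.norm_exp]
  simp

lemma expi_eq (x : ℝ) : expi x = Complex.exp (((2 * Real.pi * x : ℝ) : ℂ) * Complex.I) := by
  rw [expi]
  push_cast
  ring_nf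

@[fun_prop]
lemma continuous_expi : Continuous expi := by
  unfold expi
  fun_prop

lemma norm_expi_sub_one_le (x : ℝ) : ‖expi x - 1‖ ≤ 2 * Real.pi * |x| := by
  rw [expi_eq, mul_comm]
  have := Real.norm_exp_I_mul_ofReal_sub_one_le (x := 2 * Real.pi * x)
  refine this.trans (le_of_eq ?_)
  rw [Real.norm_eq_abs, abs_mul, abs_of_nonneg Real.two_pi_pos.le]

lemma diffBound_expi_linear (N : ℕ) (β : ℝ) :
    DiffBound N ((1 + 2 * Real.pi * |β|) ^ N) (fun s => expi (β * s)) := by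
  intro k hk h s hh hs hs1
  have h1 : ∀ k : ℕ, (fwdDiff h)^[k] (fun s => expi (β * s)) =
      ((expi (β * h) - 1) ^ k) • (fun s => expi (β * s)) := by
    intro k
    induction k with
    | zero => simp
    | succ k ih =>
      rw [Function.iterate_succ_apply', ih, fwdDiff_const_smul, pow_succ, mul_smul]
      congr 1
      funext x
      simp only [fwdDiff, Pi.smul_apply, smul_eq_mul, mul_add, expi_add]
      ring
  rw [h1 k, Pi.smul_apply, smul_eq_mul, norm_mul, norm_expi, mul_one, norm_pow]
  have h2 : ‖expi (β * h) - 1‖ ≤ (1 + 2 * Real.pi * |β|) * h := by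
    refine (norm_expi_sub_one_le _).trans ?_
    rw [abs_mul, abs_of_nonneg hh]
    nlinarith
  have h3 : (1 : ℝ) ≤ 1 + 2 * Real.pi * |β| := by
    have := Real.pi_pos
    have := abs_nonneg β
    nlinarith [mul_nonneg Real.pi_pos.le (abs_nonneg β)]
  calc ‖expi (β * h) - 1‖ ^ k ≤ ((1 + 2 * Real.pi * |β|) * h) ^ k := by gcongr
    _ = (1 + 2 * Real.pi * |β|) ^ k * h ^ k := mul_pow _ _ _
    _ ≤ _ := by gcongr

lemma contDiff_expi : ContDiff ℝ ∞ expi := by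
  unfold expi
  exact Complex.contDiff_exp.comp (contDiff_const.mul Complex.ofRealCLM.contDiff)

lemma iteratedDeriv_expi (k : ℕ) (x : ℝ) :
    iteratedDeriv k expi x = (2 * Real.pi * Complex.I) ^ k * expi x := by
  induction k generalizing x with
  | zero => simp
  | succ k ih =>
    rw [iteratedDeriv_succ, show iteratedDeriv k expi = _ from funext ih]
    have h1 : HasDerivAt expi (expi x * (2 * Real.pi * Complex.I)) x := by
      unfold expi
      have := ((Complex.ofRealCLM.hasDerivAt (x := x)).const_mul (2 * Real.pi * Complex.I)).cexp
      simpa using this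
    rw [(h1.const_mul _).deriv]
    ring

lemma exists_diffBound_expi_quadratic (N : ℕ) :
    ∃ C : ℝ, 0 ≤ C ∧ ∀ u : ℝ, DiffBound N (C * (1 + |u|) ^ N) (fun s => expi (u * s ^ 2)) := by
  refine ⟨N.factorial * (2 * Real.pi) ^ N * 2 ^ N, by positivity, fun u => ?_⟩
  have hq : ContDiff ℝ ∞ (fun s : ℝ => u * s ^ 2) := by fun_prop
  refine diffBound_of_iteratedDeriv (contDiff_expi.comp hq) fun k hk s hs => ?_
  have hpi : (1 : ℝ) ≤ 2 * Real.pi := by linarith [Real.pi_gt_three]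
  have h1 := norm_iteratedFDeriv_comp_le (n := k) (C := (2 * Real.pi) ^ k) (D := 2 * (1 + |u|))
    contDiff_expi hq (by exact_mod_cast le_top) s
    (fun i hi => by
      rw [norm_iteratedFDeriv_eq_norm_iteratedDeriv, iteratedDeriv_expi, norm_mul, norm_expi,
        mul_one, norm_pow]
      simp only [norm_mul, Complex.norm_I, mul_one, Complex.norm_real, Complex.norm_ofNat,
        Real.norm_eq_abs, abs_of_pos Real.pi_pos]
      exact pow_le_pow_right₀ hpi hi)
    (fun i hi1 hi2 => by
      rw [norm_iteratedFDeriv_eq_norm_iteratedDeriv, iteratedDeriv_const_mul_field]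
      have hu := abs_nonneg u
      have h2 : ‖iteratedDeriv i (fun s : ℝ => s ^ 2) s‖ ≤ 2 := by
        rw [iteratedDeriv_pow]
        obtain ⟨h0, h1⟩ := hs
        match i with
        | 0 => omega
        | 1 => simp [Nat.descFactorial, abs_of_nonneg h0]; linarith
        | 2 => simp [Nat.descFactorial]
        | (n + 3) => simp [Nat.descFactorial]
      rw [norm_mul, Real.norm_eq_abs]
      calc |u| * ‖iteratedDeriv i (fun s : ℝ => s ^ 2) s‖ ≤ |u| * 2 := by gcongr
        _ ≤ 2 * (1 + |u|) := by linarith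
        _ ≤ _ := le_self_pow₀ (by linarith) (by omega))
  rw [norm_iteratedFDeriv_eq_norm_iteratedDeriv] at h1
  have h5 : (1 : ℝ) ≤ 1 + |u| := by linarith [abs_nonneg u]
  calc _ ≤ _ := h1
    _ ≤ N.factorial * (2 * Real.pi) ^ N * (2 * (1 + |u|)) ^ N := by
        gcongr
        linarith
    _ = _ := by rw [mul_pow 2 (1 + |u|)]; ring

/-- Smoothness of a Schwartz function along all segments of length at most one, with decay in the
starting point. -/
lemma exists_diffBound_schwartz {E : Type*} [NormedAddCommGroup E] [NormedSpace ℝ E]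
    (g : SchwartzMap E ℂ) (N K : ℕ) :
    ∃ C : ℝ, 0 ≤ C ∧ ∀ z v : E, ‖v‖ ≤ 1 →
      DiffBound N (C * decay K z) (fun s => g (z + s • v)) := by
  set D := 2 ^ K * (Finset.Iic (K, N)).sup (fun m => SchwartzMap.seminorm ℝ m.1 m.2) g with hD
  refine ⟨2 ^ K * D, by positivity, fun z v hv => ?_⟩
  have hline : ContDiff ℝ ∞ (fun s : ℝ => z + s • v) := by fun_prop
  refine diffBound_of_iteratedDeriv ((g.smooth ⊤).comp hline) fun k hk s hs => ?_
  rw [← norm_iteratedFDeriv_eq_norm_iteratedDeriv]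
  set ℓ : ℝ →L[ℝ] E := ContinuousLinearMap.toSpanSingleton ℝ v
  have h1 : (fun s : ℝ => g (z + s • v)) = (fun y => g (z + y)) ∘ ℓ := by
    funext s
    simp [ℓ]
  have hg' : ContDiff ℝ ∞ (fun y => g (z + y)) := (g.smooth ⊤).comp (by fun_prop)
  rw [h1, ContinuousLinearMap.iteratedFDeriv_comp_right ℓ hg' s (by exact_mod_cast le_top),
    iteratedFDeriv_comp_add_left]
  refine (ContinuousMultilinearMap.norm_compContinuousLinearMap_le _ _).trans ?_
  have hl : ‖ℓ‖ ≤ 1 := by simpa [ℓ] using hv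
  have hp : (∏ _i : Fin k, ‖ℓ‖) ≤ 1 := by
    simpa using pow_le_one₀ (norm_nonneg ℓ) hl
  have h2 : (1 + ‖z + ℓ s‖) ^ K * ‖iteratedFDeriv ℝ k g (z + ℓ s)‖ ≤ D :=
    SchwartzMap.one_add_le_sup_seminorm_apply (𝕜 := ℝ) (m := (K, N)) le_rfl hk g _
  have h3 : 1 + ‖z‖ ≤ 2 * (1 + ‖z + ℓ s‖) := by
    have h4 : ‖ℓ s‖ ≤ 1 := by
      refine (ℓ.le_opNorm s).trans ?_
      have : ‖s‖ ≤ 1 := by rw [Real.norm_eq_abs, abs_of_nonneg hs.1]; exact hs.2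
      nlinarith [norm_nonneg ℓ, norm_nonneg s]
    have h5 : ‖z‖ ≤ ‖z + ℓ s‖ + ‖ℓ s‖ := by
      simpa using norm_sub_le (z + ℓ s) (ℓ s)
    have := norm_nonneg (z + ℓ s)
    linarith
  have h6 : (1 + ‖z‖) ^ K ≤ 2 ^ K * (1 + ‖z + ℓ s‖) ^ K := by
    rw [← mul_pow]
    gcongr
  rw [decay, ← div_eq_mul_inv, le_div_iff₀ (by positivity)]
  calc ‖iteratedFDeriv ℝ k (⇑g) (z + ℓ s)‖ * (∏ _i : Fin k, ‖ℓ‖) * (1 + ‖z‖) ^ K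
      ≤ ‖iteratedFDeriv ℝ k (⇑g) (z + ℓ s)‖ * 1 * (2 ^ K * (1 + ‖z + ℓ s‖) ^ K) := by gcongr
    _ = 2 ^ K * ((1 + ‖z + ℓ s‖) ^ K * ‖iteratedFDeriv ℝ k g (z + ℓ s)‖) := by ring
    _ ≤ _ := by gcongr

/-- Integration by parts in the form of finite differences: if translating the variable by `s`
multiplies the integral by the phase `e(ρ s)`, then `N` differences of step `1 / (2 ρ)` gain the
factor `(4 ρ)^{-N}`. -/
lemma norm_integral_le_of_diffBound {Z : Type*} [MeasurableSpace Z] {μ : Measure Z} {N : ℕ}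
    {c : Z → ℝ} {F : Z → ℝ → ℂ} (hF : ∀ z, DiffBound N (c z) (F z))
    (hint : ∀ s, Integrable (fun z => F z s) μ) (hc : Integrable c μ) {ρ : ℝ} (hρ : 0 < ρ)
    (hN : N ≤ 2 * ρ) (hshift : ∀ s, ∫ z, F z s ∂μ = expi (ρ * s) * ∫ z, F z 0 ∂μ) :
    ‖∫ z, F z 0 ∂μ‖ ≤ ((4 * ρ) ^ N)⁻¹ * ∫ z, c z ∂μ := by
  -- for the step `1 / (2 ρ)` each difference multiplies `e(ρ s)` by `e(1/2) - 1 = -2`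
  have h1 := DiffBound.integral hF hint hc N le_rfl (1 / (2 * ρ)) 0 (by positivity) le_rfl
    (by rw [zero_add, mul_one_div, div_le_one (by positivity)]; exact hN)
  set I := ∫ z, F z 0 ∂μ
  have h2 : (fun s => ∫ z, F z s ∂μ) = I • fun s => expi (ρ * s) := by
    funext s
    rw [hshift s, Pi.smul_apply, smul_eq_mul, mul_comm]
  have hhalf : expi (1 / 2) = -1 := by
    rw [expi_eq]
    rw [show ((2 * Real.pi * (1 / 2) : ℝ) : ℂ) = (Real.pi : ℂ) by push_cast; ring]
    exact Complex.exp_pi_mul_I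
  have h3 : ∀ k : ℕ, (fwdDiff (1 / (2 * ρ)))^[k] (fun s => expi (ρ * s)) =
      ((-2 : ℂ) ^ k) • (fun s => expi (ρ * s)) := by
    intro k
    induction k with
    | zero => simp
    | succ k ih =>
      rw [Function.iterate_succ_apply', ih, fwdDiff_const_smul, pow_succ, mul_smul]
      congr 1
      funext x
      simp only [fwdDiff, Pi.smul_apply, smul_eq_mul, mul_add, expi_add]
      rw [show ρ * (1 / (2 * ρ)) = 1 / 2 by field_simp, hhalf]
      ring
  rw [h2, fwdDiff_iter_const_smul, h3 N] at h1
  simp only [Pi.smul_apply, smul_eq_mul, norm_mul, norm_expi, mul_one, norm_pow, norm_neg,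
    Complex.norm_ofNat] at h1
  have h4 : ‖I‖ = ‖I‖ * 2 ^ N * (2 ^ N)⁻¹ := by field_simp
  rw [h4]
  calc ‖I‖ * 2 ^ N * (2 ^ N)⁻¹ ≤ (∫ z, c z ∂μ) * (1 / (2 * ρ)) ^ N * (2 ^ N)⁻¹ := by gcongr
    _ = _ := by
      rw [show (4 * ρ) = 2 * (2 * ρ) by ring, mul_pow 2 (2 * ρ), one_div, inv_pow, mul_inv]
      ring

/-! ### Decay, and the partial Fourier transform of a Schwartz function -/

section Decay

variable {E : Type*} [NormedAddCommGroup E]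

lemma decay_pos (K : ℕ) (x : E) : 0 < decay K x := by
  unfold decay
  positivity

lemma decay_le_one (K : ℕ) (x : E) : decay K x ≤ 1 :=
  inv_le_one_of_one_le₀ (one_le_pow₀ (by linarith [norm_nonneg x]))

lemma decay_add (K L : ℕ) (x : E) : decay (K + L) x = decay K x * decay L x := by
  rw [decay, decay, decay, pow_add, mul_inv]

lemma decay_mul_pow (K : ℕ) (x : E) : decay K x * (1 + ‖x‖) ^ K = 1 := by
  unfold decay
  field_simp

lemma decay_add_le (K : ℕ) (x z : E) : decay K (x + z) ≤ decay K x * (1 + ‖z‖) ^ K := by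
  have h1 : 1 + ‖x‖ ≤ (1 + ‖x + z‖) * (1 + ‖z‖) := by
    have h2 : ‖x‖ ≤ ‖x + z‖ + ‖z‖ := by simpa using norm_sub_le (x + z) z
    nlinarith [norm_nonneg (x + z), norm_nonneg z]
  unfold decay
  rw [inv_mul_eq_div, le_div_iff₀ (by positivity), inv_mul_le_iff₀ (by positivity), ← mul_pow]
  gcongr

lemma decay_sub_le (K : ℕ) (x z : E) : decay K (x - z) ≤ decay K x * (1 + ‖z‖) ^ K := by
  simpa [sub_eq_add_neg] using decay_add_le K x (-z)

@[fun_prop]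
lemma continuous_decay (K : ℕ) : Continuous (decay K : E → ℝ) := by
  unfold decay
  exact Continuous.inv₀ (by fun_prop) fun x => by positivity

lemma decay_neg (K : ℕ) (x : E) : decay K (-x) = decay K x := by simp [decay]

end Decay

lemma integrable_decay {d K : ℕ} (hK : d < K) : Integrable (decay K : Space d → ℝ) := by
  have h := integrable_one_add_norm (E := Space d) (μ := volume) (r := K) (by simpa using hK)
  refine h.congr (Eventually.of_forall fun x => ?_)
  simp only [decay]
  rw [Real.rpow_neg (by positivity), Real.rpow_natCast]

lemma decay_prod_le {d : ℕ} (K L : ℕ) (x y : Space d) :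
    decay (K + L) (x, y) ≤ decay K x * decay L y := by
  rw [decay_add]
  have h1 : decay K (x, y) ≤ decay K x := by
    unfold decay
    gcongr
    exact norm_fst_le (x, y)
  have h2 : decay L (x, y) ≤ decay L y := by
    unfold decay
    gcongr
    exact norm_snd_le (x, y)
  exact mul_le_mul h1 h2 (decay_pos _ _).le (decay_pos _ _).le

lemma exists_norm_le_decay {E : Type*} [NormedAddCommGroup E] [NormedSpace ℝ E]
    (g : SchwartzMap E ℂ) (K : ℕ) : ∃ C : ℝ, 0 ≤ C ∧ ∀ z : E, ‖g z‖ ≤ C * decay K z := by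
  obtain ⟨C, hC, h⟩ := exists_diffBound_schwartz g 0 K
  exact ⟨C, hC, fun z => by simpa using (h z 0 (by simp)).norm_zero_le⟩

section Tilde

variable {d : ℕ}

lemma tildeTransform_eq (a : SchwartzMap (Space d × Space d) ℂ) (ξ y : Space d) :
    tildeTransform a ξ y = ∫ x, expi (-inner ℝ x ξ) * a (x, y) := by
  rw [tildeTransform, Real.fourier_eq]
  refine integral_congr_ae (Eventually.of_forall fun x => ?_)
  simp only [Circle.smul_def, smul_eq_mul, Real.fourierChar_apply, expi_eq]

lemma integrable_decay_slice (y : Space d) {K : ℕ} (hK : d < K) (c : ℝ) :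
    Integrable (fun x : Space d => c * decay K (x, y)) := by
  refine Integrable.const_mul ?_ c
  refine (integrable_decay hK).mono' (by fun_prop) (Eventually.of_forall fun x => ?_)
  rw [Real.norm_of_nonneg (decay_pos _ _).le]
  unfold decay
  gcongr
  exact norm_fst_le (x, y)

lemma exists_tildeTransform_diffBound_aux (a : SchwartzMap (Space d × Space d) ℂ) (N K : ℕ) :
    ∃ C : ℝ, 0 ≤ C ∧ ∀ ξ y v : Space d, ‖v‖ ≤ 1 →
      DiffBound N (C * decay K y) (fun s => tildeTransform a ξ (y + s • v)) := by
  obtain ⟨C, hC, h⟩ := exists_diffBound_schwartz a N (d + 1 + K)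
  refine ⟨C * ∫ x : Space d, decay (d + 1) x,
    mul_nonneg hC (integral_nonneg fun x => (decay_pos _ _).le), fun ξ y v hv => ?_⟩
  simp only [tildeTransform_eq]
  have hint : ∀ y, Integrable (fun x : Space d => expi (-inner ℝ x ξ) * a (x, y)) := by
    intro y
    obtain ⟨C', _, h'⟩ := exists_norm_le_decay a (d + 1)
    refine (integrable_decay_slice y (Nat.lt_succ_self d) C').mono' ?_
      (Eventually.of_forall fun x => ?_)
    · have := a.continuous
      exact (by fun_prop : Continuous fun x : Space d =>
        expi (-inner ℝ x ξ) * a (x, y)).aestronglyMeasurable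
    · rw [norm_mul, norm_expi, one_mul]
      exact h' _
  have hD : DiffBound N (∫ x : Space d, C * decay (d + 1 + K) (x, y))
      (fun s => ∫ x, expi (-inner ℝ x ξ) * a (x, y + s • v)) := by
    refine DiffBound.integral (fun x => ?_) (fun s => hint _)
      (integrable_decay_slice y (by omega) C)
    have h1 := (h (x, y) (0, v) (by simpa using hv)).const_mul (expi (-inner ℝ x ξ))
    rw [norm_expi, one_mul] at h1
    simpa using h1
  refine hD.mono ?_
  rw [mul_assoc, ← integral_mul_const, ← integral_const_mul]
  refine integral_mono (integrable_decay_slice y (by omega) C)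
    (((integrable_decay (Nat.lt_succ_self d)).mul_const _).const_mul _) fun x => ?_
  exact mul_le_mul_of_nonneg_left (decay_prod_le (d + 1) K x y) hC

/-- The slice `x ↦ a(x, y)` of a Schwartz function on a product. -/
noncomputable def slice (y : Space d) (a : SchwartzMap (Space d × Space d) ℂ) :
    SchwartzMap (Space d) ℂ :=
  SchwartzMap.compCLMOfAntilipschitz (g := fun x : Space d => (x, y)) (K := 1) ℂ
    (by
      have h : (fun x : Space d => (x, y)) =
        fun x => ContinuousLinearMap.inl ℝ (Space d) (Space d) x + (0, y) := by
          funext x; simp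
      rw [h]
      fun_prop)
    (fun x x' => by simp [Prod.edist_eq]) a

lemma slice_apply (y : Space d) (a : SchwartzMap (Space d × Space d) ℂ) (x : Space d) :
    slice y a x = a (x, y) := rfl

open LineDeriv in
lemma tildeTransform_lineDerivOp (a : SchwartzMap (Space d × Space d) ℂ) (w ξ y : Space d) :
    tildeTransform (∂_{(w, (0 : Space d))} a) ξ y =
      (2 * Real.pi * Complex.I) * (inner ℝ ξ w : ℂ) * tildeTransform a ξ y := by
  have h1 : slice y (∂_{(w, (0 : Space d))} a) = ∂_{w} (slice y a) := by
    ext x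
    rw [slice_apply, SchwartzMap.lineDerivOp_apply_eq_fderiv,
      SchwartzMap.lineDerivOp_apply_eq_fderiv]
    have h2 : HasFDerivAt (fun x : Space d => a (x, y))
        ((fderiv ℝ a (x, y)).comp (ContinuousLinearMap.inl ℝ (Space d) (Space d))) x := by
      refine (a.differentiable (x, y)).hasFDerivAt.comp x ?_
      have h3 := (ContinuousLinearMap.inl ℝ (Space d) (Space d)).hasFDerivAt (x := x)
      have h4 := h3.add_const (0, y)
      simpa using h4
    have h5 : fderiv ℝ (slice y a) x = _ := h2.fderiv
    rw [h5]
    simp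
  have h6 : ∀ b : SchwartzMap (Space d × Space d) ℂ,
      tildeTransform b ξ y = 𝓕 (slice y b) ξ := fun b => rfl
  rw [h6, h1, SchwartzMap.fourier_lineDerivOp_eq, h6]
  have : (fun x : Space d => inner ℝ x w).HasTemperateGrowth := by fun_prop
  simp [SchwartzMap.smulLeftCLM_apply_apply this]
  ring

open LineDeriv in
/-- Smoothness of the partial Fourier transform in the second variable, with rapid decay in both.
The decay in `ξ` comes from the bounds for the derivatives of `a` in the directions of the first
variable. -/
lemma exists_tildeTransform_diffBound (a : SchwartzMap (Space d × Space d) ℂ) (N K L : ℕ) :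
    ∃ C : ℝ, 0 ≤ C ∧ ∀ ξ y v : Space d, ‖v‖ ≤ 1 →
      DiffBound N (C * decay L ξ * decay K y) (fun s => tildeTransform a ξ (y + s • v)) := by
  obtain ⟨C₀, hC₀, h₀⟩ := exists_tildeTransform_diffBound_aux a N K
  have hb := fun i : Fin d => exists_tildeTransform_diffBound_aux
    ((fun b => ∂_{(EuclideanSpace.single i (1 : ℝ), (0 : Space d))} b)^[L] a) N K
  choose C hC h using hb
  have hiter : ∀ (n : ℕ) (i : Fin d) (ξ y : Space d), tildeTransform
      ((fun b => ∂_{(EuclideanSpace.single i (1 : ℝ), (0 : Space d))} b)^[n] a) ξ y =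
        ((2 * Real.pi * Complex.I) * (ξ i : ℂ)) ^ n * tildeTransform a ξ y := by
    intro n i ξ y
    induction n with
    | zero => simp
    | succ n ih =>
      rw [Function.iterate_succ_apply', tildeTransform_lineDerivOp, ih, pow_succ]
      simp only [EuclideanSpace.inner_single_right, one_mul]
      simp
      ring
  have hpi : (1 : ℝ) ≤ 2 * Real.pi := by linarith [Real.pi_gt_three]
  refine ⟨(2 * (d + 1)) ^ L * (C₀ + ∑ i, C i), by
    have := Finset.sum_nonneg fun i (_ : i ∈ Finset.univ) => hC i
    positivity, fun ξ y v hv => ?_⟩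
  intro k hk t s ht hs hst
  set Dl := (fwdDiff t)^[k] (fun s => tildeTransform a ξ (y + s • v)) s with hDl
  have hS := decay_pos K y
  have h1 : ‖Dl‖ ≤ C₀ * decay K y * t ^ k := h₀ ξ y v hv k hk t s ht hs hst
  have h2 : ∀ i, |ξ i| ^ L * ‖Dl‖ ≤ C i * decay K y * t ^ k := by
    intro i
    have h3 := h i ξ y v hv k hk t s ht hs hst
    have h4 : (fun s : ℝ => tildeTransform
        ((fun b => ∂_{(EuclideanSpace.single i (1 : ℝ), (0 : Space d))} b)^[L] a) ξ (y + s • v)) =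
        (((2 * Real.pi * Complex.I) * (ξ i : ℂ)) ^ L) •
          (fun s => tildeTransform a ξ (y + s • v)) := by
      funext s
      rw [hiter, Pi.smul_apply, smul_eq_mul]
    rw [h4, fwdDiff_iter_const_smul, Pi.smul_apply, smul_eq_mul, norm_mul, norm_pow] at h3
    refine le_trans ?_ h3
    gcongr
    simp only [norm_mul, Complex.norm_I, mul_one, Complex.norm_real, Complex.norm_ofNat,
      Real.norm_eq_abs, abs_of_pos Real.pi_pos]
    nlinarith [abs_nonneg (ξ i)]
  have h5 : ‖ξ‖ ≤ ∑ i, |ξ i| := by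
    have := (EuclideanSpace.basisFun (Fin d) ℝ).sum_repr ξ
    calc ‖ξ‖ = ‖∑ i, (EuclideanSpace.basisFun (Fin d) ℝ).repr ξ i •
          (EuclideanSpace.basisFun (Fin d) ℝ) i‖ := by rw [this]
      _ ≤ ∑ i, ‖(EuclideanSpace.basisFun (Fin d) ℝ).repr ξ i •
          (EuclideanSpace.basisFun (Fin d) ℝ) i‖ := norm_sum_le _ _
      _ = ∑ i, |ξ i| := by simp [norm_smul]
  -- the largest of `1` and the coordinates is at least `(1 + ‖ξ‖) / (d + 1)`
  have h6 : (1 + ‖ξ‖) ^ L ≤ (2 * (d + 1)) ^ L * (1 + ∑ i, |ξ i| ^ L) := by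
    have hsn : 0 ≤ ∑ i, |ξ i| ^ L := Finset.sum_nonneg fun i _ => by positivity
    by_cases hbig : ∃ i, 1 ≤ |ξ i| ∧ ∀ j, |ξ j| ≤ |ξ i|
    · obtain ⟨i, hi1, hi⟩ := hbig
      have h7 : 1 + ‖ξ‖ ≤ 2 * (d + 1) * |ξ i| := by
        have : ∑ j, |ξ j| ≤ d * |ξ i| := by
          simpa using Finset.sum_le_card_nsmul Finset.univ (fun j => |ξ j|) _ fun j _ => hi j
        nlinarith [mul_nonneg (Nat.cast_nonneg (α := ℝ) d) (abs_nonneg (ξ i))]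
      calc (1 + ‖ξ‖) ^ L ≤ (2 * (d + 1) * |ξ i|) ^ L := by gcongr
        _ = (2 * (d + 1)) ^ L * |ξ i| ^ L := mul_pow _ _ _
        _ ≤ (2 * (d + 1)) ^ L * (1 + ∑ i, |ξ i| ^ L) := by
          gcongr
          have := Finset.single_le_sum (f := fun i => |ξ i| ^ L)
            (fun i _ => by positivity) (Finset.mem_univ i)
          simp only at this
          linarith
    · have h8 : ∀ j, |ξ j| ≤ 1 := by
        intro j
        by_contra hj
        obtain ⟨i, _, hi⟩ := Finset.exists_max_image Finset.univ (fun i => |ξ i|)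
          ⟨j, Finset.mem_univ j⟩
        exact hbig ⟨i, (lt_of_not_ge hj).le.trans (hi j (Finset.mem_univ j)),
          fun j => hi j (Finset.mem_univ j)⟩
      have h9 : 1 + ‖ξ‖ ≤ 2 * (d + 1) := by
        have : ∑ j, |ξ j| ≤ d * 1 := by
          simpa using Finset.sum_le_card_nsmul Finset.univ (fun j => |ξ j|) _ fun j _ => h8 j
        linarith
      calc (1 + ‖ξ‖) ^ L ≤ (2 * (d + 1)) ^ L := by gcongr
        _ ≤ _ := le_mul_of_one_le_right (by positivity) (by linarith)
  have h10 : (1 + ‖ξ‖) ^ L * ‖Dl‖ ≤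
      (2 * (d + 1)) ^ L * (C₀ + ∑ i, C i) * decay K y * t ^ k := by
    calc (1 + ‖ξ‖) ^ L * ‖Dl‖ ≤ (2 * (d + 1)) ^ L * (1 + ∑ i, |ξ i| ^ L) * ‖Dl‖ := by gcongr
      _ = (2 * (d + 1)) ^ L * (‖Dl‖ + ∑ i, |ξ i| ^ L * ‖Dl‖) := by
        rw [← Finset.sum_mul]; ring
      _ ≤ (2 * (d + 1)) ^ L * (C₀ * decay K y * t ^ k + ∑ i, C i * decay K y * t ^ k) := by
        exact mul_le_mul_of_nonneg_left (add_le_add h1 (Finset.sum_le_sum fun i _ => h2 i))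
          (by positivity)
      _ = _ := by rw [← Finset.sum_mul, ← Finset.sum_mul]; ring
  have h11 : ‖Dl‖ = decay L ξ * ((1 + ‖ξ‖) ^ L * ‖Dl‖) := by
    rw [← mul_assoc, decay_mul_pow, one_mul]
  rw [h11]
  calc decay L ξ * ((1 + ‖ξ‖) ^ L * ‖Dl‖)
      ≤ decay L ξ * ((2 * (d + 1)) ^ L * (C₀ + ∑ i, C i) * decay K y * t ^ k) :=
        mul_le_mul_of_nonneg_left h10 (decay_pos _ _).le
    _ = _ := by ring

lemma continuous_tildeTransform (a : SchwartzMap (Space d × Space d) ℂ) :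
    Continuous fun p : Space d × Space d => tildeTransform a p.1 p.2 := by
  simp only [tildeTransform_eq]
  obtain ⟨C, hC, h⟩ := exists_norm_le_decay a (d + 1)
  have := a.continuous
  refine continuous_of_dominated (bound := fun x : Space d => C * decay (d + 1) x)
    (fun p => ?_) (fun p => Eventually.of_forall fun x => ?_)
    ((integrable_decay (Nat.lt_succ_self d)).const_mul C) (Eventually.of_forall fun x => ?_)
  · exact (by fun_prop : Continuous fun x : Space d =>
        expi (-inner ℝ x p.1) * a (x, p.2)).aestronglyMeasurable
  · rw [norm_mul, norm_expi, one_mul]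
    refine (h _).trans (mul_le_mul_of_nonneg_left ?_ hC)
    unfold decay
    gcongr
    exact norm_fst_le (x, p.2)
  · fun_prop

end Tilde

/-! ### Collisions, and bounds against test functions -/

variable {d : ℕ}

/-- The `L²` norm of a Schwartz function. -/
noncomputable def l2norm (ψ : SchwartzMap (Space d) ℂ) : ℝ := √(∫ x, ‖ψ x‖ ^ 2)

/-- The supremum norm of a Schwartz function. -/
noncomputable def supnorm (ψ : SchwartzMap (Space d) ℂ) : ℝ := SchwartzMap.seminorm ℝ 0 0 ψ

lemma l2norm_nonneg (ψ : SchwartzMap (Space d) ℂ) : 0 ≤ l2norm ψ := Real.sqrt_nonneg _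

lemma supnorm_nonneg (ψ : SchwartzMap (Space d) ℂ) : 0 ≤ supnorm ψ := apply_nonneg _ _

lemma norm_le_supnorm (ψ : SchwartzMap (Space d) ℂ) (x : Space d) : ‖ψ x‖ ≤ supnorm ψ :=
  SchwartzMap.norm_le_seminorm ℝ ψ x

lemma supnorm_le {ψ : SchwartzMap (Space d) ℂ} {M : ℝ} (hM : 0 ≤ M) (h : ∀ x, ‖ψ x‖ ≤ M) :
    supnorm ψ ≤ M :=
  SchwartzMap.seminorm_le_bound ℝ 0 0 ψ hM fun x => by simpa using h x

lemma integrable_norm_sq (ψ : SchwartzMap (Space d) ℂ) : Integrable fun x => ‖ψ x‖ ^ 2 :=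
  (ψ.memLp 2).integrable_norm_pow (by norm_num)

lemma l2norm_sq (ψ : SchwartzMap (Space d) ℂ) : l2norm ψ ^ 2 = ∫ x, ‖ψ x‖ ^ 2 :=
  Real.sq_sqrt (integral_nonneg fun x => by positivity)

/-- The Cauchy–Schwarz inequality, for nonnegative real functions. -/
lemma integral_mul_le_sqrt_mul_sqrt {Z : Type*} [MeasurableSpace Z] {μ : Measure Z} {f g : Z → ℝ}
    (hf0 : ∀ z, 0 ≤ f z) (hg0 : ∀ z, 0 ≤ g z) (hfm : AEStronglyMeasurable f μ)
    (hgm : AEStronglyMeasurable g μ) (hf : Integrable (fun z => f z ^ 2) μ)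
    (hg : Integrable (fun z => g z ^ 2) μ) :
    ∫ z, f z * g z ∂μ ≤ √(∫ z, f z ^ 2 ∂μ) * √(∫ z, g z ^ 2 ∂μ) := by
  have h := integral_mul_le_Lp_mul_Lq_of_nonneg (μ := μ) (p := 2) (q := 2)
    Real.HolderConjugate.two_two (Eventually.of_forall hf0) (Eventually.of_forall hg0)
    (by simpa using (memLp_two_iff_integrable_sq hfm).2 hf)
    (by simpa using (memLp_two_iff_integrable_sq hgm).2 hg)
  simpa [Real.sqrt_eq_rpow] using h

/-- The change of the pair of momenta in a collision with momentum transfer `z`. The transfer acts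
on the first momentum when `g = 0` and, with the opposite sign, on the second one when `g = 1`; in
both cases `z` is added to the difference of the momenta. -/
noncomputable def step (g : Fin 2) (x : Space d × Space d) (z : Space d) : Space d × Space d :=
  (x.1 + (1 - ((g : ℕ) : ℝ)) • z, x.2 - ((g : ℕ) : ℝ) • z)

/-- The average `x ↦ ∫ k(z) Q(step g x z) dz` of `Q` over the momentum transfer in a collision. -/
noncomputable def collide (k : Space d → ℂ) (g : Fin 2) (Q : Space d × Space d → ℂ)
    (x : Space d × Space d) : ℂ :=
  ∫ z, k z * Q (step g x z)

lemma step_zero (x : Space d × Space d) (z : Space d) : step 0 x z = (x.1 + z, x.2) := by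
  simp [step]

lemma step_one (x : Space d × Space d) (z : Space d) : step 1 x z = (x.1, x.2 - z) := by
  simp [step]

lemma step_fst_sub_snd (g : Fin 2) (x : Space d × Space d) (z : Space d) :
    (step g x z).1 - (step g x z).2 = x.1 - x.2 + z := by
  simp only [step]
  module

@[fun_prop]
lemma continuous_step (g : Fin 2) :
    Continuous fun p : (Space d × Space d) × Space d => step g p.1 p.2 := by
  unfold step
  fun_prop

/-- Bounded measurable functions. -/
structure BoundedMeasurable (Q : Space d × Space d → ℂ) : Prop where
  stronglyMeasurable : StronglyMeasurable Q
  bounded : ∃ M, ∀ x, ‖Q x‖ ≤ M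

/-- The quantitative weak bound on functions of the pair of momenta that is stable under collisions:
`Q` is tested in each variable against Schwartz functions, in the norm `κ ‖·‖₂ + ‖·‖_∞`, and in both
variables against products, in the `L²` norm. The parameter `κ²` is the order of the number of
scatterers. -/
structure TestBound (κ c : ℝ) (Q : Space d × Space d → ℂ) : Prop where
  nonneg : 0 ≤ c
  left : ∀ (ψ : SchwartzMap (Space d) ℂ) (B : Space d),
    ‖∫ A, ψ A * Q (A, B)‖ ≤ c * (κ * l2norm ψ + supnorm ψ)
  right : ∀ (φ : SchwartzMap (Space d) ℂ) (A : Space d),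
    ‖∫ B, φ B * Q (A, B)‖ ≤ c * (κ * l2norm φ + supnorm φ)
  both : ∀ ψ φ : SchwartzMap (Space d) ℂ,
    ‖∫ x : Space d × Space d, ψ x.1 * φ x.2 * Q x‖ ≤ c * (l2norm ψ * l2norm φ)

lemma BoundedMeasurable.swap {Q : Space d × Space d → ℂ} (hQ : BoundedMeasurable Q) :
    BoundedMeasurable fun x => Q x.swap :=
  ⟨hQ.stronglyMeasurable.comp_measurable measurable_swap,
    hQ.bounded.imp fun _ hM _ => hM _⟩

lemma BoundedMeasurable.mul {Q Q' : Space d × Space d → ℂ} (hQ : BoundedMeasurable Q)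
    (hQ' : BoundedMeasurable Q') : BoundedMeasurable fun x => Q x * Q' x := by
  obtain ⟨M, hM⟩ := hQ.bounded
  obtain ⟨M', hM'⟩ := hQ'.bounded
  refine ⟨hQ.stronglyMeasurable.mul hQ'.stronglyMeasurable, M * M', fun x => ?_⟩
  rw [norm_mul]
  exact mul_le_mul (hM x) (hM' x) (norm_nonneg _) ((norm_nonneg _).trans (hM x))

lemma BoundedMeasurable.sum {ι : Type*} {s : Finset ι} {Q : ι → Space d × Space d → ℂ}
    (hQ : ∀ i ∈ s, BoundedMeasurable (Q i)) : BoundedMeasurable fun x => ∑ i ∈ s, Q i x := by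
  classical
  induction s using Finset.induction_on with
  | empty => exact ⟨by simpa using stronglyMeasurable_const, 0, by simp⟩
  | insert i s hi ih =>
    obtain ⟨h1, M, hM⟩ := hQ i (Finset.mem_insert_self _ _)
    obtain ⟨h2, M', hM'⟩ := ih fun j hj => hQ j (Finset.mem_insert_of_mem hj)
    simp only [Finset.sum_insert hi]
    exact ⟨h1.add h2, M + M', fun x => (norm_add_le _ _).trans (add_le_add (hM x) (hM' x))⟩

lemma BoundedMeasurable.collide {k : Space d → ℂ} (hk : Integrable k) (g : Fin 2)
    {Q : Space d × Space d → ℂ} (hQ : BoundedMeasurable Q) :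
    BoundedMeasurable (collide k g Q) := by
  obtain ⟨M, hM⟩ := hQ.bounded
  constructor
  · -- `k` is replaced by a measurable representative
    have h1 : LorentzGas.collide k g Q = fun x => ∫ z, hk.1.mk k z * Q (step g x z) := by
      funext x
      refine integral_congr_ae ?_
      filter_upwards [hk.1.ae_eq_mk] with z hz
      rw [hz]
    rw [h1]
    have h2 : StronglyMeasurable fun p : (Space d × Space d) × Space d =>
        hk.1.mk k p.2 * Q (step g p.1 p.2) :=
      (hk.1.stronglyMeasurable_mk.comp_measurable measurable_snd).mul
        (hQ.stronglyMeasurable.comp_measurable (continuous_step g).measurable)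
    exact h2.integral_prod_right'
  · refine ⟨∫ z, ‖k z‖ * M, fun x => ?_⟩
    refine norm_integral_le_of_norm_le (hk.norm.mul_const M) (Eventually.of_forall fun z => ?_)
    rw [norm_mul]
    exact mul_le_mul_of_nonneg_left (hM _) (norm_nonneg _)

lemma integrable_collide {k : Space d → ℂ} (hk : Integrable k) (g : Fin 2)
    {Q : Space d × Space d → ℂ} (hQ : BoundedMeasurable Q) (x : Space d × Space d) :
    Integrable fun z => k z * Q (step g x z) := by
  obtain ⟨M, hM⟩ := hQ.bounded
  refine hk.mul_bdd (c := M) ?_ (Eventually.of_forall fun z => hM _)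
  exact (hQ.stronglyMeasurable.comp_measurable
    ((continuous_step g).comp (by fun_prop : Continuous fun z => (x, z))).measurable
      ).aestronglyMeasurable

section TestBoundBasic

variable {κ c : ℝ} {Q : Space d × Space d → ℂ}

lemma TestBound.swap (hQ : TestBound κ c Q) : TestBound κ c fun x => Q x.swap where
  nonneg := hQ.nonneg
  left := hQ.right
  right := hQ.left
  both ψ φ := by
    have h1 : ∫ x : Space d × Space d, ψ x.1 * φ x.2 * Q x.swap =
        ∫ x : Space d × Space d, φ x.1 * ψ x.2 * Q x := by
      rw [Measure.volume_eq_prod, ← integral_prod_swap]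
      refine integral_congr_ae (Eventually.of_forall fun x => ?_)
      simp only [Prod.fst_swap, Prod.snd_swap, Prod.swap_swap]
      ring
    rw [h1, mul_comm (l2norm ψ)]
    exact hQ.both φ ψ

lemma TestBound.mono (hκ : 0 ≤ κ) (hQ : TestBound κ c Q) {c' : ℝ} (h : c ≤ c') :
    TestBound κ c' Q where
  nonneg := hQ.nonneg.trans h
  left ψ B := (hQ.left ψ B).trans <| mul_le_mul_of_nonneg_right h <|
    add_nonneg (mul_nonneg hκ (l2norm_nonneg _)) (supnorm_nonneg _)
  right ψ B := (hQ.right ψ B).trans <| mul_le_mul_of_nonneg_right h <|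
    add_nonneg (mul_nonneg hκ (l2norm_nonneg _)) (supnorm_nonneg _)
  both ψ φ := (hQ.both ψ φ).trans <| mul_le_mul_of_nonneg_right h <|
    mul_nonneg (l2norm_nonneg _) (l2norm_nonneg _)

lemma TestBound.zero : TestBound κ 0 fun _ : Space d × Space d => 0 where
  nonneg := le_rfl
  left ψ B := by simp
  right ψ B := by simp
  both ψ φ := by simp

lemma TestBound.const_mul (w : ℂ) (hQ : TestBound κ c Q) :
    TestBound κ (‖w‖ * c) fun x => w * Q x where
  nonneg := mul_nonneg (norm_nonneg _) hQ.nonneg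
  left ψ B := by
    simp only [mul_left_comm _ w, integral_const_mul, norm_mul, mul_assoc]
    exact mul_le_mul_of_nonneg_left (hQ.left ψ B) (norm_nonneg _)
  right ψ B := by
    simp only [mul_left_comm _ w, integral_const_mul, norm_mul, mul_assoc]
    exact mul_le_mul_of_nonneg_left (hQ.right ψ B) (norm_nonneg _)
  both ψ φ := by
    simp only [mul_left_comm _ w, integral_const_mul, norm_mul, mul_assoc]
    have := hQ.both ψ φ
    simp only [mul_assoc] at this
    exact mul_le_mul_of_nonneg_left this (norm_nonneg _)

lemma integrable_test_left (hQ : BoundedMeasurable Q) (ψ : SchwartzMap (Space d) ℂ) (B : Space d) :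
    Integrable fun A => ψ A * Q (A, B) := by
  obtain ⟨M, hM⟩ := hQ.bounded
  exact ψ.integrable.mul_bdd (c := M) (hQ.stronglyMeasurable.comp_measurable
    (by fun_prop : Measurable fun A => (A, B))).aestronglyMeasurable
      (Eventually.of_forall fun z => hM _)

lemma integrable_test_both (hQ : BoundedMeasurable Q) (ψ φ : SchwartzMap (Space d) ℂ) :
    Integrable fun x : Space d × Space d => ψ x.1 * φ x.2 * Q x := by
  obtain ⟨M, hM⟩ := hQ.bounded
  exact (ψ.integrable.mul_prod φ.integrable).mul_bdd (c := M)
    hQ.stronglyMeasurable.aestronglyMeasurable (Eventually.of_forall fun z => hM _)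

lemma TestBound.add {c' : ℝ} {Q' : Space d × Space d → ℂ} (hQ : TestBound κ c Q)
    (hQ' : TestBound κ c' Q') (hm : BoundedMeasurable Q) (hm' : BoundedMeasurable Q') :
    TestBound κ (c + c') fun x => Q x + Q' x where
  nonneg := add_nonneg hQ.nonneg hQ'.nonneg
  left ψ B := by
    simp only [mul_add]
    rw [integral_add (integrable_test_left hm ψ B) (integrable_test_left hm' ψ B)]
    refine (norm_add_le _ _).trans ((add_le_add (hQ.left ψ B) (hQ'.left ψ B)).trans_eq (by ring))
  right ψ B := by
    simp only [mul_add]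
    have h1 := integrable_test_left hm.swap ψ B
    have h2 := integrable_test_left hm'.swap ψ B
    simp only [Prod.swap_prod_mk] at h1 h2
    rw [integral_add h1 h2]
    refine (norm_add_le _ _).trans ((add_le_add (hQ.right ψ B) (hQ'.right ψ B)).trans_eq (by ring))
  both ψ φ := by
    simp only [mul_add]
    rw [integral_add (integrable_test_both hm ψ φ) (integrable_test_both hm' ψ φ)]
    refine (norm_add_le _ _).trans ((add_le_add (hQ.both ψ φ) (hQ'.both ψ φ)).trans_eq (by ring))

lemma TestBound.sum {ι : Type*} {s : Finset ι} {c : ι → ℝ} {Q : ι → Space d × Space d → ℂ}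
    (hQ : ∀ i ∈ s, TestBound κ (c i) (Q i)) (hm : ∀ i ∈ s, BoundedMeasurable (Q i)) :
    TestBound κ (∑ i ∈ s, c i) fun x => ∑ i ∈ s, Q i x := by
  classical
  induction s using Finset.induction_on with
  | empty => simpa using TestBound.zero
  | insert i s hi ih =>
    simp only [Finset.sum_insert hi]
    exact (hQ i (Finset.mem_insert_self _ _)).add
      (ih (fun j hj => hQ j (Finset.mem_insert_of_mem hj))
        fun j hj => hm j (Finset.mem_insert_of_mem hj))
      (hm i (Finset.mem_insert_self _ _))
      (BoundedMeasurable.sum fun j hj => hm j (Finset.mem_insert_of_mem hj))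

end TestBoundBasic

section Convolution

/-- Bounds on a potential `v`, the Fourier transform of which is the kernel of a collision. For a
sum of `O(κ²)` separated bumps, only the supremum is bounded independently of `κ`. -/
structure PotentialBound (κ L : ℝ) (v : SchwartzMap (Space d) ℂ) : Prop where
  sup : ∀ x, ‖v x‖ ≤ L
  l2 : l2norm v ≤ L * κ
  fourier_sup : ∀ ξ, ‖𝓕 v ξ‖ ≤ L * κ ^ 2

lemma fourier_fourier_apply (v : SchwartzMap (Space d) ℂ) (x : Space d) :
    𝓕 (𝓕 v) x = v (-x) := by
  have h := SchwartzMap.fourierInv_apply_eq (𝓕 v)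
  have h2 : 𝓕⁻ (𝓕 v) = v := FourierTransform.fourierInv_fourier_eq v
  rw [h2] at h
  have h3 := congrArg (fun f : SchwartzMap (Space d) ℂ => f (-x)) h
  simpa using h3.symm

lemma l2norm_fourier (v : SchwartzMap (Space d) ℂ) : l2norm (𝓕 v) = l2norm v := by
  rw [l2norm, l2norm, SchwartzMap.integral_norm_sq_fourier]

lemma l2norm_translate (k : SchwartzMap (Space d) ℂ) (A : Space d) :
    l2norm (SchwartzMap.compSubConstCLM ℂ A k) = l2norm k := by
  simp only [l2norm, SchwartzMap.compSubConstCLM_apply]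
  rw [integral_sub_right_eq_self (fun x => ‖k x‖ ^ 2) A]

/-- The convolution `ψ ⋆ k` of two Schwartz functions. -/
noncomputable def conv (ψ k : SchwartzMap (Space d) ℂ) : SchwartzMap (Space d) ℂ :=
  SchwartzMap.convolution (ContinuousLinearMap.mul ℂ ℂ) ψ k

lemma conv_apply (ψ k : SchwartzMap (Space d) ℂ) (x : Space d) :
    conv ψ k x = ∫ t, ψ t * k (x - t) := by
  rw [conv, SchwartzMap.convolution_apply]
  rfl

/-- By Plancherel, convolution with the Fourier transform of `v` is bounded on `L²` by the supremum
of `|v|`. -/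
lemma l2norm_conv_le {L : ℝ} (ψ v : SchwartzMap (Space d) ℂ) (hv : ∀ x, ‖v x‖ ≤ L) :
    l2norm (conv ψ (𝓕 v)) ≤ L * l2norm ψ := by
  have hL : 0 ≤ L := (norm_nonneg _).trans (hv 0)
  rw [← l2norm_fourier, ← l2norm_fourier ψ, l2norm, l2norm]
  refine Real.sqrt_le_iff.2 ⟨by positivity, ?_⟩
  rw [mul_pow, Real.sq_sqrt (integral_nonneg fun x => by positivity), ← integral_const_mul]
  refine integral_mono (integrable_norm_sq _) ((integrable_norm_sq _).const_mul _) fun x => ?_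
  have h1 : 𝓕 (conv ψ (𝓕 v)) x = 𝓕 ψ x * v (-x) := by
    rw [conv, SchwartzMap.fourier_convolution, SchwartzMap.pairing_apply_apply,
      fourier_fourier_apply]
    rfl
  simp only [h1, norm_mul, mul_pow]
  rw [mul_comm]
  gcongr
  exact hv _

lemma supnorm_conv_le (ψ k : SchwartzMap (Space d) ℂ) :
    supnorm (conv ψ k) ≤ l2norm ψ * l2norm k := by
  refine supnorm_le (mul_nonneg (l2norm_nonneg _) (l2norm_nonneg _)) fun x => ?_
  rw [conv_apply]
  refine (norm_integral_le_integral_norm _).trans ?_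
  simp only [norm_mul]
  have h2 : ∫ t, ‖k (x - t)‖ ^ 2 = ∫ t, ‖k t‖ ^ 2 :=
    integral_sub_left_eq_self (fun t => ‖k t‖ ^ 2) volume x
  have h3 : Integrable fun t => ‖k (x - t)‖ ^ 2 := (integrable_norm_sq k).comp_sub_left x
  have hk := k.continuous
  have hψ := ψ.continuous
  have := integral_mul_le_sqrt_mul_sqrt (μ := volume) (f := fun t => ‖ψ t‖)
    (g := fun t => ‖k (x - t)‖) (fun t => norm_nonneg _) (fun t => norm_nonneg _)
    (by fun_prop) (by fun_prop)
    (integrable_norm_sq ψ) h3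
  rwa [h2] at this

variable {κ L c : ℝ} {v : SchwartzMap (Space d) ℂ} {Q : Space d × Space d → ℂ}

lemma PotentialBound.nonneg (hv : PotentialBound κ L v) : 0 ≤ L := (norm_nonneg _).trans (hv.sup 0)

lemma collide_zero_eq (k : Space d → ℂ) (Q : Space d × Space d → ℂ) (A B : Space d) :
    collide k 0 Q (A, B) = ∫ A', k (A' - A) * Q (A', B) := by
  simp only [collide, step_zero]
  rw [← integral_add_right_eq_self (fun A' => k (A' - A) * Q (A', B)) A]
  refine integral_congr_ae (Eventually.of_forall fun z => ?_)
  simp [add_comm]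

lemma norm_collide_zero_le (hκ : 0 ≤ κ) (hv : PotentialBound κ L v) (hQ : TestBound κ c Q)
    (x : Space d × Space d) : ‖collide (𝓕 v : SchwartzMap (Space d) ℂ) 0 Q x‖ ≤
      2 * L * κ ^ 2 * c := by
  obtain ⟨A, B⟩ := x
  rw [collide_zero_eq]
  refine (hQ.left (SchwartzMap.compSubConstCLM ℂ A (𝓕 v)) B).trans ?_
  rw [l2norm_translate, l2norm_fourier]
  have h1 : supnorm (SchwartzMap.compSubConstCLM ℂ A (𝓕 v)) ≤ L * κ ^ 2 :=
    supnorm_le (mul_nonneg hv.nonneg (sq_nonneg _)) fun x => hv.fourier_sup _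
  calc c * (κ * l2norm v + supnorm (SchwartzMap.compSubConstCLM ℂ A (𝓕 v)))
      ≤ c * (κ * (L * κ) + L * κ ^ 2) := by
        gcongr
        · exact hQ.nonneg
        · exact hv.l2
    _ = _ := by ring

lemma integral_mul_collide_zero (ψ k : SchwartzMap (Space d) ℂ) (hm : BoundedMeasurable Q)
    (B : Space d) :
    ∫ A, ψ A * collide k 0 Q (A, B) = ∫ A', conv ψ k A' * Q (A', B) := by
  obtain ⟨M, hM⟩ := hm.bounded
  simp only [collide_zero_eq, conv_apply, ← integral_const_mul, ← integral_mul_const]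
  rw [integral_integral_swap]
  · simp only [mul_assoc]
  · have h1 : Integrable (fun p : Space d × Space d => ψ p.1 * k (p.2 - p.1))
        (volume.prod volume) := by
      have := (ψ.integrable (μ := volume)).convolution_integrand (ContinuousLinearMap.mul ℂ ℂ)
        (k.integrable (μ := volume))
      exact this.swap
    have h2 := h1.mul_bdd (c := M) (g := fun p : Space d × Space d => Q (p.2, B))
      (hm.stronglyMeasurable.comp_measurable (by fun_prop)).aestronglyMeasurable
      (Eventually.of_forall fun z => hM _)
    refine h2.congr (Eventually.of_forall fun p => ?_)
    simp [Function.uncurry, mul_assoc]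

/-- By duality, the collision is moved to the test function of the variable on which it acts; where
there is none, the translated kernel is the test function. -/
lemma TestBound.collide_zero (hκ : 0 ≤ κ) (hv : PotentialBound κ L v) (hQ : TestBound κ c Q)
    (hm : BoundedMeasurable Q) :
    TestBound κ (2 * L * c) (collide (𝓕 v : SchwartzMap (Space d) ℂ) 0 Q) := by
  have hL := hv.nonneg
  have hc := hQ.nonneg
  set k : SchwartzMap (Space d) ℂ := 𝓕 v with hk
  have hkl : l2norm k ≤ L * κ := by rw [hk, l2norm_fourier]; exact hv.l2
  have hmc := hm.collide k.integrable 0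
  obtain ⟨M, hM⟩ := hm.bounded
  refine ⟨by positivity, fun ψ B => ?_, fun φ A => ?_, fun ψ φ => ?_⟩
  · rw [integral_mul_collide_zero ψ k hm B]
    refine (hQ.left _ B).trans ?_
    have h1 := l2norm_conv_le ψ v hv.sup
    have h2 := supnorm_conv_le ψ k
    have h3 := l2norm_nonneg ψ
    have h4 := supnorm_nonneg ψ
    calc c * (κ * l2norm (conv ψ k) + supnorm (conv ψ k))
        ≤ c * (κ * (L * l2norm ψ) + l2norm ψ * (L * κ)) := by
          gcongr
          exact h2.trans (by gcongr)
      _ = 2 * L * c * (κ * l2norm ψ) := by ring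
      _ ≤ _ := by gcongr; linarith
  · have h1 : ∫ B, φ B * collide k 0 Q (A, B) = ∫ x : Space d × Space d,
        SchwartzMap.compSubConstCLM ℂ A k x.1 * φ x.2 * Q x := by
      have h5 := integrable_test_both hm (SchwartzMap.compSubConstCLM ℂ A k) φ
      rw [Measure.volume_eq_prod] at h5 ⊢
      rw [integral_prod_symm _ h5]
      refine integral_congr_ae (Eventually.of_forall fun B => ?_)
      simp only [collide_zero_eq, SchwartzMap.compSubConstCLM_apply]
      rw [← integral_const_mul]
      refine integral_congr_ae (Eventually.of_forall fun A' => ?_)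
      simp only
      ring
    rw [h1]
    refine (hQ.both _ _).trans ?_
    rw [l2norm_translate]
    have h3 := l2norm_nonneg φ
    have h4 := supnorm_nonneg φ
    calc c * (l2norm k * l2norm φ) ≤ c * ((L * κ) * l2norm φ) := by gcongr
      _ = L * c * (κ * l2norm φ) := by ring
      _ ≤ 2 * L * c * (κ * l2norm φ) := by
        have : 0 ≤ L * c * (κ * l2norm φ) := by positivity
        linarith
      _ ≤ _ := by gcongr; linarith
  · have h1 : ∫ x : Space d × Space d, ψ x.1 * φ x.2 * collide k 0 Q x =
        ∫ x : Space d × Space d, conv ψ k x.1 * φ x.2 * Q x := by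
      have h5 := integrable_test_both hmc ψ φ
      have h6 := integrable_test_both hm (conv ψ k) φ
      rw [Measure.volume_eq_prod] at h5 h6 ⊢
      rw [integral_prod_symm _ h5, integral_prod_symm _ h6]
      refine integral_congr_ae (Eventually.of_forall fun B => ?_)
      simp only [mul_right_comm _ (φ B)]
      rw [integral_mul_const, integral_mul_const, integral_mul_collide_zero ψ k hm B]
    rw [h1]
    refine (hQ.both _ _).trans ?_
    have h2 := l2norm_conv_le ψ v hv.sup
    have h3 := l2norm_nonneg φ
    have h4 := l2norm_nonneg ψ
    calc c * (l2norm (conv ψ k) * l2norm φ) ≤ c * ((L * l2norm ψ) * l2norm φ) := by gcongr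
      _ = L * c * (l2norm ψ * l2norm φ) := by ring
      _ ≤ 2 * L * c * (l2norm ψ * l2norm φ) := by
        have : 0 ≤ L * c * (l2norm ψ * l2norm φ) := by positivity
        linarith

/-- The reflection `x ↦ v(-x)`. -/
noncomputable def reflect (v : SchwartzMap (Space d) ℂ) : SchwartzMap (Space d) ℂ :=
  SchwartzMap.compCLMOfContinuousLinearEquiv ℂ (ContinuousLinearEquiv.neg ℝ) v

lemma reflect_apply (v : SchwartzMap (Space d) ℂ) (x : Space d) : reflect v x = v (-x) := rfl

lemma fourier_reflect (v : SchwartzMap (Space d) ℂ) (ξ : Space d) :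
    𝓕 (reflect v) ξ = 𝓕 v (-ξ) := by
  rw [SchwartzMap.fourier_coe, SchwartzMap.fourier_coe, Real.fourier_eq, Real.fourier_eq,
    ← integral_neg_eq_self]
  simp [reflect_apply]

lemma PotentialBound.reflect (hv : PotentialBound κ L v) :
    PotentialBound κ L (reflect v) where
  sup x := hv.sup _
  l2 := by
    have : l2norm (LorentzGas.reflect v) = l2norm v := by
      simp only [l2norm, reflect_apply]
      rw [integral_neg_eq_self (fun x => ‖v x‖ ^ 2)]
    rw [this]
    exact hv.l2
  fourier_sup ξ := by
    rw [fourier_reflect]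
    exact hv.fourier_sup _

lemma collide_one_eq (v : SchwartzMap (Space d) ℂ) (Q : Space d × Space d → ℂ) :
    collide (𝓕 v : SchwartzMap (Space d) ℂ) 1 Q = fun x =>
      collide (𝓕 (reflect v) : SchwartzMap (Space d) ℂ) 0 (fun y => Q y.swap) x.swap := by
  funext x
  simp only [collide, step_one, step_zero, Prod.fst_swap, Prod.snd_swap, Prod.swap_prod_mk,
    fourier_reflect]
  rw [← integral_neg_eq_self]
  simp [sub_neg_eq_add]

/-- Collisions are bounded in the sense of `TestBound`. The exchange of the two momenta reduces
`g = 1` to `g = 0`, with the reflected potential. -/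
lemma TestBound.collide (hκ : 0 ≤ κ) (hv : PotentialBound κ L v) (hQ : TestBound κ c Q)
    (hm : BoundedMeasurable Q) (g : Fin 2) :
    TestBound κ (2 * L * c) (collide (𝓕 v : SchwartzMap (Space d) ℂ) g Q) := by
  fin_cases g
  · exact hQ.collide_zero hκ hv hm
  · have := (hQ.swap.collide_zero hκ hv.reflect hm.swap).swap
    simpa only [Fin.mk_one, collide_one_eq] using this

/-- The passage from tests to the supremum costs the factor `κ²`. -/
lemma norm_collide_le (hκ : 0 ≤ κ) (hv : PotentialBound κ L v) (hQ : TestBound κ c Q)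
    (g : Fin 2) (x : Space d × Space d) :
    ‖collide (𝓕 v : SchwartzMap (Space d) ℂ) g Q x‖ ≤ 2 * L * κ ^ 2 * c := by
  fin_cases g
  · exact norm_collide_zero_le hκ hv hQ x
  · simp only [Fin.mk_one, collide_one_eq]
    exact norm_collide_zero_le hκ hv.reflect hQ.swap _

end Convolution

/-! ### Free evolution, and functions supported in a strip -/

section Phase

lemma hasTemperateGrowth_expi : expi.HasTemperateGrowth := by
  refine ⟨contDiff_expi, fun n => ⟨0, (2 * Real.pi) ^ n, fun x => ?_⟩⟩
  rw [norm_iteratedFDeriv_eq_norm_iteratedDeriv, iteratedDeriv_expi, norm_mul, norm_expi]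
  simp [abs_of_pos Real.pi_pos]

/-- The free evolution factor `e(½ (‖A‖² - ‖B‖²) u)`. -/
noncomputable def phase (u : ℝ) (x : Space d × Space d) : ℂ :=
  expi (1 / 2 * (‖x.1‖ ^ 2 - ‖x.2‖ ^ 2) * u)

@[fun_prop]
lemma continuous_phase (u : ℝ) : Continuous (phase u : Space d × Space d → ℂ) := by
  unfold phase
  fun_prop

lemma norm_phase (u : ℝ) (x : Space d × Space d) : ‖phase u x‖ = 1 := norm_expi _

/-- Multiplication of a Schwartz function by the chirp `e(c ‖x‖²)`. -/
noncomputable def chirp (c : ℝ) (ψ : SchwartzMap (Space d) ℂ) : SchwartzMap (Space d) ℂ :=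
  SchwartzMap.smulLeftCLM ℂ (fun x : Space d => expi (c * ‖x‖ ^ 2)) ψ

lemma chirp_apply (c : ℝ) (ψ : SchwartzMap (Space d) ℂ) (x : Space d) :
    chirp c ψ x = expi (c * ‖x‖ ^ 2) * ψ x := by
  have h1 : (fun x : Space d => c * ‖x‖ ^ 2).HasTemperateGrowth := by fun_prop
  have h : (fun x : Space d => expi (c * ‖x‖ ^ 2)).HasTemperateGrowth :=
    hasTemperateGrowth_expi.comp h1
  rw [chirp, SchwartzMap.smulLeftCLM_apply_apply h, smul_eq_mul]

lemma l2norm_chirp (c : ℝ) (ψ : SchwartzMap (Space d) ℂ) : l2norm (chirp c ψ) = l2norm ψ := by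
  simp [l2norm, chirp_apply, norm_expi]

lemma supnorm_chirp_le (c : ℝ) (ψ : SchwartzMap (Space d) ℂ) :
    supnorm (chirp c ψ) ≤ supnorm ψ :=
  supnorm_le (supnorm_nonneg _) fun x => by
    rw [chirp_apply, norm_mul, norm_expi, one_mul]
    exact norm_le_supnorm ψ x

lemma phase_eq (u : ℝ) (A B : Space d) :
    phase u (A, B) = expi (u / 2 * ‖A‖ ^ 2) * expi (-(u / 2) * ‖B‖ ^ 2) := by
  rw [← expi_add, phase]
  ring_nf

/-- Free evolution acts on the test functions by chirps, which leave the norms unchanged. -/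
lemma TestBound.phase_mul {κ c : ℝ} {Q : Space d × Space d → ℂ} (hQ : TestBound κ c Q) (u : ℝ) :
    TestBound κ c fun x => phase u x * Q x where
  nonneg := hQ.nonneg
  left ψ B := by
    have h1 : ∀ A, ψ A * (phase u (A, B) * Q (A, B)) =
        expi (-(u / 2) * ‖B‖ ^ 2) * (chirp (u / 2) ψ A * Q (A, B)) := fun A => by
      rw [chirp_apply, phase_eq]; ring
    simp only [h1, integral_const_mul, norm_mul, norm_expi, one_mul]
    refine (hQ.left _ B).trans ?_
    rw [l2norm_chirp]
    have := hQ.nonneg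
    gcongr
    exact supnorm_chirp_le _ _
  right φ A := by
    have h1 : ∀ B, φ B * (phase u (A, B) * Q (A, B)) =
        expi (u / 2 * ‖A‖ ^ 2) * (chirp (-(u / 2)) φ B * Q (A, B)) := fun B => by
      rw [chirp_apply, phase_eq]; ring
    simp only [h1, integral_const_mul, norm_mul, norm_expi, one_mul]
    refine (hQ.right _ A).trans ?_
    rw [l2norm_chirp]
    have := hQ.nonneg
    gcongr
    exact supnorm_chirp_le _ _
  both ψ φ := by
    have h1 : ∀ x : Space d × Space d, ψ x.1 * φ x.2 * (phase u x * Q x) =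
        chirp (u / 2) ψ x.1 * chirp (-(u / 2)) φ x.2 * Q x := fun x => by
      rw [chirp_apply, chirp_apply, show phase u x = phase u (x.1, x.2) from rfl, phase_eq]
      ring
    simp only [h1]
    refine (hQ.both _ _).trans_eq ?_
    rw [l2norm_chirp, l2norm_chirp]

end Phase

section Strip

lemma integrable_strip (ψ : SchwartzMap (Space d) ℂ) (ρ : ℝ) :
    Integrable (fun x : Space d × Space d =>
        ({x | ‖x.1 - x.2‖ ≤ ρ} : Set (Space d × Space d)).indicator (fun x => ‖ψ x.1‖ ^ 2) x) ∧
      ∫ x : Space d × Space d,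
        ({x | ‖x.1 - x.2‖ ≤ ρ} : Set (Space d × Space d)).indicator (fun x => ‖ψ x.1‖ ^ 2) x =
          volume.real (Metric.closedBall (0 : Space d) ρ) * l2norm ψ ^ 2 := by
  have hmp := measurePreserving_prod_neg_add (volume : Measure (Space d))
    (volume : Measure (Space d))
  have h1 : Integrable (fun y : Space d => (Metric.closedBall (0 : Space d) ρ).indicator
      (fun _ => (1 : ℝ)) y) :=
    (integrable_indicator_iff measurableSet_closedBall).2
      (integrableOn_const (measure_closedBall_lt_top.ne))
  have h2 := (integrable_norm_sq ψ).mul_prod h1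
  have h3 : (fun x : Space d × Space d =>
        ({x | ‖x.1 - x.2‖ ≤ ρ} : Set (Space d × Space d)).indicator (fun x => ‖ψ x.1‖ ^ 2) x) =
      (fun p : Space d × Space d => ‖ψ p.1‖ ^ 2 *
        (Metric.closedBall (0 : Space d) ρ).indicator (fun _ => (1 : ℝ)) p.2) ∘
          (fun p : Space d × Space d => (p.1, -p.1 + p.2)) := by
    funext x
    have : ‖-x.1 + x.2‖ = ‖x.1 - x.2‖ := by rw [neg_add_eq_sub, norm_sub_rev]
    by_cases hx : ‖x.1 - x.2‖ ≤ ρ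
    · simp [hx, this]
    · simp [hx, this]
  constructor
  · rw [h3]
    exact hmp.integrable_comp_of_integrable h2
  · rw [h3]
    have hemb : MeasurableEmbedding fun p : Space d × Space d => (p.1, -p.1 + p.2) :=
      (MeasurableEquiv.shearAddRight (Space d)).symm.measurableEmbedding
    have h4 := hmp.integral_comp hemb (fun p : Space d × Space d => ‖ψ p.1‖ ^ 2 *
        (Metric.closedBall (0 : Space d) ρ).indicator (fun _ => (1 : ℝ)) p.2)
    rw [Measure.volume_eq_prod]
    simp only [Function.comp_def]
    rw [h4, integral_prod_mul (fun A => ‖ψ A‖ ^ 2)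
      (fun y => (Metric.closedBall (0 : Space d) ρ).indicator (fun _ => (1 : ℝ)) y), l2norm_sq,
      integral_indicator measurableSet_closedBall]
    simp [mul_comm]

/-- A bounded function supported in the strip `‖A - B‖ ≤ ρ` gains the volume of the `ρ`-ball. -/
lemma TestBound.of_strip {κ c ρ : ℝ} (hκ : 0 ≤ κ) {Q : Space d × Space d → ℂ}
    (hQ : ∀ x, ‖Q x‖ ≤ c) (hsupp : ∀ x, ρ < ‖x.1 - x.2‖ → Q x = 0) :
    TestBound κ (c * volume.real (Metric.closedBall (0 : Space d) ρ)) Q := by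
  have hc : 0 ≤ c := (norm_nonneg _).trans (hQ 0)
  have hV : 0 ≤ volume.real (Metric.closedBall (0 : Space d) ρ) := measureReal_nonneg
  have key : ∀ (ψ : SchwartzMap (Space d) ℂ) (B : Space d) (q : Space d → ℂ), (∀ A, ‖q A‖ ≤ c) →
      (∀ A, ρ < ‖A - B‖ → q A = 0) → ‖∫ A, ψ A * q A‖ ≤
        c * volume.real (Metric.closedBall (0 : Space d) ρ) * (κ * l2norm ψ + supnorm ψ) := by
    intro ψ B q hq hq0
    have h1 : ‖∫ A, ψ A * q A‖ ≤
        ∫ A, (Metric.closedBall B ρ).indicator (fun _ => supnorm ψ * c) A := by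
      refine norm_integral_le_of_norm_le ((integrable_indicator_iff measurableSet_closedBall).2
        (integrableOn_const measure_closedBall_lt_top.ne)) (Eventually.of_forall fun A => ?_)
      by_cases hA : A ∈ Metric.closedBall B ρ
      · rw [Set.indicator_of_mem hA, norm_mul]
        exact mul_le_mul (norm_le_supnorm ψ A) (hq A) (norm_nonneg _) (supnorm_nonneg _)
      · rw [Set.indicator_of_notMem hA, hq0 A, mul_zero, norm_zero]
        simpa [dist_eq_norm] using hA
    rw [integral_indicator measurableSet_closedBall, setIntegral_const, smul_eq_mul,
      measureReal_def, Measure.addHaar_closedBall_center, ← measureReal_def] at h1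
    refine h1.trans ?_
    have := supnorm_nonneg ψ
    have := l2norm_nonneg ψ
    calc _ = c * volume.real (Metric.closedBall (0 : Space d) ρ) * supnorm ψ := by ring
      _ ≤ _ := by
        gcongr
        nlinarith [mul_nonneg hκ this]
  refine ⟨by positivity, fun ψ B => key ψ B _ (fun A => hQ _) fun A hA => hsupp _ hA,
    fun φ A => key φ A _ (fun B => hQ _) fun B hB => hsupp _ ?_, fun ψ φ => ?_⟩
  · rwa [norm_sub_rev]
  · set S : Set (Space d × Space d) := {x | ‖x.1 - x.2‖ ≤ ρ} with hS
    have hSm : MeasurableSet S := measurableSet_le (by fun_prop) (by fun_prop)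
    obtain ⟨i1, e1⟩ := integrable_strip ψ ρ
    obtain ⟨i2, e2⟩ := integrable_strip φ ρ
    have i2' : Integrable (fun x : Space d × Space d => S.indicator (fun x => ‖φ x.2‖ ^ 2) x) := by
      have := i2.swap
      refine this.congr (Eventually.of_forall fun x => ?_)
      simp [Set.indicator, hS, norm_sub_rev]
    have e2' : ∫ x : Space d × Space d, S.indicator (fun x => ‖φ x.2‖ ^ 2) x =
        volume.real (Metric.closedBall (0 : Space d) ρ) * l2norm φ ^ 2 := by
      rw [← e2, Measure.volume_eq_prod, ← integral_prod_swap]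
      refine integral_congr_ae (Eventually.of_forall fun x => ?_)
      simp [Set.indicator, hS, norm_sub_rev]
    have hψ := ψ.continuous
    have hφ := φ.continuous
    set f : Space d × Space d → ℝ := S.indicator fun x => ‖ψ x.1‖ with hf
    set g : Space d × Space d → ℝ := S.indicator fun x => ‖φ x.2‖ with hg
    have hf2 : (fun x => f x ^ 2) = S.indicator (fun x => ‖ψ x.1‖ ^ 2) := by
      funext x
      simp only [hf, Set.indicator]
      split_ifs <;> simp
    have hg2 : (fun x => g x ^ 2) = S.indicator (fun x => ‖φ x.2‖ ^ 2) := by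
      funext x
      simp only [hg, Set.indicator]
      split_ifs <;> simp
    have hf0 : ∀ x, 0 ≤ f x := fun x => Set.indicator_nonneg (fun _ _ => norm_nonneg _) _
    have hg0 : ∀ x, 0 ≤ g x := fun x => Set.indicator_nonneg (fun _ _ => norm_nonneg _) _
    have hfm : AEStronglyMeasurable f volume :=
      (by fun_prop : Continuous fun x : Space d × Space d => ‖ψ x.1‖).aestronglyMeasurable.indicator
        hSm
    have hgm : AEStronglyMeasurable g volume :=
      (by fun_prop : Continuous fun x : Space d × Space d => ‖φ x.2‖).aestronglyMeasurable.indicator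
        hSm
    have hcs := integral_mul_le_sqrt_mul_sqrt hf0 hg0 hfm hgm (by rw [hf2]; exact i1)
      (by rw [hg2]; exact i2')
    have hfg : Integrable (fun x => f x * g x) :=
      MemLp.integrable_mul (p := 2) (q := 2)
        ((memLp_two_iff_integrable_sq hfm).2 (by rw [hf2]; exact i1))
        ((memLp_two_iff_integrable_sq hgm).2 (by rw [hg2]; exact i2'))
    have h5 : ‖∫ x : Space d × Space d, ψ x.1 * φ x.2 * Q x‖ ≤ ∫ x, c * (f x * g x) := by
      refine norm_integral_le_of_norm_le (hfg.const_mul c) (Eventually.of_forall fun x => ?_)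
      by_cases hx : x ∈ S
      · simp only [hf, hg, Set.indicator_of_mem hx, norm_mul]
        rw [mul_comm c]
        gcongr
        exact hQ x
      · rw [hsupp x (by simpa [hS] using hx), mul_zero, norm_zero]
        exact mul_nonneg hc (mul_nonneg (hf0 _) (hg0 _))
    refine h5.trans ?_
    rw [integral_const_mul, mul_assoc]
    refine mul_le_mul_of_nonneg_left (hcs.trans_eq ?_) hc
    rw [hf2, hg2, e1, e2', Real.sqrt_mul hV, Real.sqrt_mul hV, Real.sqrt_sq (l2norm_nonneg _),
      Real.sqrt_sq (l2norm_nonneg _), mul_mul_mul_comm, Real.mul_self_sqrt hV]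

lemma TestBound.of_decay {κ c : ℝ} (hκ : 0 ≤ κ) {Q : Space d × Space d → ℂ}
    (hQ : ∀ x, ‖Q x‖ ≤ c * decay (d + 1) x.1 * decay (d + 1) x.2) :
    TestBound κ (c * ∫ x : Space d, decay (d + 1) x) Q := by
  have hc : 0 ≤ c := by
    have h1 := (norm_nonneg _).trans (hQ 0)
    simpa [decay] using h1
  have hi : Integrable (decay (d + 1) : Space d → ℝ) := integrable_decay (Nat.lt_succ_self d)
  set J := ∫ x : Space d, decay (d + 1) x with hJ
  have hJ0 : 0 ≤ J := integral_nonneg fun x => (decay_pos _ _).le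
  have key : ∀ (ψ : SchwartzMap (Space d) ℂ) (q : Space d → ℂ),
      (∀ A, ‖q A‖ ≤ c * decay (d + 1) A) →
      ‖∫ A, ψ A * q A‖ ≤ c * J * (κ * l2norm ψ + supnorm ψ) := by
    intro ψ q hq
    have h1 : ‖∫ A, ψ A * q A‖ ≤ ∫ A : Space d, (supnorm ψ * c) * decay (d + 1) A := by
      refine norm_integral_le_of_norm_le (hi.const_mul _) (Eventually.of_forall fun A => ?_)
      rw [norm_mul, mul_assoc]
      exact mul_le_mul (norm_le_supnorm ψ A) (hq A) (norm_nonneg _) (supnorm_nonneg _)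
    rw [integral_const_mul] at h1
    refine h1.trans ?_
    have := supnorm_nonneg ψ
    have h2 := mul_nonneg hκ (l2norm_nonneg ψ)
    calc _ = c * J * supnorm ψ := by ring
      _ ≤ _ := by gcongr; linarith
  have hl2 : ∀ ψ : SchwartzMap (Space d) ℂ,
      Integrable (fun A => ‖ψ A‖ * decay (d + 1) A) ∧
        ∫ A, ‖ψ A‖ * decay (d + 1) A ≤ l2norm ψ * √J := by
    intro ψ
    have hψ := ψ.continuous
    have hd2 : Integrable fun A : Space d => decay (d + 1) A ^ 2 := by
      refine hi.mono' (by fun_prop) (Eventually.of_forall fun A => ?_)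
      rw [Real.norm_of_nonneg (sq_nonneg _), sq]
      exact mul_le_of_le_one_left (decay_pos _ _).le (decay_le_one _ _)
    constructor
    · refine ψ.integrable.norm.mul_bdd (c := 1) (by fun_prop) (Eventually.of_forall fun A => ?_)
      rw [Real.norm_of_nonneg (decay_pos _ _).le]
      exact decay_le_one _ _
    · refine (integral_mul_le_sqrt_mul_sqrt (fun A => norm_nonneg _) (fun A => (decay_pos _ _).le)
        (by fun_prop) (by fun_prop) (integrable_norm_sq ψ) hd2).trans ?_
      refine mul_le_mul_of_nonneg_left (Real.sqrt_le_sqrt ?_) (l2norm_nonneg ψ)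
      refine integral_mono hd2 hi fun A => ?_
      simp only [sq]
      exact mul_le_of_le_one_left (decay_pos _ _).le (decay_le_one _ _)
  refine ⟨mul_nonneg hc hJ0, fun ψ B => key ψ _ fun A => (hQ _).trans ?_,
    fun φ A => key φ _ fun B => (hQ _).trans ?_, fun ψ φ => ?_⟩
  · exact mul_le_of_le_one_right (mul_nonneg hc (decay_pos _ _).le) (decay_le_one _ _)
  · rw [mul_right_comm]
    exact mul_le_of_le_one_right (mul_nonneg hc (decay_pos _ _).le) (decay_le_one _ _)
  · obtain ⟨i1, h1⟩ := hl2 ψ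
    obtain ⟨i2, h2⟩ := hl2 φ
    have h3 : ‖∫ x : Space d × Space d, ψ x.1 * φ x.2 * Q x‖ ≤ ∫ x : Space d × Space d,
        c * ((‖ψ x.1‖ * decay (d + 1) x.1) * (‖φ x.2‖ * decay (d + 1) x.2)) := by
      refine norm_integral_le_of_norm_le ((i1.mul_prod i2).const_mul c)
        (Eventually.of_forall fun x => ?_)
      rw [norm_mul, norm_mul]
      calc ‖ψ x.1‖ * ‖φ x.2‖ * ‖Q x‖
          ≤ ‖ψ x.1‖ * ‖φ x.2‖ * (c * decay (d + 1) x.1 * decay (d + 1) x.2) := by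
            gcongr
            exact hQ x
        _ = _ := by ring
    refine h3.trans ?_
    rw [integral_const_mul, Measure.volume_eq_prod, integral_prod_mul
      (fun A => ‖ψ A‖ * decay (d + 1) A) (fun B => ‖φ B‖ * decay (d + 1) B), mul_assoc]
    refine mul_le_mul_of_nonneg_left ?_ hc
    calc _ ≤ (l2norm ψ * √J) * (l2norm φ * √J) := by
          refine mul_le_mul h1 h2 (integral_nonneg fun A => ?_)
            (mul_nonneg (l2norm_nonneg _) (Real.sqrt_nonneg _))
          exact mul_nonneg (norm_nonneg _) (decay_pos _ _).le
      _ = _ := by rw [mul_mul_mul_comm, Real.mul_self_sqrt hJ0]; ring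

end Strip

/-! ### Scatterers and their potential -/

/-- Sums of a decaying weight over separated points are bounded, by comparison with integrals over
disjoint balls. -/
lemma exists_sum_decay_le (d : ℕ) : ∃ C : ℝ, 0 ≤ C ∧ ∀ F : Finset (Space d),
    (∀ q ∈ F, ∀ q' ∈ F, q ≠ q' → 1 ≤ ‖q - q'‖) →
      ∀ x : Space d, ∑ q ∈ F, decay (d + 1) (x - q) ≤ C := by
  have hi : Integrable (decay (d + 1) : Space d → ℝ) := integrable_decay (Nat.lt_succ_self d)
  set J := ∫ x : Space d, decay (d + 1) x with hJ
  have hJ0 : 0 ≤ J := integral_nonneg fun x => (decay_pos _ _).le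
  set V := volume.real (Metric.ball (0 : Space d) (1 / 2)) with hV
  have hV0 : 0 < V := by
    rw [hV, measureReal_def]
    exact ENNReal.toReal_pos (Metric.measure_ball_pos volume _ (by norm_num)).ne'
      measure_ball_lt_top.ne
  refine ⟨V⁻¹ * (2 ^ (d + 1) * J), by positivity, fun F hF x => ?_⟩
  have hix : Integrable fun w : Space d => decay (d + 1) (x - w) := hi.comp_sub_left x
  have h1 : ∀ q, V * decay (d + 1) (x - q) ≤
      ∫ w in Metric.ball q (1 / 2), 2 ^ (d + 1) * decay (d + 1) (x - w) := by
    intro q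
    have h2 : V * decay (d + 1) (x - q) =
        ∫ _w in Metric.ball q (1 / 2), decay (d + 1) (x - q) := by
      rw [setIntegral_const, smul_eq_mul, measureReal_def, Measure.addHaar_ball_center, hV,
        measureReal_def]
    rw [h2]
    refine setIntegral_mono_on (integrableOn_const measure_ball_lt_top.ne)
      ((hix.const_mul _).integrableOn) measurableSet_ball fun w hw => ?_
    have h3 := decay_add_le (d + 1) (x - w) (w - q)
    rw [sub_add_sub_cancel] at h3
    refine h3.trans ?_
    rw [mul_comm]
    refine mul_le_mul_of_nonneg_right ?_ (decay_pos _ _).le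
    rw [Metric.mem_ball, dist_eq_norm] at hw
    gcongr
    linarith
  have hdisj : Set.PairwiseDisjoint (F : Set (Space d)) fun q => Metric.ball q (1 / 2 : ℝ) := by
    intro q hq q' hq' hne
    refine Metric.ball_disjoint_ball ?_
    rw [dist_eq_norm]
    linarith [hF q hq q' hq' hne]
  rw [← div_eq_inv_mul, le_div_iff₀ hV0, mul_comm, Finset.mul_sum]
  calc ∑ q ∈ F, V * decay (d + 1) (x - q)
      ≤ ∑ q ∈ F, ∫ w in Metric.ball q (1 / 2), 2 ^ (d + 1) * decay (d + 1) (x - w) :=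
        Finset.sum_le_sum fun q _ => h1 q
    _ = ∫ w in ⋃ q ∈ F, Metric.ball q (1 / 2), 2 ^ (d + 1) * decay (d + 1) (x - w) := by
        rw [integral_biUnion_finset F (fun q _ => measurableSet_ball) hdisj
          fun q _ => (hix.const_mul _).integrableOn]
    _ ≤ ∫ w, 2 ^ (d + 1) * decay (d + 1) (x - w) :=
        setIntegral_le_integral (hix.const_mul _)
          (Eventually.of_forall fun w => mul_nonneg (by positivity) (decay_pos _ _).le)
    _ = 2 ^ (d + 1) * J := by
        rw [integral_const_mul, integral_sub_left_eq_self (fun w => decay (d + 1) w) volume x]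

lemma IsScattererConfiguration.finite_inter_ball {P : Set (Space d)} {b : ℝ}
    (hP : IsScattererConfiguration P b) (ρ : ℝ) : {q ∈ P | ‖q‖ ≤ ρ}.Finite := by
  by_contra hinf
  obtain ⟨C, hC, hsum⟩ := exists_sum_decay_le d
  have hb := hP.sep_pos
  set M := C * (1 + b⁻¹ * |ρ|) ^ (d + 1) with hM
  obtain ⟨F, hF, hcard⟩ := (show {q ∈ P | ‖q‖ ≤ ρ}.Infinite from hinf).exists_subset_card_eq
    (⌊M⌋₊ + 1)
  classical
  have hinj : Set.InjOn (fun q : Space d => b⁻¹ • q) F :=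
    (smul_right_injective _ (inv_ne_zero hb.ne')).injOn
  have h1 := hsum (F.image fun q => b⁻¹ • q) (by
    intro q hq q' hq' hne
    obtain ⟨p, hp, rfl⟩ := Finset.mem_image.1 hq
    obtain ⟨p', hp', rfl⟩ := Finset.mem_image.1 hq'
    have hpp : p ≠ p' := fun h => hne (by rw [h])
    rw [← smul_sub, norm_smul, Real.norm_of_nonneg (by positivity), ← div_eq_inv_mul,
      le_div_iff₀ hb, one_mul]
    exact (hP.separated p (hF hp).1 p' (hF hp').1 hpp).le) 0
  rw [Finset.sum_image hinj] at h1
  have h2 : ∀ q ∈ F, ((1 + b⁻¹ * |ρ|) ^ (d + 1))⁻¹ ≤ decay (d + 1) (0 - b⁻¹ • q) := by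
    intro q hq
    rw [zero_sub, decay_neg, decay, norm_smul, Real.norm_of_nonneg (by positivity)]
    have : ‖q‖ ≤ |ρ| := (hF hq).2.trans (le_abs_self ρ)
    gcongr
  have h3 := (Finset.card_nsmul_le_sum F _ _ h2).trans h1
  rw [hcard, nsmul_eq_mul, ← div_eq_mul_inv, div_le_iff₀ (by positivity)] at h3
  have h4 := Nat.lt_floor_add_one M
  push_cast at h3
  linarith

/-- The number of scatterers in the ball of radius `r^{1-d}` is `O(r^{-d(d-1)})`, with a constant
that depends only on the dimension. -/
lemma exists_card_scatterers_le (d : ℕ) (hd : 2 ≤ d) : ∃ D : ℝ, 1 ≤ D ∧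
    ∀ (P : Set (Space d)) (b : ℝ), IsScattererConfiguration P b →
      ∀ᶠ r : ℝ in 𝓝[>] 0, ∀ F : Finset (Space d), (∀ q ∈ F, q ∈ P ∧ ‖r ^ (d - 1) • q‖ ≤ 1) →
        (F.card : ℝ) ≤ D * (r ^ (d * (d - 1)))⁻¹ := by
  let f : ContDiffBump (0 : Space d) := ⟨1, 2, by norm_num, by norm_num⟩
  have hf0 : 0 ≤ ∫ x, f x := integral_nonneg fun x => f.nonneg
  refine ⟨(∫ x, f x) + 1, by linarith, fun P b hP => ?_⟩
  obtain ⟨c, hc, hden⟩ := hP.density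
  obtain ⟨K, hK⟩ := hden f f.contDiff f.hasCompactSupport
  set s := ⨆ x, ‖fderiv ℝ f x‖
  have hlim : Tendsto (fun r : ℝ => K * (((r ^ (d - 1)) ^ c) * s)) (𝓝[>] 0) (𝓝 0) := by
    have h1 : Tendsto (fun r : ℝ => r ^ (d - 1)) (𝓝[>] 0) (𝓝 0) := by
      have : Tendsto (fun r : ℝ => r ^ (d - 1)) (𝓝 0) (𝓝 (0 ^ (d - 1))) :=
        (continuous_pow (d - 1)).tendsto 0
      rw [zero_pow (by omega)] at this
      exact this.mono_left nhdsWithin_le_nhds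
    have h2 : Tendsto (fun x : ℝ => x ^ c) (𝓝 0) (𝓝 (0 ^ c)) :=
      (Real.continuousAt_rpow_const 0 c (Or.inr hc.le)).tendsto
    rw [Real.zero_rpow hc.ne'] at h2
    simpa using ((h2.comp h1).mul_const s).const_mul K
  have h01 : ∀ᶠ r : ℝ in 𝓝[>] 0, r ∈ Set.Ioo (0 : ℝ) 1 := Ioo_mem_nhdsGT one_pos
  filter_upwards [hlim.eventually (gt_mem_nhds one_pos), h01] with r hr hr01 F hF
  have hε0 : 0 < r ^ (d - 1) := pow_pos hr01.1 _
  have hε1 : r ^ (d - 1) < 1 := pow_lt_one₀ hr01.1.le hr01.2 (by omega)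
  have h1 := (abs_le.1 (hK _ hε0 hε1)).2
  have hsupp : (Function.support fun q : P => f (r ^ (d - 1) • (q : Space d))).Finite := by
    refine Set.Finite.subset ((hP.finite_inter_ball (2 / r ^ (d - 1))).preimage
      Subtype.val_injective.injOn) fun q hq => ?_
    have h2 : r ^ (d - 1) • (q : Space d) ∈ Metric.ball (0 : Space d) 2 := by
      rw [← f.support_eq]
      exact hq
    rw [mem_ball_zero_iff, norm_smul, Real.norm_of_nonneg hε0.le] at h2
    exact ⟨q.2, by rw [le_div_iff₀ hε0, mul_comm]; exact h2.le⟩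
  have hsummable : Summable fun q : P => f (r ^ (d - 1) • (q : Space d)) :=
    summable_of_hasFiniteSupport hsupp
  classical
  have h3 : (F.card : ℝ) ≤ ∑' q : P, f (r ^ (d - 1) • (q : Space d)) := by
    have h4 := hsummable.sum_le_tsum (F.subtype (· ∈ P)) fun q _ => f.nonneg
    refine le_trans ?_ h4
    have h5 : ∑ q ∈ F.subtype (· ∈ P), f (r ^ (d - 1) • (q : Space d)) =
        ∑ q ∈ F, f (r ^ (d - 1) • q) :=
      Finset.sum_subtype_of_mem (fun q => f (r ^ (d - 1) • q)) fun q hq => (hF q hq).1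
    rw [h5]
    have h6 : ∀ q ∈ F, f (r ^ (d - 1) • q) = 1 := fun q hq =>
      f.one_of_mem_closedBall (by simpa using (hF q hq).2)
    rw [Finset.sum_congr rfl h6]
    simp
  have h7 : r ^ (d * (d - 1)) = (r ^ (d - 1)) ^ d := by rw [← pow_mul, mul_comm]
  rw [← div_eq_mul_inv, le_div_iff₀ (pow_pos hr01.1 _), h7, mul_comm]
  calc (r ^ (d - 1)) ^ d * (F.card : ℝ)
      ≤ (r ^ (d - 1)) ^ d * ∑' q : P, f (r ^ (d - 1) • (q : Space d)) := by gcongr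
    _ ≤ _ := by linarith

/-- The scaled potential `c W(· - Q)` of a single scatterer at `Q`. -/
noncomputable def singlePotential (W : SchwartzMap (Space d) ℂ) (c : ℂ) (Q : Space d) :
    SchwartzMap (Space d) ℂ :=
  c • SchwartzMap.compSubConstCLM ℂ Q W

lemma singlePotential_apply (W : SchwartzMap (Space d) ℂ) (c : ℂ) (Q x : Space d) :
    singlePotential W c Q x = c * W (x - Q) := rfl

lemma fourier_singlePotential (W : SchwartzMap (Space d) ℂ) (c : ℂ) (Q z : Space d) :
    𝓕 (singlePotential W c Q) z = c * expi (-inner ℝ Q z) * 𝓕 (W : Space d → ℂ) z := by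
  have h1 : ∀ f : Space d → ℂ, 𝓕 f z = ∫ x, expi (-inner ℝ x z) * f x := by
    intro f
    rw [Real.fourier_eq]
    refine integral_congr_ae (Eventually.of_forall fun x => ?_)
    simp only [Circle.smul_def, smul_eq_mul, Real.fourierChar_apply, expi_eq]
  rw [SchwartzMap.fourier_coe, h1, h1, ← integral_const_mul,
    ← integral_add_right_eq_self (fun x => expi (-inner ℝ x z) * singlePotential W c Q x) Q]
  refine integral_congr_ae (Eventually.of_forall fun x => ?_)
  simp only [singlePotential_apply, add_sub_cancel_right, inner_add_left, neg_add, expi_add]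
  ring

/-- Bounds for the potential of finitely many separated scatterers. The bound on the supremum is
independent of their number. -/
lemma exists_potentialBound (W : SchwartzMap (Space d) ℂ) (D : ℝ) (hD : 0 ≤ D) :
    ∃ C : ℝ, 0 ≤ C ∧ ∀ {ι : Type} (s : Finset ι) (Q : ι → Space d) (c : ι → ℂ) (Λ κ : ℝ),
      0 ≤ κ → 0 ≤ Λ → (∀ i ∈ s, ‖c i‖ ≤ Λ) →
      (∀ i ∈ s, ∀ j ∈ s, i ≠ j → 1 ≤ ‖Q i - Q j‖) → (s.card : ℝ) ≤ D * κ ^ 2 →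
        PotentialBound κ (C * Λ) (∑ i ∈ s, singlePotential W (c i) (Q i)) := by
  obtain ⟨C₁, hC₁, hW⟩ := exists_norm_le_decay W (d + 1)
  obtain ⟨C₂, hC₂, hWF⟩ := exists_norm_le_decay (𝓕 W) 0
  obtain ⟨C₃, hC₃, hsum⟩ := exists_sum_decay_le d
  set I := ∫ x, ‖W x‖ with hI
  have hI0 : 0 ≤ I := integral_nonneg fun x => norm_nonneg _
  set C := C₁ * C₃ + D * I + D * C₂ with hC
  have hC0 : 0 ≤ C := by positivity
  refine ⟨C, hC0, ?_⟩
  intro ι s Q c Λ κ hκ hΛ hc hsep hcard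
  classical
  have happ : ∀ x, (∑ i ∈ s, singlePotential W (c i) (Q i)) x = ∑ i ∈ s, c i * W (x - Q i) := by
    intro x
    rw [sum_apply]
    simp [singlePotential_apply]
  have hsup : ∀ x, ‖(∑ i ∈ s, singlePotential W (c i) (Q i)) x‖ ≤ C₁ * C₃ * Λ := by
    intro x
    rw [happ]
    have hinj : Set.InjOn Q s := by
      intro i hi j hj hij
      by_contra hne
      have := hsep i hi j hj hne
      rw [hij, sub_self, norm_zero] at this
      linarith
    have h2 := hsum (s.image Q) (by
      intro q hq q' hq' hne
      obtain ⟨i, hi, rfl⟩ := Finset.mem_image.1 hq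
      obtain ⟨j, hj, rfl⟩ := Finset.mem_image.1 hq'
      exact hsep i hi j hj fun h => hne (by rw [h])) x
    rw [Finset.sum_image hinj] at h2
    calc ‖∑ i ∈ s, c i * W (x - Q i)‖ ≤ ∑ i ∈ s, ‖c i * W (x - Q i)‖ := norm_sum_le _ _
      _ ≤ ∑ i ∈ s, Λ * C₁ * decay (d + 1) (x - Q i) := by
          refine Finset.sum_le_sum fun i hi => ?_
          rw [norm_mul, mul_assoc]
          exact mul_le_mul (hc i hi) (hW _) (norm_nonneg _) hΛ
      _ = Λ * C₁ * ∑ i ∈ s, decay (d + 1) (x - Q i) := by rw [Finset.mul_sum]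
      _ ≤ Λ * C₁ * C₃ := by gcongr
      _ = _ := by ring
  have hl1 : ∫ x, ‖(∑ i ∈ s, singlePotential W (c i) (Q i)) x‖ ≤ D * κ ^ 2 * (Λ * I) := by
    have h3 : ∀ i, Integrable fun x => ‖W (x - Q i)‖ := fun i =>
      (W.integrable.comp_sub_right (Q i)).norm
    calc ∫ x, ‖(∑ i ∈ s, singlePotential W (c i) (Q i)) x‖
        ≤ ∫ x, ∑ i ∈ s, Λ * ‖W (x - Q i)‖ := by
          refine integral_mono (SchwartzMap.integrable _).norm
            (integrable_finsetSum _ fun i _ => (h3 i).const_mul _) fun x => ?_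
          simp only [happ]
          refine (norm_sum_le _ _).trans (Finset.sum_le_sum fun i hi => ?_)
          rw [norm_mul]
          gcongr
          exact hc i hi
      _ = s.card * (Λ * I) := by
          rw [integral_finsetSum _ fun i _ => (h3 i).const_mul _]
          have h4 : ∀ i ∈ s, ∫ x, Λ * ‖W (x - Q i)‖ = Λ * I := fun i _ => by
            rw [integral_const_mul, integral_sub_right_eq_self (fun x => ‖W x‖) (Q i)]
          rw [Finset.sum_congr rfl h4, Finset.sum_const, nsmul_eq_mul]
      _ ≤ _ := by gcongr
  have hcomp : C₁ * C₃ ≤ C := by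
    have : 0 ≤ D * I + D * C₂ := by positivity
    linarith
  refine ⟨fun x => (hsup x).trans (by gcongr), ?_, fun ξ => ?_⟩
  · rw [l2norm]
    refine Real.sqrt_le_iff.2 ⟨by positivity, ?_⟩
    calc ∫ x, ‖(∑ i ∈ s, singlePotential W (c i) (Q i)) x‖ ^ 2
        ≤ ∫ x, C₁ * C₃ * Λ * ‖(∑ i ∈ s, singlePotential W (c i) (Q i)) x‖ := by
          refine integral_mono (integrable_norm_sq _)
            ((SchwartzMap.integrable _).norm.const_mul _) fun x => ?_
          simp only [sq]
          gcongr
          exact hsup x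
      _ ≤ C₁ * C₃ * Λ * (D * κ ^ 2 * (Λ * I)) := by
          rw [integral_const_mul]
          gcongr
      _ = (C₁ * C₃) * (D * I) * (Λ * κ) ^ 2 := by ring
      _ ≤ C * C * (Λ * κ) ^ 2 := by
          gcongr
          have : 0 ≤ C₁ * C₃ + D * C₂ := by positivity
          linarith
      _ = _ := by ring
  · have h5 : 𝓕 (∑ i ∈ s, singlePotential W (c i) (Q i)) =
        ∑ i ∈ s, 𝓕 (singlePotential W (c i) (Q i)) :=
      map_sum (FourierTransform.fourierCLM ℂ (SchwartzMap (Space d) ℂ)) _ _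
    rw [h5, sum_apply]
    calc ‖∑ i ∈ s, 𝓕 (singlePotential W (c i) (Q i)) ξ‖
        ≤ ∑ i ∈ s, ‖𝓕 (singlePotential W (c i) (Q i)) ξ‖ := norm_sum_le _ _
      _ ≤ ∑ _i ∈ s, Λ * C₂ := by
          refine Finset.sum_le_sum fun i hi => ?_
          rw [fourier_singlePotential, norm_mul, norm_mul, norm_expi, mul_one]
          refine mul_le_mul (hc i hi) ?_ (norm_nonneg _) hΛ
          have h6 := hWF ξ
          rw [SchwartzMap.fourier_coe] at h6
          simpa [decay] using h6
      _ = s.card * (Λ * C₂) := by rw [Finset.sum_const, nsmul_eq_mul]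
      _ ≤ D * κ ^ 2 * (Λ * C₂) := by gcongr
      _ = D * C₂ * (Λ * κ ^ 2) := by ring
      _ ≤ C * (Λ * κ ^ 2) := by
          gcongr
          have : 0 ≤ C₁ * C₃ + D * I := by positivity
          linarith
      _ = _ := by ring

/-! ### Simultaneous translations, and the oscillation of two collisions -/

section ShiftBound

/-- The kernel `c e(-Q·z) Ŵ(z)` of a collision with a scatterer of strength `c` at `Q`. -/
noncomputable def kern (W : SchwartzMap (Space d) ℂ) (c : ℂ) (Q : Space d) : Space d → ℂ :=
  (𝓕 (singlePotential W c Q) : SchwartzMap (Space d) ℂ)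

lemma kern_apply (W : SchwartzMap (Space d) ℂ) (c : ℂ) (Q z : Space d) :
    kern W c Q z = c * expi (-inner ℝ Q z) * 𝓕 (W : Space d → ℂ) z :=
  fourier_singlePotential W c Q z

@[fun_prop]
lemma continuous_kern (W : SchwartzMap (Space d) ℂ) (c : ℂ) (Q : Space d) :
    Continuous (kern W c Q) := (𝓕 (singlePotential W c Q)).continuous

lemma integrable_kern (W : SchwartzMap (Space d) ℂ) (c : ℂ) (Q : Space d) :
    Integrable (kern W c Q) := (𝓕 (singlePotential W c Q)).integrable

lemma norm_kern (W : SchwartzMap (Space d) ℂ) (c : ℂ) (Q z : Space d) :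
    ‖kern W c Q z‖ = ‖c‖ * ‖(𝓕 W : SchwartzMap (Space d) ℂ) z‖ := by
  rw [kern_apply, norm_mul, norm_mul, norm_expi, mul_one, SchwartzMap.fourier_coe]

/-- The regularity of a function `K` of the pair of momenta under simultaneous translation of both:
all forward differences up to order `N` along segments of length at most one, also after
multiplication by a linear phase, are controlled with polynomial decay in each momentum and with a
profile `H` in their difference, which the translation leaves unchanged. -/
def ShiftBound (N K₀ : ℕ) (H : Space d → ℝ) (K : Space d × Space d → ℂ) : Prop :=
  ∀ (x : Space d × Space d) (v : Space d) (β : ℝ), ‖v‖ ≤ 1 →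
    DiffBound N (H (x.1 - x.2) * (1 + |β| + ‖x.1 - x.2‖) ^ N * decay K₀ x.1 * decay K₀ x.2)
      (fun s => expi (β * s) * K (x.1 + s • v, x.2 + s • v))

/-- Profiles in the difference of the momenta that a collision integrates to at most `h`. -/
structure IsProfile (H : Space d → ℝ) (h : ℝ) : Prop where
  measurable : Measurable H
  nonneg : ∀ ζ, 0 ≤ H ζ
  bounded : ∃ M, ∀ ζ, H ζ ≤ M
  integral_le : ∀ ζ, ∫ z, decay (d + 1) z * H (ζ + z) ≤ h

lemma IsProfile.le_nonneg {H : Space d → ℝ} {h : ℝ} (hH : IsProfile H h) : 0 ≤ h :=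
  (integral_nonneg fun _ => mul_nonneg (decay_pos _ _).le (hH.nonneg _)).trans (hH.integral_le 0)

lemma IsProfile.integrable {H : Space d → ℝ} {h : ℝ} (hH : IsProfile H h) (ζ : Space d) :
    Integrable fun z => decay (d + 1) z * H (ζ + z) := by
  obtain ⟨M, hM⟩ := hH.bounded
  refine (integrable_decay (Nat.lt_succ_self d)).mul_bdd (c := M)
    (hH.measurable.comp (measurable_const_add ζ)).aestronglyMeasurable
    (Eventually.of_forall fun z => ?_)
  rw [Real.norm_of_nonneg (hH.nonneg _)]
  exact hM _

/-- The pointwise bound contained in `ShiftBound`; the growth in the difference of the momenta costs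
`N` powers of the decay. -/
lemma ShiftBound.norm_le {N K₀ : ℕ} {H : Space d → ℝ} {K : Space d × Space d → ℂ}
    (hK : ShiftBound N K₀ H K) (hN : N ≤ K₀) {c : ℝ} (hc : ∀ ζ, H ζ ≤ c)
    (x : Space d × Space d) : ‖K x‖ ≤ c * decay (K₀ - N) x.1 * decay (K₀ - N) x.2 := by
  have h1 := (hK x 0 0 (by simp)).norm_zero_le
  simp only [mul_zero, smul_zero, add_zero, norm_mul, norm_expi, one_mul, abs_zero] at h1
  have hc0 : 0 ≤ c := by
    by_contra hneg
    have h2 : (0 : ℝ) ≤ H (x.1 - x.2) * ((1 + ‖x.1 - x.2‖) ^ N * decay K₀ x.1 * decay K₀ x.2) := by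
      refine (norm_nonneg _).trans (h1.trans_eq (by ring))
    have h3 : 0 < (1 + ‖x.1 - x.2‖) ^ N * decay K₀ x.1 * decay K₀ x.2 := by
      have := decay_pos K₀ x.1
      have := decay_pos K₀ x.2
      positivity
    have h4 := nonneg_of_mul_nonneg_left h2 h3
    linarith [hc (x.1 - x.2)]
  have h5 : ∀ y : Space d, decay K₀ y * (1 + ‖y‖) ^ N = decay (K₀ - N) y := by
    intro y
    have : K₀ = (K₀ - N) + N := by omega
    conv_lhs => rw [this, decay_add, mul_assoc, decay_mul_pow, mul_one]
  have h6 : (1 + ‖x.1 - x.2‖) ^ N ≤ (1 + ‖x.1‖) ^ N * (1 + ‖x.2‖) ^ N := by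
    rw [← mul_pow]
    gcongr
    nlinarith [norm_sub_le x.1 x.2, norm_nonneg x.1, norm_nonneg x.2]
  have p1 := decay_pos K₀ x.1
  have p2 := decay_pos K₀ x.2
  calc ‖K x‖ ≤ _ := h1
    _ ≤ c * ((1 + ‖x.1‖) ^ N * (1 + ‖x.2‖) ^ N) * decay K₀ x.1 * decay K₀ x.2 := by
      gcongr
      exact hc _
    _ = _ := by rw [← h5, ← h5]; ring

lemma decay_step_mul_le (K₀ : ℕ) (g : Fin 2) (x : Space d × Space d) (z : Space d) :
    decay K₀ (step g x z).1 * decay K₀ (step g x z).2 ≤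
      decay K₀ x.1 * decay K₀ x.2 * (1 + ‖z‖) ^ K₀ := by
  have p1 := decay_pos K₀ x.1
  have p2 := decay_pos K₀ x.2
  fin_cases g
  · simp only [Fin.zero_eta, step_zero]
    calc _ ≤ decay K₀ x.1 * (1 + ‖z‖) ^ K₀ * decay K₀ x.2 := by
          gcongr; exact decay_add_le _ _ _
      _ = _ := by ring
  · simp only [Fin.mk_one, step_one]
    calc _ ≤ decay K₀ x.1 * (decay K₀ x.2 * (1 + ‖z‖) ^ K₀) := by
          gcongr; exact decay_sub_le _ _ _
      _ = _ := by ring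

lemma step_add_add (g : Fin 2) (A B z w : Space d) :
    step g (A + w, B + w) z = ((step g (A, B) z).1 + w, (step g (A, B) z).2 + w) := by
  simp only [step, Prod.mk.injEq]
  constructor <;> module

lemma decay_kernel_mul (N K₀ : ℕ) (z : Space d) :
    decay (N + K₀ + (d + 1)) z * (1 + ‖z‖) ^ N * (1 + ‖z‖) ^ K₀ = decay (d + 1) z := by
  rw [mul_assoc, ← pow_add, decay_add, mul_right_comm, decay_mul_pow, one_mul]

/-- A collision turns a profile into a constant one. The growth of the weights under the momentum
transfer is absorbed in the decay of the kernel. -/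
lemma ShiftBound.collide {N K₀ : ℕ} {H : Space d → ℝ} {h ck : ℝ} {Q : Space d × Space d → ℂ}
    {k : Space d → ℂ} (hQ : ShiftBound N K₀ H Q) (hH : IsProfile H h) (hm : BoundedMeasurable Q)
    (hk : Integrable k) (hck : 0 ≤ ck) (hkb : ∀ z, ‖k z‖ ≤ ck * decay (N + K₀ + (d + 1)) z)
    (g : Fin 2) : ShiftBound N K₀ (fun _ => ck * h) (collide k g Q) := by
  intro x v β hv
  set ζ := x.1 - x.2 with hζ
  set T := (1 + |β| + ‖ζ‖) ^ N * (decay K₀ x.1 * decay K₀ x.2) with hT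
  have hT0 : 0 ≤ T := by
    have := decay_pos K₀ x.1
    have := decay_pos K₀ x.2
    positivity
  have h1 : ∀ s : ℝ, expi (β * s) * LorentzGas.collide k g Q (x.1 + s • v, x.2 + s • v) =
      ∫ z, k z * (expi (β * s) * Q ((step g x z).1 + s • v, (step g x z).2 + s • v)) := by
    intro s
    rw [LorentzGas.collide, ← integral_const_mul]
    refine integral_congr_ae (Eventually.of_forall fun z => ?_)
    simp only [step_add_add]
    ring
  simp only [h1]
  have hcz : ∀ z, ‖k z‖ * (H (ζ + z) * (1 + |β| + ‖ζ + z‖) ^ N *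
      decay K₀ (step g x z).1 * decay K₀ (step g x z).2) ≤
        ck * T * (decay (d + 1) z * H (ζ + z)) := by
    intro z
    have hH0 := hH.nonneg (ζ + z)
    have q1 := decay_pos K₀ (step g x z).1
    have q2 := decay_pos K₀ (step g x z).2
    have h2 : 1 + |β| + ‖ζ + z‖ ≤ (1 + |β| + ‖ζ‖) * (1 + ‖z‖) := by
      nlinarith [norm_add_le ζ z, norm_nonneg z, norm_nonneg ζ, abs_nonneg β,
        mul_nonneg (abs_nonneg β) (norm_nonneg z), mul_nonneg (norm_nonneg ζ) (norm_nonneg z)]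
    have hdk := decay_pos (N + K₀ + (d + 1)) z
    calc ‖k z‖ * (H (ζ + z) * (1 + |β| + ‖ζ + z‖) ^ N *
          decay K₀ (step g x z).1 * decay K₀ (step g x z).2)
        = ‖k z‖ * (H (ζ + z) * (1 + |β| + ‖ζ + z‖) ^ N *
          (decay K₀ (step g x z).1 * decay K₀ (step g x z).2)) := by ring
      _ ≤ ck * decay (N + K₀ + (d + 1)) z * (H (ζ + z) * ((1 + |β| + ‖ζ‖) * (1 + ‖z‖)) ^ N *
          (decay K₀ x.1 * decay K₀ x.2 * (1 + ‖z‖) ^ K₀)) := by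
          refine mul_le_mul (hkb z) (mul_le_mul ?_ (decay_step_mul_le K₀ g x z) (by positivity)
            (by positivity)) (by positivity) (by positivity)
          gcongr
      _ = ck * T * ((decay (N + K₀ + (d + 1)) z * (1 + ‖z‖) ^ N * (1 + ‖z‖) ^ K₀) *
            H (ζ + z)) := by
          rw [hT, mul_pow]; ring
      _ = _ := by rw [decay_kernel_mul]
  have hD : DiffBound N (∫ z, ck * T * (decay (d + 1) z * H (ζ + z))) (fun s => ∫ z,
      k z * (expi (β * s) * Q ((step g x z).1 + s • v, (step g x z).2 + s • v))) := by
    refine DiffBound.integral (fun z => ?_) (fun s => ?_) ((hH.integrable ζ).const_mul _)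
    · have h3 := (hQ (step g x z) v β hv).const_mul (k z)
      rw [step_fst_sub_snd] at h3
      exact h3.mono (hcz z)
    · have h4 := (integrable_collide hk g hm (x.1 + s • v, x.2 + s • v)).const_mul (expi (β * s))
      refine h4.congr (Eventually.of_forall fun z => ?_)
      simp only [step_add_add]
      ring
  refine hD.mono ?_
  rw [integral_const_mul]
  have := mul_le_mul_of_nonneg_left (hH.integral_le ζ) (mul_nonneg hck hT0)
  refine this.trans_eq ?_
  rw [hT]
  ring

lemma phase_add_add (u : ℝ) (A B w : Space d) :
    phase u (A + w, B + w) = phase u (A, B) * expi (u * inner ℝ w (A - B)) := by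
  rw [phase, phase, ← expi_add]
  simp only [norm_add_sq_real, inner_sub_right, real_inner_comm w]
  ring_nf

/-- Multiplication by the free evolution factor and by a function of the difference of the momenta:
under a simultaneous translation, the former changes by a linear phase with frequency at most
`u ‖ζ‖`, and the latter not at all. -/
lemma ShiftBound.phase_mul {N K₀ : ℕ} {H H' : Space d → ℝ} {K : Space d × Space d → ℂ} {u : ℝ}
    {m : Space d → ℂ} (hK : ShiftBound N K₀ H K) (hu : 0 ≤ u) (hH : ∀ ζ, 0 ≤ H ζ)
    (h : ∀ ζ, ‖m ζ‖ * H ζ * (1 + u * min 1 ‖ζ‖) ^ N ≤ H' ζ) :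
    ShiftBound N K₀ H' (fun x => phase u x * m (x.1 - x.2) * K x) := by
  intro x v β hv
  set ζ := x.1 - x.2 with hζ
  have h1 := (hK x v (β + u * inner ℝ v ζ) hv).const_mul (phase u x * m ζ)
  have h2 : (fun s : ℝ => phase u x * m ζ *
      (expi ((β + u * inner ℝ v ζ) * s) * K (x.1 + s • v, x.2 + s • v))) = fun s =>
      expi (β * s) * (phase u (x.1 + s • v, x.2 + s • v) * m (x.1 + s • v - (x.2 + s • v)) *
        K (x.1 + s • v, x.2 + s • v)) := by
    funext s
    rw [phase_add_add, add_sub_add_right_eq_sub, add_mul, expi_add, real_inner_smul_left, hζ,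
      show u * (s * inner ℝ v (x.1 - x.2)) = u * inner ℝ v (x.1 - x.2) * s by ring]
    ring
  rw [h2] at h1
  refine h1.mono ?_
  rw [norm_mul, norm_phase, one_mul]
  have p1 := decay_pos K₀ x.1
  have p2 := decay_pos K₀ x.2
  have h3 : |β + u * inner ℝ v ζ| ≤ |β| + u * ‖ζ‖ := by
    refine (abs_add_le _ _).trans ?_
    rw [abs_mul, abs_of_nonneg hu]
    gcongr
    refine (abs_real_inner_le_norm v ζ).trans ?_
    exact mul_le_of_le_one_left (norm_nonneg _) hv
  have h4 : u * ‖ζ‖ ≤ u * min 1 ‖ζ‖ * (1 + ‖ζ‖) := by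
    rw [mul_assoc]
    gcongr
    have := norm_nonneg ζ
    rcases le_total 1 ‖ζ‖ with h | h
    · rw [min_eq_left h]; linarith
    · rw [min_eq_right h]; nlinarith
  have hmin : 0 ≤ min 1 ‖ζ‖ := le_min zero_le_one (norm_nonneg _)
  have h5 : 1 + |β + u * inner ℝ v ζ| + ‖ζ‖ ≤ (1 + u * min 1 ‖ζ‖) * (1 + |β| + ‖ζ‖) := by
    nlinarith [mul_nonneg (mul_nonneg hu hmin) (abs_nonneg β)]
  have hHz := hH ζ
  calc ‖m ζ‖ * (H ζ * (1 + |β + u * inner ℝ v ζ| + ‖ζ‖) ^ N * decay K₀ x.1 * decay K₀ x.2)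
      ≤ ‖m ζ‖ * (H ζ * ((1 + u * min 1 ‖ζ‖) * (1 + |β| + ‖ζ‖)) ^ N * decay K₀ x.1 *
          decay K₀ x.2) := by gcongr
    _ = (‖m ζ‖ * H ζ * (1 + u * min 1 ‖ζ‖) ^ N) * (1 + |β| + ‖ζ‖) ^ N * decay K₀ x.1 *
          decay K₀ x.2 := by rw [mul_pow]; ring
    _ ≤ _ := by
      gcongr
      exact h ζ

/-- The final state: the observable, evaluated at the rescaled difference and at the mean of the
momenta. -/
lemma exists_shiftBound_tildeTransform (a : SchwartzMap (Space d × Space d) ℂ) (N K₀ : ℕ) (t : ℝ)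
    (ht : 0 ≤ t) : ∃ C : ℝ, 0 ≤ C ∧ ∀ (ε u : ℝ) (m : Space d → ℂ), 0 < ε → ε ≤ 1 → 0 ≤ u →
      u * ε ≤ t → (∀ ζ, ‖m ζ‖ ≤ 1) →
      ShiftBound N K₀ (fun ζ => C * decay (d + 1) (ε⁻¹ • ζ)) (fun x =>
        phase u x * m (x.1 - x.2) *
          tildeTransform a (-(ε⁻¹ • (x.1 - x.2))) ((1 / 2 : ℝ) • (x.1 + x.2))) := by
  obtain ⟨C, hC, h⟩ := exists_tildeTransform_diffBound a N (K₀ + K₀) (N + (K₀ + K₀) + (d + 1))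
  have hpi : 1 ≤ 2 * Real.pi := by linarith [Real.pi_gt_three]
  refine ⟨2 ^ N * (2 * Real.pi * (1 + t)) ^ N * C, by positivity, ?_⟩
  intro ε u m hε hε1 hu hut hm x v β hv
  set ζ := x.1 - x.2 with hζ
  set η := ε⁻¹ • ζ with hη
  set Y := (1 / 2 : ℝ) • (x.1 + x.2) with hY
  have hζη : ‖ζ‖ = ε * ‖η‖ := by
    rw [hη, norm_smul, Real.norm_of_nonneg (by positivity), mul_inv_cancel_left₀ hε.ne']
  have hζη' : ‖ζ‖ ≤ ‖η‖ := by rw [hζη]; exact mul_le_of_le_one_left (norm_nonneg _) hε1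
  set β' := β + u * inner ℝ v ζ with hβ'
  have h1 := ((diffBound_expi_linear N β').mul (h (-η) Y v hv)).const_mul (phase u x * m ζ)
  have h2 : (fun s : ℝ => phase u x * m ζ * (expi (β' * s) * tildeTransform a (-η) (Y + s • v))) =
      fun s => expi (β * s) * (phase u (x.1 + s • v, x.2 + s • v) *
        m (x.1 + s • v - (x.2 + s • v)) *
          tildeTransform a (-(ε⁻¹ • (x.1 + s • v - (x.2 + s • v))))
            ((1 / 2 : ℝ) • (x.1 + s • v + (x.2 + s • v)))) := by
    funext s
    rw [phase_add_add, add_sub_add_right_eq_sub, hβ', add_mul, expi_add, real_inner_smul_left, hζ,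
      show u * (s * inner ℝ v (x.1 - x.2)) = u * inner ℝ v (x.1 - x.2) * s by ring,
      show (1 / 2 : ℝ) • (x.1 + s • v + (x.2 + s • v)) = Y + s • v by rw [hY]; module]
    ring
  rw [h2] at h1
  refine h1.mono ?_
  rw [norm_mul, norm_phase, one_mul, decay_neg]
  have p1 := decay_pos K₀ x.1
  have p2 := decay_pos K₀ x.2
  have pη := norm_nonneg η
  have h3 : 1 + 2 * Real.pi * |β'| ≤ 2 * Real.pi * (1 + t) * (1 + |β| + ‖ζ‖) * (1 + ‖η‖) := by
    have h4 : |β'| ≤ |β| + t * ‖η‖ := by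
      refine (abs_add_le _ _).trans ?_
      rw [abs_mul, abs_of_nonneg hu]
      refine add_le_add_right ?_ _
      calc u * |inner ℝ v ζ| ≤ u * ‖ζ‖ := by
            gcongr
            exact (abs_real_inner_le_norm v ζ).trans (mul_le_of_le_one_left (norm_nonneg _) hv)
        _ = u * ε * ‖η‖ := by rw [hζη]; ring
        _ ≤ t * ‖η‖ := by gcongr
    have h5 : 1 + |β'| ≤ (1 + t) * (1 + |β| + ‖ζ‖) * (1 + ‖η‖) := by
      have e1 : 0 ≤ t * |β| := by positivity
      have e2 : 0 ≤ t * ‖ζ‖ := by positivity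
      have e3 : 0 ≤ (1 + t) * (|β| + ‖ζ‖) * ‖η‖ := by positivity
      have e4 := norm_nonneg ζ
      calc 1 + |β'| ≤ 1 + (|β| + t * ‖η‖) := by linarith
        _ ≤ _ := by nlinarith
    calc 1 + 2 * Real.pi * |β'| ≤ 2 * Real.pi * (1 + |β'|) := by linarith
      _ ≤ 2 * Real.pi * ((1 + t) * (1 + |β| + ‖ζ‖) * (1 + ‖η‖)) := by gcongr
      _ = _ := by ring
  have hYd : ∀ y w : Space d, Y = y + w → ‖w‖ ≤ ‖η‖ →
      decay K₀ Y ≤ decay K₀ y * (1 + ‖η‖) ^ K₀ := by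
    intro y w hyw hw
    rw [hyw]
    refine (decay_add_le K₀ y w).trans ?_
    have := decay_pos K₀ y
    gcongr
  have hw : ‖(1 / 2 : ℝ) • ζ‖ ≤ ‖η‖ := by
    rw [norm_smul, Real.norm_of_nonneg (by norm_num)]
    linarith [norm_nonneg ζ]
  have hY1 := hYd x.1 (-((1 / 2 : ℝ) • ζ)) (by rw [hY, hζ]; module) (by rwa [norm_neg])
  have hY2 := hYd x.2 ((1 / 2 : ℝ) • ζ) (by rw [hY, hζ]; module) hw
  have pY := decay_pos K₀ Y
  have pd := decay_pos (N + (K₀ + K₀) + (d + 1)) η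
  have pDY := decay_pos (K₀ + K₀) Y
  calc ‖m ζ‖ * (2 ^ N * (1 + 2 * Real.pi * |β'|) ^ N *
        (C * decay (N + (K₀ + K₀) + (d + 1)) η * decay (K₀ + K₀) Y))
      ≤ 1 * (2 ^ N * (2 * Real.pi * (1 + t) * (1 + |β| + ‖ζ‖) * (1 + ‖η‖)) ^ N *
        (C * decay (N + (K₀ + K₀) + (d + 1)) η *
          ((decay K₀ x.1 * (1 + ‖η‖) ^ K₀) * (decay K₀ x.2 * (1 + ‖η‖) ^ K₀)))) := by
        gcongr
        · exact hm ζ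
        · rw [decay_add]
          exact mul_le_mul hY1 hY2 pY.le (by positivity)
    _ = 2 ^ N * (2 * Real.pi * (1 + t)) ^ N * C * (decay (N + (K₀ + K₀) + (d + 1)) η *
          (1 + ‖η‖) ^ N * (1 + ‖η‖) ^ (K₀ + K₀)) * (1 + |β| + ‖ζ‖) ^ N * decay K₀ x.1 *
            decay K₀ x.2 := by
        rw [mul_pow _ (1 + ‖η‖), mul_pow _ (1 + |β| + ‖ζ‖), pow_add _ K₀ K₀]
        ring
    _ = _ := by rw [decay_kernel_mul]

end ShiftBound

section Oscillation

variable {W : SchwartzMap (Space d) ℂ}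

/-- The growth of the weight in `ShiftBound` after two momentum transfers of size `z₁` and `z₂`,
starting from momenta of size `a₁` and `a₂`. -/
lemma oscillation_shift_le {u a₁ a₂ z₁ z₂ B Z : ℝ} (hu : 0 ≤ u) (ha₁ : 0 ≤ a₁) (ha₂ : 0 ≤ a₂)
    (hz₁ : 0 ≤ z₁) (hz₂ : 0 ≤ z₂) (hB : B ≤ u * (a₁ + a₂ + z₁)) (hZ : Z ≤ a₁ + a₂ + z₁ + z₂) :
    1 + B + Z ≤ (1 + u) * ((1 + a₁) * (1 + a₂)) * ((1 + z₁) * (1 + z₂)) := by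
  have e1 : 1 + (a₁ + a₂ + z₁ + z₂) ≤ ((1 + a₁) * (1 + a₂)) * ((1 + z₁) * (1 + z₂)) := by
    have m1 : 1 + a₁ + a₂ ≤ (1 + a₁) * (1 + a₂) := by nlinarith
    have m2 : 1 + z₁ + z₂ ≤ (1 + z₁) * (1 + z₂) := by nlinarith
    have m3 := mul_le_mul m1 m2 (by positivity) (by positivity)
    nlinarith [mul_nonneg (add_nonneg ha₁ ha₂) (add_nonneg hz₁ hz₂)]
  have e2 : u * (a₁ + a₂ + z₁) ≤ u * (a₁ + a₂ + z₁ + z₂) := by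
    exact mul_le_mul_of_nonneg_left (by linarith) hu
  calc 1 + B + Z ≤ (1 + u) * (1 + (a₁ + a₂ + z₁ + z₂)) := by nlinarith
    _ ≤ (1 + u) * (((1 + a₁) * (1 + a₂)) * ((1 + z₁) * (1 + z₂))) := by gcongr
    _ = _ := by ring

/-- The product of the bounds on the factors of the integrand for two collisions, rearranged so that
the growth in each variable is next to the decay that compensates it. -/
lemma oscillation_weight_le {cc C₁ C₂ k₁ k₂ s u h S a₁ a₂ b₁ b₂ y₁ y₂ z₁ z₂ : ℝ} (N K : ℕ)
    (hcc : 0 ≤ cc) (hC₁ : 0 ≤ C₁) (hC₂ : 0 ≤ C₂) (hk₁ : 0 ≤ k₁) (hk₂ : 0 ≤ k₂) (hs : 0 ≤ s)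
    (hsu : s ≤ u) (hh : 0 ≤ h) (hS : 0 ≤ S) (ha₁ : 0 ≤ a₁) (ha₂ : 0 ≤ a₂) (hz₁ : 0 ≤ z₁)
    (hz₂ : 0 ≤ z₂) (hbig : S ≤ (1 + u) * ((1 + a₁) * (1 + a₂)) * ((1 + z₁) * (1 + z₂)))
    (hy : 0 ≤ y₁ * y₂) (hdec : y₁ * y₂ ≤ b₁ * b₂ * (1 + z₁) ^ K * (1 + z₂) ^ K) :
    cc * (2 ^ N * (2 ^ N * (C₁ * k₁) * (C₁ * k₂)) * (2 ^ N * (C₂ * (1 + s) ^ N) *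
        (h * S ^ N * y₁ * y₂))) ≤
      cc * (2 ^ N * (2 ^ N * C₁ * C₁) * (2 ^ N * (C₂ * (1 + u) ^ N) *
        ((1 + u) ^ N * ((b₁ * (1 + a₁) ^ N) * (b₂ * (1 + a₂) ^ N))))) *
      ((k₁ * (1 + z₁) ^ N * (1 + z₁) ^ K) * ((k₂ * (1 + z₂) ^ N * (1 + z₂) ^ K) * h)) := by
  have hu : 0 ≤ u := hs.trans hsu
  rw [mul_assoc (h * S ^ N)]
  calc _ ≤ cc * (2 ^ N * (2 ^ N * (C₁ * k₁) * (C₁ * k₂)) * (2 ^ N * (C₂ * (1 + u) ^ N) *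
        (h * ((1 + u) * ((1 + a₁) * (1 + a₂)) * ((1 + z₁) * (1 + z₂))) ^ N *
          (b₁ * b₂ * (1 + z₁) ^ K * (1 + z₂) ^ K)))) := by
        refine mul_le_mul_of_nonneg_left (mul_le_mul_of_nonneg_left (mul_le_mul ?_ (mul_le_mul ?_
          hdec hy ?_) (by positivity) (by positivity)) (by positivity)) hcc
        · gcongr
        · gcongr
        · positivity
    _ = _ := by
        simp only [mul_pow]
        ring

set_option maxHeartbeats 600000 in
/-- Two consecutive collisions with distinct scatterers, with nothing but free evolution in between,
oscillate: translating the two momentum transfers by `s ν` and `-s ν`, where `ν` is the direction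
from one scatterer to the other, multiplies the product of the two kernels by the phase
`e(-‖Q - Q'‖ s)`, while everything else varies at unit scale. -/
lemma exists_norm_collide_collide_le (W : SchwartzMap (Space d) ℂ) (N K₀ : ℕ) (hNK : N ≤ K₀) :
    ∃ C : ℝ, 0 ≤ C ∧ ∀ (c c' : ℂ) (Q Q' : Space d) (g g' : Fin 2) (u ρ h : ℝ) (H : Space d → ℝ)
      (G : Space d × Space d → ℂ), 0 ≤ u → 0 < ρ → N ≤ 2 * ρ → ρ ≤ ‖Q - Q'‖ → IsProfile H h →
      ShiftBound N K₀ H G → BoundedMeasurable G → ∀ x : Space d × Space d,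
      ‖collide (kern W c Q) g (fun y => phase u y * collide (kern W c' Q') g' G y) x‖ ≤
        C * (‖c‖ * ‖c'‖) * (1 + u) ^ (2 * N) * ((4 * ρ) ^ N)⁻¹ * h *
          decay (K₀ - N) x.1 * decay (K₀ - N) x.2 := by
  obtain ⟨C₁, hC₁, hW⟩ := exists_diffBound_schwartz (𝓕 W) N (N + K₀ + (d + 1))
  obtain ⟨C₂, hC₂, hquad⟩ := exists_diffBound_expi_quadratic N
  have hJi : Integrable (decay (d + 1) : Space d → ℝ) := integrable_decay (Nat.lt_succ_self d)
  set J := ∫ x : Space d, decay (d + 1) x with hJ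
  have hJ0 : 0 ≤ J := integral_nonneg fun x => (decay_pos _ _).le
  refine ⟨2 ^ N * 2 ^ N * 2 ^ N * C₁ * C₁ * C₂ * J, by positivity, ?_⟩
  intro c c' Q Q' g g' u ρ h H G hu hρ hN hQ hH hG hm x
  set ρ' := ‖Q - Q'‖ with hρ'
  have hρ'0 : 0 < ρ' := hρ.trans_le hQ
  set ν := ρ'⁻¹ • (Q - Q') with hν
  have hν1 : ‖ν‖ = 1 := by
    rw [hν, norm_smul, norm_inv, Real.norm_of_nonneg hρ'0.le, ← hρ', inv_mul_cancel₀ hρ'0.ne']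
  have hQν : inner ℝ (Q - Q') ν = ρ' := by
    rw [hν, real_inner_smul_right, real_inner_self_eq_norm_sq, ← hρ']
    field_simp
  set γ : ℝ := ((g : ℕ) : ℝ) with hγ
  set γ' : ℝ := ((g' : ℕ) : ℝ) with hγ'
  -- the momenta after both collisions move by a common vector, which is zero if `g = g'`
  set v := (γ' - γ) • ν with hv
  have hvn : ‖v‖ ≤ 1 := by
    rw [hv, norm_smul, hν1, mul_one, hγ, hγ']
    fin_cases g <;> fin_cases g' <;> simp
  set ζ := x.1 - x.2 with hζ
  -- the momenta after the first and after the second collision; `X` is the one that the first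
  -- collision changes
  set P₁ : Space d → Space d × Space d := fun z => step g x z with hP₁
  set P₂ : Space d × Space d → Space d × Space d := fun p => step g' (step g x p.1) p.2 with hP₂
  set X : Space d → Space d := fun z => if g = 0 then (P₁ z).1 else (P₁ z).2 with hX
  set σ : ℝ := if g = 0 then 1 else -1 with hσ
  have hphase : ∀ (z : Space d) (s : ℝ), phase u (step g x (z + s • ν)) =
      phase u (P₁ z) * expi (u * inner ℝ (X z) ν * s) * expi (σ * (u / 2) * s ^ 2) := by
    intro z s
    have hν2 : ‖ν‖ ^ 2 = 1 := by rw [hν1]; norm_num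
    rw [phase, phase, ← expi_add, ← expi_add]
    congr 1
    fin_cases g
    · simp only [hP₁, hX, hσ, Fin.zero_eta, step_zero, if_true]
      rw [show x.1 + (z + s • ν) = (x.1 + z) + s • ν by abel, norm_add_sq_real,
        real_inner_smul_right, norm_smul, mul_pow, hν2, Real.norm_eq_abs, sq_abs]
      ring
    · simp only [hP₁, hX, hσ, Fin.mk_one, step_one]
      simp only [one_ne_zero, if_false]
      rw [show x.2 - (z + s • ν) = (x.2 - z) - s • ν by abel, norm_sub_sq_real,
        real_inner_smul_right, norm_smul, mul_pow, hν2, Real.norm_eq_abs, sq_abs]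
      ring
  have hP₂s : ∀ (p : Space d × Space d) (s : ℝ),
      step g' (step g x (p.1 + s • ν)) (p.2 - s • ν) = ((P₂ p).1 + s • v, (P₂ p).2 + s • v) := by
    intro p s
    simp only [hP₂, step, hv, Prod.mk.injEq]
    constructor <;> module
  set B : Space d → ℂ := fun z => (𝓕 W : SchwartzMap (Space d) ℂ) z with hB
  have hBc : Continuous B := (𝓕 W).continuous
  have hBi : Integrable B := (𝓕 W).integrable
  -- the integrand at translated transfers, except that the phases of the two kernels stay in place
  set F : Space d × Space d → ℝ → ℂ := fun p s =>
    (c * c' * expi (-inner ℝ Q p.1) * expi (-inner ℝ Q' p.2) * phase u (P₁ p.1)) *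
      ((B (p.1 + s • ν) * B (p.2 + s • (-ν))) * (expi (σ * (u / 2) * s ^ 2) *
        (expi (u * inner ℝ (X p.1) ν * s) * G ((P₂ p).1 + s • v, (P₂ p).2 + s • v)))) with hF
  set Φ : Space d × Space d → ℂ := fun p => kern W c Q p.1 * (phase u (P₁ p.1) *
    (kern W c' Q' p.2 * G (P₂ p))) with hΦ
  have hshift₀ : ∀ (p : Space d × Space d) (s : ℝ),
      F p s = expi (ρ' * s) * Φ (p + (s • ν, -(s • ν))) := by
    intro p s
    have e1 : inner ℝ Q ν - inner ℝ Q' ν = ρ' := by rw [← inner_sub_left, hQν]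
    have e2 : expi (-inner ℝ Q p.1) * expi (-inner ℝ Q' p.2) = expi (ρ' * s) *
        (expi (-inner ℝ Q (p.1 + s • ν)) * expi (-inner ℝ Q' (p.2 + -(s • ν)))) := by
      rw [← expi_add, ← expi_add, ← expi_add]
      congr 1
      simp only [inner_add_right, inner_neg_right, real_inner_smul_right]
      rw [← e1]
      ring
    have e3 : P₂ (p + (s • ν, -(s • ν))) = ((P₂ p).1 + s • v, (P₂ p).2 + s • v) := by
      rw [← hP₂s]
      simp [hP₂, sub_eq_add_neg]
    simp only [hF, hΦ, e3, Prod.fst_add, Prod.snd_add, kern_apply, ← SchwartzMap.fourier_coe]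
    simp only [hP₁] at hphase ⊢
    rw [hphase, smul_neg]
    simp only [hB]
    linear_combination (c * c' * phase u (step g x p.1) *
      ((𝓕 W : SchwartzMap (Space d) ℂ) (p.1 + s • ν) *
        (𝓕 W : SchwartzMap (Space d) ℂ) (p.2 + -(s • ν))) *
      (expi (σ * (u / 2) * s ^ 2) * (expi (u * inner ℝ (X p.1) ν * s) *
        G ((P₂ p).1 + s • v, (P₂ p).2 + s • v)))) * e2
  have hP₂c : Continuous P₂ := by
    simp only [hP₂, step]
    fun_prop
  have hP₁c : Continuous P₁ := by
    simp only [hP₁, step]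
    fun_prop
  have hΦi : Integrable Φ := by
    obtain ⟨M, hM⟩ := hm.bounded
    have h1 : Integrable fun p : Space d × Space d => kern W c Q p.1 * kern W c' Q' p.2 :=
      (integrable_kern W c Q).mul_prod (integrable_kern W c' Q')
    have h2 := h1.mul_bdd (c := M) (g := fun p => phase u (P₁ p.1) * G (P₂ p)) ?_ ?_
    · refine h2.congr (Eventually.of_forall fun p => ?_)
      simp only [hΦ]
      ring
    · refine AEStronglyMeasurable.mul ?_ ?_
      · exact (by fun_prop : Continuous fun p : Space d × Space d =>
          phase u (P₁ p.1)).aestronglyMeasurable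
      · exact (hm.stronglyMeasurable.comp_measurable hP₂c.measurable).aestronglyMeasurable
    · refine Eventually.of_forall fun p => ?_
      rw [norm_mul, norm_phase, one_mul]
      exact hM _
  have he0 : expi 0 = 1 := by simp [expi]
  have hmain : collide (kern W c Q) g (fun y => phase u y * collide (kern W c' Q') g' G y) x =
      ∫ p, F p 0 := by
    have h0 : ∀ p, F p 0 = Φ p := fun p => by
      rw [hshift₀, mul_zero, zero_smul, neg_zero, Prod.mk_zero_zero, add_zero, he0, one_mul]
    simp only [h0]
    rw [Measure.volume_eq_prod, integral_prod _ (by rw [← Measure.volume_eq_prod]; exact hΦi)]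
    simp only [collide, hΦ, integral_const_mul]
    rfl
  have : (volume : Measure (Space d × Space d)).IsAddRightInvariant := by
    rw [Measure.volume_eq_prod]
    infer_instance
  have hFint : ∀ s, ∫ p, F p s = expi (ρ' * s) * ∫ p, Φ p := by
    intro s
    simp only [hshift₀]
    rw [integral_const_mul, integral_add_right_eq_self Φ]
  set T := (‖c‖ * ‖c'‖) * (2 ^ N * (2 ^ N * C₁ * C₁) * (2 ^ N * (C₂ * (1 + u) ^ N) *
    ((1 + u) ^ N * (decay (K₀ - N) x.1 * decay (K₀ - N) x.2)))) with hT
  have hd1 := decay_pos (K₀ - N) x.1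
  have hd2 := decay_pos (K₀ - N) x.2
  have hT0 : 0 ≤ T := by positivity
  have hdiff : ∀ p, DiffBound N (T * (decay (d + 1) p.1 * (decay (d + 1) p.2 * H (ζ + p.1 + p.2))))
      (F p) := by
    intro p
    have hzeta : (P₂ p).1 - (P₂ p).2 = ζ + p.1 + p.2 := by
      simp only [hP₂]
      rw [step_fst_sub_snd, step_fst_sub_snd]
    have b1 := (hW p.1 ν hν1.le).mul (hW p.2 (-ν) (by rw [norm_neg, hν1]))
    have b2 := hquad (σ * (u / 2))
    have b3 := hG (P₂ p) v (u * inner ℝ (X p.1) ν) hvn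
    rw [hzeta] at b3
    have b4 := (b1.mul (b2.mul b3)).const_mul
      (c * c' * expi (-inner ℝ Q p.1) * expi (-inner ℝ Q' p.2) * phase u (P₁ p.1))
    refine b4.mono ?_
    simp only [norm_mul, norm_expi, norm_phase, mul_one]
    have hH0 := hH.nonneg (ζ + p.1 + p.2)
    have n1 := norm_nonneg p.1
    have n2 := norm_nonneg p.2
    have n3 := norm_nonneg x.1
    have n4 := norm_nonneg x.2
    have hσu : |σ * (u / 2)| ≤ u := by
      rw [abs_mul, abs_of_nonneg (by positivity : 0 ≤ u / 2), hσ]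
      split_ifs <;> simp <;> linarith
    have hXn : ‖X p.1‖ ≤ ‖x.1‖ + ‖x.2‖ + ‖p.1‖ := by
      simp only [hX, hP₁]
      split_ifs with hg
      · rw [hg, step_zero]
        linarith [norm_add_le x.1 p.1]
      · have hg1 : g = 1 := by omega
        rw [hg1, step_one]
        linarith [norm_sub_le x.2 p.1]
    have hβ : |u * inner ℝ (X p.1) ν| ≤ u * (‖x.1‖ + ‖x.2‖ + ‖p.1‖) := by
      rw [abs_mul, abs_of_nonneg hu]
      gcongr
      refine (abs_real_inner_le_norm _ _).trans ?_
      rwa [hν1, mul_one]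
    have hζn : ‖ζ + p.1 + p.2‖ ≤ ‖x.1‖ + ‖x.2‖ + ‖p.1‖ + ‖p.2‖ := by
      have e1 := norm_add_le (ζ + p.1) p.2
      have e2 := norm_add_le ζ p.1
      have e3 := norm_sub_le x.1 x.2
      rw [← hζ] at e3
      linarith
    have hbig := oscillation_shift_le hu n3 n4 n1 n2 hβ hζn
    have hdec : decay K₀ (P₂ p).1 * decay K₀ (P₂ p).2 ≤
        decay K₀ x.1 * decay K₀ x.2 * (1 + ‖p.1‖) ^ K₀ * (1 + ‖p.2‖) ^ K₀ := by
      simp only [hP₂]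
      refine (decay_step_mul_le K₀ g' _ _).trans ?_
      exact mul_le_mul_of_nonneg_right (decay_step_mul_le K₀ g x p.1) (by positivity)
    have h5 : ∀ y : Space d, decay K₀ y * (1 + ‖y‖) ^ N = decay (K₀ - N) y := by
      intro y
      have : K₀ = (K₀ - N) + N := by omega
      conv_lhs => rw [this, decay_add, mul_assoc, decay_mul_pow, mul_one]
    have hk1 := decay_pos (N + K₀ + (d + 1)) p.1
    have hk2 := decay_pos (N + K₀ + (d + 1)) p.2
    have hfin := oscillation_weight_le (cc := ‖c‖ * ‖c'‖) N K₀ (by positivity) hC₁ hC₂ hk1.le hk2.le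
      (abs_nonneg _) hσu hH0 (by positivity) n3 n4 n1 n2 hbig
      (mul_nonneg (decay_pos _ _).le (decay_pos _ _).le) hdec
    rw [decay_kernel_mul, decay_kernel_mul, h5, h5, ← hT] at hfin
    exact hfin
  have hci : Integrable fun p : Space d × Space d =>
      decay (d + 1) p.1 * (decay (d + 1) p.2 * H (ζ + p.1 + p.2)) := by
    obtain ⟨M, hM⟩ := hH.bounded
    have h1 := (hJi.mul_prod hJi).mul_bdd (c := M) (g := fun p => H (ζ + p.1 + p.2))
      (hH.measurable.comp (by fun_prop)).aestronglyMeasurable (Eventually.of_forall fun p => by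
        rw [Real.norm_of_nonneg (hH.nonneg _)]; exact hM _)
    refine h1.congr (Eventually.of_forall fun p => ?_)
    simp only
    ring
  have hcint : ∫ p : Space d × Space d,
      decay (d + 1) p.1 * (decay (d + 1) p.2 * H (ζ + p.1 + p.2)) ≤ J * h := by
    rw [Measure.volume_eq_prod, integral_prod _ (by rw [← Measure.volume_eq_prod]; exact hci)]
    simp only [integral_const_mul]
    rw [hJ, ← integral_mul_const]
    refine integral_mono_of_nonneg (Eventually.of_forall fun z => ?_) (hJi.mul_const h)
      (Eventually.of_forall fun z => ?_)
    · exact mul_nonneg (decay_pos _ _).le (integral_nonneg fun w =>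
        mul_nonneg (decay_pos _ _).le (hH.nonneg _))
    · exact mul_le_mul_of_nonneg_left (hH.integral_le _) (decay_pos _ _).le
  have hfin := norm_integral_le_of_diffBound (μ := volume) hdiff
    (fun s => by
      have := (hΦi.comp_add_right (s • ν, -(s • ν))).const_mul (expi (ρ' * s))
      exact this.congr (Eventually.of_forall fun p => (hshift₀ p s).symm))
    (hci.const_mul T) hρ'0 (hN.trans (by linarith)) (fun s => by
      rw [hFint s, hFint 0, mul_zero, he0, one_mul])
  rw [hmain]
  refine hfin.trans ?_
  rw [integral_const_mul]
  have hh := hH.le_nonneg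
  have hρρ : ((4 * ρ') ^ N)⁻¹ ≤ ((4 * ρ) ^ N)⁻¹ := by gcongr
  have hTJ := mul_le_mul_of_nonneg_left hcint hT0
  refine (mul_le_mul hρρ hTJ (mul_nonneg hT0 (integral_nonneg fun p => mul_nonneg (decay_pos _ _).le
    (mul_nonneg (decay_pos _ _).le (hH.nonneg _)))) (by positivity)).trans_eq ?_
  rw [hT, pow_mul' (1 + u) 2 N]
  generalize decay (K₀ - N) x.1 = w₁, decay (K₀ - N) x.2 = w₂, (1 + u) ^ N = w₃,
    ((4 * ρ) ^ N)⁻¹ = w₄, ‖c‖ * ‖c'‖ = w₅, (2 : ℝ) ^ N = w₆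
  clear * -
  ring

end Oscillation

/-! ### Single collision histories, and diagonal tuples -/

section Chain

/-- The integral `∫ (1 + ‖x‖)^{-(d+1)} dx`. -/
noncomputable def decayMass (d : ℕ) : ℝ := ∫ x : Space d, decay (d + 1) x

lemma decayMass_nonneg (d : ℕ) : 0 ≤ decayMass d := integral_nonneg fun _ => (decay_pos _ _).le

lemma integrable_decay_succ : Integrable (decay (d + 1) : Space d → ℝ) :=
  integrable_decay (Nat.lt_succ_self d)

lemma volume_real_closedBall_mul {ε R : ℝ} (hε : 0 ≤ ε) (hR : 0 ≤ R) :
    volume.real (Metric.closedBall (0 : Space d) (R * ε)) =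
      ε ^ d * volume.real (Metric.closedBall (0 : Space d) R) := by
  have h := Measure.addHaar_closedBall_mul (volume : Measure (Space d)) (0 : Space d) hε hR
  rw [mul_comm R, measureReal_def, h, ENNReal.toReal_mul, ENNReal.toReal_ofReal (by positivity),
    ← measureReal_def, finrank_euclideanSpace_fin]

lemma isProfile_const {h : ℝ} (hh : 0 ≤ h) :
    IsProfile (fun _ : Space d => h) (h * decayMass d) where
  measurable := measurable_const
  nonneg _ := hh
  bounded := ⟨h, fun _ => le_rfl⟩
  integral_le ζ := by rw [integral_mul_const, mul_comm, decayMass]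

lemma isProfile_ball {h ρ : ℝ} (hh : 0 ≤ h) :
    IsProfile ((Metric.closedBall (0 : Space d) ρ).indicator fun _ => h)
      (h * volume.real (Metric.closedBall (0 : Space d) ρ)) where
  measurable := measurable_const.indicator measurableSet_closedBall
  nonneg ζ := Set.indicator_nonneg (fun _ _ => hh) _
  bounded := ⟨h, fun ζ => Set.indicator_le_self' (fun _ _ => hh) ζ⟩
  integral_le ζ := by
    have h1 : Integrable ((Metric.closedBall (0 : Space d) ρ).indicator fun _ => h) :=
      (integrable_indicator_iff measurableSet_closedBall).2
        (integrableOn_const measure_closedBall_lt_top.ne)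
    calc ∫ z, decay (d + 1) z * (Metric.closedBall (0 : Space d) ρ).indicator (fun _ => h) (ζ + z)
        ≤ ∫ z, (Metric.closedBall (0 : Space d) ρ).indicator (fun _ => h) (ζ + z) := by
          refine integral_mono_of_nonneg (Eventually.of_forall fun z =>
            mul_nonneg (decay_pos _ _).le (Set.indicator_nonneg (fun _ _ => hh) _))
            (h1.comp_add_left ζ) (Eventually.of_forall fun z => ?_)
          exact mul_le_of_le_one_left (Set.indicator_nonneg (fun _ _ => hh) _) (decay_le_one _ _)
      _ = _ := by
          rw [integral_add_left_eq_self ((Metric.closedBall (0 : Space d) ρ).indicator fun _ => h),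
            integral_indicator measurableSet_closedBall, setIntegral_const, smul_eq_mul, mul_comm]

lemma isProfile_decay {C ε : ℝ} (hC : 0 ≤ C) (hε : 0 < ε) :
    IsProfile (fun ζ : Space d => C * decay (d + 1) (ε⁻¹ • ζ)) (C * decayMass d * ε ^ d) where
  measurable := by
    have : Continuous fun ζ : Space d => C * decay (d + 1) (ε⁻¹ • ζ) := by fun_prop
    exact this.measurable
  nonneg ζ := mul_nonneg hC (decay_pos _ _).le
  bounded := ⟨C, fun ζ => mul_le_of_le_one_right hC (decay_le_one _ _)⟩
  integral_le ζ := by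
    have h1 : Integrable fun z : Space d => decay (d + 1) (ε⁻¹ • z) :=
      (integrable_comp_smul_iff volume _ (inv_ne_zero hε.ne')).2 integrable_decay_succ
    have h2 : Integrable fun z : Space d => C * decay (d + 1) (ε⁻¹ • (ζ + z)) :=
      (h1.comp_add_left ζ).const_mul C
    calc ∫ z, decay (d + 1) z * (C * decay (d + 1) (ε⁻¹ • (ζ + z)))
        ≤ ∫ z, C * decay (d + 1) (ε⁻¹ • (ζ + z)) := by
          refine integral_mono_of_nonneg (Eventually.of_forall fun z =>
            mul_nonneg (decay_pos _ _).le (mul_nonneg hC (decay_pos _ _).le)) h2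
            (Eventually.of_forall fun z => ?_)
          exact mul_le_of_le_one_left (mul_nonneg hC (decay_pos _ _).le) (decay_le_one _ _)
      _ = C * ∫ z : Space d, decay (d + 1) (ε⁻¹ • z) := by
          rw [integral_const_mul,
            integral_add_left_eq_self (fun z : Space d => decay (d + 1) (ε⁻¹ • z))]
      _ = _ := by
          rw [Measure.integral_comp_inv_smul_of_nonneg _ _ hε.le, finrank_euclideanSpace_fin,
            decayMass, smul_eq_mul]
          ring

/-- An intermediate state of a collision history: whether it belongs to the marked set, its duration
and the damping factor that it contributes if it is unmarked. -/
structure Stage where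
  /-- whether the state is marked -/
  marked : Bool
  /-- the duration of the state -/
  time : ℝ
  /-- the damping factor of an unmarked state -/
  damp : ℝ

/-- The factor that a state contributes to the estimates, with `θ` the gain of a marked state. -/
noncomputable def Stage.weight (N : ℕ) (θ : ℝ) (s : Stage) : ℝ :=
  if s.marked then θ else s.damp * (1 + s.time) ^ (2 * N)

/-- The multiplier `M` belongs to the state `s`, with the cut-off `m` to the strip
`‖A - B‖ ≤ R ε`: it is free evolution, combined with the cut-off if the state is marked, and with
damping and the complement of the cut-off if it is not. -/
structure IsMultiplier (ε R t : ℝ) (s : Stage) (m : Space d → ℝ) (M : Space d × Space d → ℂ) :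
    Prop where
  time_nonneg : 0 ≤ s.time
  damp_nonneg : 0 ≤ s.damp
  continuous : Continuous m
  nonneg : ∀ ζ, 0 ≤ m ζ
  le_one : ∀ ζ, m ζ ≤ 1
  eq_zero : ∀ ζ, R * ε < ‖ζ‖ → m ζ = 0
  time_le : s.marked = true → s.time * ε ≤ t
  eq_marked : s.marked = true → ∀ x, M x = phase s.time x * (m (x.1 - x.2) : ℂ)
  eq_unmarked : s.marked = false → ∀ x,
    M x = phase s.time x * (s.damp * (1 - m (x.1 - x.2)) : ℝ)

lemma Stage.weight_nonneg {N : ℕ} {θ : ℝ} (hθ : 0 ≤ θ) {s : Stage} (h1 : 0 ≤ s.time)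
    (h2 : 0 ≤ s.damp) : 0 ≤ s.weight N θ := by
  unfold Stage.weight
  split_ifs <;> positivity

lemma BoundedMeasurable.of_continuous {Q : Space d × Space d → ℂ} (hQ : Continuous Q) {C : ℝ}
    (h : ∀ x, ‖Q x‖ ≤ C) : BoundedMeasurable Q :=
  ⟨hQ.stronglyMeasurable, C, h⟩

lemma IsMultiplier.boundedMeasurable {ε R t : ℝ} {s : Stage} {m : Space d → ℝ}
    {M : Space d × Space d → ℂ} (h : IsMultiplier ε R t s m M) : BoundedMeasurable M := by
  have hc := h.continuous
  cases hs : s.marked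
  · rw [show M = _ from funext (h.eq_unmarked hs)]
    refine BoundedMeasurable.of_continuous (C := s.damp) (by fun_prop) fun x => ?_
    rw [norm_mul, norm_phase, one_mul, Complex.norm_real, Real.norm_of_nonneg
      (mul_nonneg h.damp_nonneg (by linarith [h.le_one (x.1 - x.2)]))]
    exact mul_le_of_le_one_right h.damp_nonneg (by linarith [h.nonneg (x.1 - x.2)])
  · rw [show M = _ from funext (h.eq_marked hs)]
    refine BoundedMeasurable.of_continuous (C := 1) (by fun_prop) fun x => ?_
    rw [norm_mul, norm_phase, one_mul, Complex.norm_real, Real.norm_of_nonneg (h.nonneg _)]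
    exact h.le_one _

/-- The composition of collisions with the kernels `k i` and of the multipliers `M i` in between,
applied to the final state `F`. -/
noncomputable def chain : (m : ℕ) → (Fin (m + 1) → Space d → ℂ) → (Fin (m + 1) → Fin 2) →
    (Fin m → Space d × Space d → ℂ) → (Space d × Space d → ℂ) → Space d × Space d → ℂ
  | 0, k, γ, _, F => collide (k 0) (γ 0) F
  | m + 1, k, γ, M, F => collide (k 0) (γ 0) fun x =>
      M 0 x * chain m (Fin.tail k) (Fin.tail γ) (Fin.tail M) F x

lemma boundedMeasurable_chain {m : ℕ} {k : Fin (m + 1) → Space d → ℂ} {γ : Fin (m + 1) → Fin 2}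
    {M : Fin m → Space d × Space d → ℂ} {F : Space d × Space d → ℂ} (hk : ∀ i, Integrable (k i))
    (hM : ∀ i, BoundedMeasurable (M i)) (hF : BoundedMeasurable F) :
    BoundedMeasurable (chain m k γ M F) := by
  induction m with
  | zero => exact hF.collide (hk 0) _
  | succ m ih =>
    exact ((hM 0).mul (ih (fun i => hk i.succ) fun i => hM i.succ)).collide (hk 0) _

/-- The gain constant of a state in the bound on a single collision history. -/
noncomputable def stageConst (d N : ℕ) (R t : ℝ) : ℝ :=
  (1 + t * R) ^ N * volume.real (Metric.closedBall (0 : Space d) R) + decayMass d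

lemma stageConst_nonneg (d N : ℕ) {R t : ℝ} (hR : 0 ≤ R) (ht : 0 ≤ t) : 0 ≤ stageConst d N R t := by
  have := decayMass_nonneg d
  have : 0 ≤ volume.real (Metric.closedBall (0 : Space d) R) := measureReal_nonneg
  unfold stageConst
  positivity

/-- A marked state confines the difference of the momenta to a ball of volume `O(ε^d)`, in which
free evolution changes slowly as `u ε ≤ t`; in an unmarked state, free evolution costs a power of
the duration. -/
lemma IsMultiplier.exists_profile {N K₀ : ℕ} {ε R t h : ℝ} {s : Stage} {m : Space d → ℝ}
    {M K : Space d × Space d → ℂ} (hM : IsMultiplier ε R t s m M) (hε : 0 < ε) (hR : 0 ≤ R)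
    (ht : 0 ≤ t) (hh : 0 ≤ h) (hK : ShiftBound N K₀ (fun _ => h) K) :
    ∃ H, ShiftBound N K₀ H (fun x => M x * K x) ∧
      IsProfile H (h * stageConst d N R t * s.weight N (ε ^ d)) := by
  have hJ := decayMass_nonneg d
  have hV : 0 ≤ volume.real (Metric.closedBall (0 : Space d) R) := measureReal_nonneg
  have hu := hM.time_nonneg
  have he := hM.damp_nonneg
  have mono : ∀ {H : Space d → ℝ} {a b : ℝ}, IsProfile H a → a ≤ b → IsProfile H b :=
    fun h1 h2 => ⟨h1.measurable, h1.nonneg, h1.bounded, fun ζ => (h1.integral_le ζ).trans h2⟩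
  cases hs : s.marked
  · refine ⟨fun _ => h * (s.damp * (1 + s.time) ^ N), ?_, mono (isProfile_const (by positivity)) ?_⟩
    · have h1 := hK.phase_mul (H' := fun _ => h * (s.damp * (1 + s.time) ^ N)) (u := s.time)
        (m := fun ζ => ((s.damp * (1 - m ζ) : ℝ) : ℂ)) hu (fun _ => hh) fun ζ => ?_
      · rw [show (fun x => M x * K x) = _ from funext fun x => by rw [hM.eq_unmarked hs x]]
        exact h1
      · have e1 : 0 ≤ 1 - m ζ := by linarith [hM.le_one ζ]
        have e2 : 1 - m ζ ≤ 1 := by linarith [hM.nonneg ζ]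
        have e3 : 0 ≤ min 1 ‖ζ‖ := le_min zero_le_one (norm_nonneg _)
        rw [Complex.norm_real, Real.norm_of_nonneg (by positivity)]
        calc s.damp * (1 - m ζ) * h * (1 + s.time * min 1 ‖ζ‖) ^ N
            ≤ s.damp * 1 * h * (1 + s.time * 1) ^ N := by
              gcongr
              exact min_le_left _ _
          _ = _ := by ring
    · rw [Stage.weight, hs, stageConst]
      simp only [Bool.false_eq_true, if_false]
      have e1 : (1 + s.time) ^ N ≤ (1 + s.time) ^ (2 * N) :=
        pow_le_pow_right₀ (by linarith) (by omega)
      have e2 : decayMass d ≤ (1 + t * R) ^ N * volume.real (Metric.closedBall (0 : Space d) R) +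
          decayMass d := le_add_of_nonneg_left (by positivity)
      calc h * (s.damp * (1 + s.time) ^ N) * decayMass d
          = h * decayMass d * (s.damp * (1 + s.time) ^ N) := by ring
        _ ≤ _ := by gcongr
  · set h' := h * (1 + t * R) ^ N with hh'
    have hh'0 : 0 ≤ h' := by positivity
    refine ⟨(Metric.closedBall (0 : Space d) (R * ε)).indicator fun _ => h', ?_,
      mono (isProfile_ball hh'0) ?_⟩
    · have h1 := hK.phase_mul
        (H' := (Metric.closedBall (0 : Space d) (R * ε)).indicator fun _ => h') (u := s.time)
        (m := fun ζ => (m ζ : ℂ)) hu (fun _ => hh) fun ζ => ?_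
      · rw [show (fun x => M x * K x) = _ from funext fun x => by rw [hM.eq_marked hs x]]
        exact h1
      · by_cases hζ : ‖ζ‖ ≤ R * ε
        · rw [Set.indicator_of_mem (by simpa using hζ), Complex.norm_real,
            Real.norm_of_nonneg (hM.nonneg ζ)]
          have e3 : 0 ≤ min 1 ‖ζ‖ := le_min zero_le_one (norm_nonneg _)
          have e4 : s.time * min 1 ‖ζ‖ ≤ t * R := by
            calc s.time * min 1 ‖ζ‖ ≤ s.time * (R * ε) := by
                  gcongr
                  exact (min_le_right _ _).trans hζ
              _ = s.time * ε * R := by ring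
              _ ≤ t * R := by gcongr; exact hM.time_le hs
          calc m ζ * h * (1 + s.time * min 1 ‖ζ‖) ^ N ≤ 1 * h * (1 + t * R) ^ N := by
                gcongr
                exact hM.le_one ζ
            _ = h' := by rw [one_mul]
        · rw [hM.eq_zero ζ (not_le.1 hζ)]
          simp only [Complex.ofReal_zero, norm_zero, zero_mul]
          exact Set.indicator_nonneg (fun _ _ => hh'0) _
    · rw [Stage.weight, hs, stageConst, volume_real_closedBall_mul hε.le hR]
      simp only [if_true]
      calc h' * (ε ^ d * volume.real (Metric.closedBall (0 : Space d) R))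
          = h * ((1 + t * R) ^ N * volume.real (Metric.closedBall (0 : Space d) R)) * ε ^ d := by
            rw [hh']; ring
        _ ≤ _ := by
            gcongr
            exact le_add_of_nonneg_right hJ

lemma prod_weight_nonneg {m N : ℕ} {θ : ℝ} (hθ : 0 ≤ θ) {st : Fin m → Stage} {ε R t : ℝ}
    {χ : Fin m → Space d → ℝ} {M : Fin m → Space d × Space d → ℂ}
    (hM : ∀ i, IsMultiplier ε R t (st i) (χ i) (M i)) : 0 ≤ ∏ i, (st i).weight N θ :=
  Finset.prod_nonneg fun i _ => Stage.weight_nonneg hθ (hM i).time_nonneg (hM i).damp_nonneg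

/-- The bound on a single collision history, obtained with absolute values alone: each marked state
and the final one confine the difference of the momenta to a set of volume `O(ε^d)`. The first
collision is kept apart, to be paired with a preceding one. -/
lemma exists_chain_eq_collide {N K₀ : ℕ} {ε R t CF ck : ℝ} (hε : 0 < ε) (hR : 0 ≤ R) (ht : 0 ≤ t)
    (hCF : 0 ≤ CF) (hck : 0 ≤ ck) {F : Space d × Space d → ℂ} (hFm : BoundedMeasurable F)
    (hF : ShiftBound N K₀ (fun ζ => CF * decay (d + 1) (ε⁻¹ • ζ)) F) (m : ℕ)
    (k : Fin (m + 1) → Space d → ℂ) (γ : Fin (m + 1) → Fin 2) (st : Fin m → Stage)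
    (χ : Fin m → Space d → ℝ) (M : Fin m → Space d × Space d → ℂ) (hk : ∀ i, Integrable (k i))
    (hkb : ∀ i z, ‖k i z‖ ≤ ck * decay (N + K₀ + (d + 1)) z)
    (hM : ∀ i, IsMultiplier ε R t (st i) (χ i) (M i)) :
    ∃ G H, chain m k γ M F = collide (k 0) (γ 0) G ∧ BoundedMeasurable G ∧ ShiftBound N K₀ H G ∧
      IsProfile H (CF * decayMass d * (ck * stageConst d N R t) ^ m * ε ^ d *
        ∏ i, (st i).weight N (ε ^ d)) := by
  induction m with
  | zero =>
    refine ⟨F, _, rfl, hFm, hF, ?_⟩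
    simpa using isProfile_decay hCF hε
  | succ m ih =>
    obtain ⟨G, H, h1, h2, h3, h4⟩ := ih (Fin.tail k) (Fin.tail γ) (Fin.tail st) (Fin.tail χ)
      (Fin.tail M) (fun i => hk i.succ) (fun i => hkb i.succ) (fun i => hM i.succ)
    have h5 := h3.collide h4 h2 (hk 1) hck (hkb 1) (γ 1)
    have h6 : chain m (Fin.tail k) (Fin.tail γ) (Fin.tail M) F = collide (k 1) (γ 1) G := h1
    rw [← h6] at h5
    obtain ⟨H', h7, h8⟩ := (hM 0).exists_profile hε hR ht (mul_nonneg hck h4.le_nonneg) h5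
    refine ⟨_, H', rfl, (hM 0).boundedMeasurable.mul
      (boundedMeasurable_chain (fun i => hk i.succ) (fun i => (hM i.succ).boundedMeasurable) hFm),
      h7, ?_⟩
    convert h8 using 1
    rw [Fin.prod_univ_succ]
    simp only [Fin.tail]
    ring

end Chain

section Diagonal

variable {ι : Type}

/-- The tuples of scatterers in which the two scatterers adjacent to an unmarked state agree. -/
def Diag : (m : ℕ) → (Fin m → Stage) → (Fin (m + 1) → ι) → Prop
  | 0, _, _ => True
  | m + 1, st, q => ((st 0).marked = true ∨ q 0 = Fin.tail q 0) ∧ Diag m (Fin.tail st) (Fin.tail q)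

open Classical in
lemma sum_pi_succ [Fintype ι] {E : Type*} [AddCommMonoid E] {m : ℕ} (f : (Fin (m + 2) → ι) → E) :
    ∑ q, f q = ∑ i, ∑ q : Fin (m + 1) → ι, f (Fin.cons i q) := by
  rw [← (Fin.consEquiv fun _ => ι).sum_comp, Fintype.sum_prod_type]
  rfl

open Classical in
/-- A diagonal tuple is determined by one scatterer for each marked state and one for the final
state. -/
lemma card_diag_le [Fintype ι] {B : ℝ} (hB : (Fintype.card ι : ℝ) ≤ B) (m : ℕ)
    (st : Fin m → Stage) :
    ∑ q : Fin (m + 1) → ι, (if Diag m st q then (1 : ℝ) else 0) ≤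
      B * ∏ i, if (st i).marked then B else 1 := by
  have hB0 : 0 ≤ B := (Nat.cast_nonneg _).trans hB
  induction m with
  | zero => simpa [Diag] using hB
  | succ m ih =>
    rw [sum_pi_succ, Finset.sum_comm, Fin.prod_univ_succ]
    have h1 : ∀ (i : ι) (q : Fin (m + 1) → ι),
        (if Diag (m + 1) st (Fin.cons i q) then (1 : ℝ) else 0) =
          (if Diag m (Fin.tail st) q then (1 : ℝ) else 0) *
          (if (st 0).marked = true ∨ i = q 0 then 1 else 0) := by
      intro i q
      simp only [Diag, Fin.cons_zero, Fin.tail_cons]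
      by_cases h1 : (st 0).marked = true ∨ i = q 0 <;> by_cases h2 : Diag m (Fin.tail st) q <;>
        simp [h1, h2]
    simp only [h1, ← Finset.mul_sum]
    have h2 : ∀ q : Fin (m + 1) → ι, ∑ i, (if (st 0).marked = true ∨ i = q 0 then (1 : ℝ) else 0) ≤
        if (st 0).marked then B else 1 := by
      intro q
      cases (st 0).marked
      · simp
      · simpa using hB
    calc _ ≤ ∑ q : Fin (m + 1) → ι, (if Diag m (Fin.tail st) q then (1 : ℝ) else 0) *
          (if (st 0).marked then B else 1) := by
          refine Finset.sum_le_sum fun q _ => mul_le_mul_of_nonneg_left (h2 q) ?_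
          split_ifs <;> norm_num
      _ ≤ (B * ∏ i, if (Fin.tail st i).marked then B else 1) *
          (if (st 0).marked then B else 1) := by
          rw [← Finset.sum_mul]
          refine mul_le_mul_of_nonneg_right (ih (Fin.tail st)) ?_
          split_ifs <;> [exact hB0; norm_num]
      _ = _ := (mul_right_comm _ _ _).trans (mul_assoc _ _ _)

end Diagonal

/-! ### Collisions that leave the diagonal -/

section Estimate

/-- The range of parameters of the estimate: the scatterers `Q i` (on the microscopic scale) of
strength `c i` have separation `ρ`, there are at most `D κ²` of them, and `ε` is the scale of the
difference of the momenta in a marked state. The gain is `δ`: it bounds the volume of the strip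
times the number of scatterers (`thin_le`), and the factor gained from the oscillation of two
collisions times the square of that number (`oscillation_le`). -/
structure Regime {ι : Type} [Fintype ι] (d N : ℕ) (D Λ κ ε δ ρ : ℝ) (Q : ι → Space d)
    (c : ι → ℂ) : Prop where
  one_le_kappa : 1 ≤ κ
  eps_pos : 0 < ε
  eps_le_one : ε ≤ 1
  strength_nonneg : 0 ≤ Λ
  norm_le : ∀ i, ‖c i‖ ≤ Λ
  one_le_rho : 1 ≤ ρ
  order_le : N ≤ 2 * ρ
  separated : ∀ i j, i ≠ j → ρ ≤ ‖Q i - Q j‖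
  card_le : (Fintype.card ι : ℝ) ≤ D * κ ^ 2
  thin_le_one : ε ^ d * κ ^ 2 ≤ 1
  thin_le : ε ^ d * κ ^ 2 ≤ δ
  oscillation_le : κ ^ 4 * ((4 * ρ) ^ N)⁻¹ ≤ δ

lemma fourier_sum_singlePotential {ι : Type} (W : SchwartzMap (Space d) ℂ) (s : Finset ι)
    (c : ι → ℂ) (Q : ι → Space d) :
    ⇑(𝓕 (∑ i ∈ s, singlePotential W (c i) (Q i)) : SchwartzMap (Space d) ℂ) =
      fun z => ∑ i ∈ s, kern W (c i) (Q i) z := by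
  have h5 : 𝓕 (∑ i ∈ s, singlePotential W (c i) (Q i)) =
      ∑ i ∈ s, 𝓕 (singlePotential W (c i) (Q i)) :=
    map_sum (FourierTransform.fourierCLM ℂ (SchwartzMap (Space d) ℂ)) _ _
  funext z
  rw [h5, sum_apply]
  rfl

lemma collide_sum_sum {ι ι' : Type*} (s : Finset ι) (s' : Finset ι') {k : ι → Space d → ℂ}
    {Q : ι' → Space d × Space d → ℂ} (hk : ∀ i ∈ s, Integrable (k i))
    (hQ : ∀ j ∈ s', BoundedMeasurable (Q j)) (g : Fin 2) (x : Space d × Space d) :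
    collide (fun z => ∑ i ∈ s, k i z) g (fun y => ∑ j ∈ s', Q j y) x =
      ∑ i ∈ s, ∑ j ∈ s', collide (k i) g (Q j) x := by
  simp only [collide, Finset.sum_mul_sum]
  rw [integral_finsetSum _ fun i hi => integrable_finsetSum _ fun j hj =>
    integrable_collide (hk i hi) g (hQ j hj) x]
  refine Finset.sum_congr rfl fun i hi => ?_
  rw [integral_finsetSum _ fun j hj => integrable_collide (hk i hi) g (hQ j hj) x]

lemma collide_sum_left {ι : Type*} (s : Finset ι) {k : ι → Space d → ℂ}
    {Q : Space d × Space d → ℂ} (hk : ∀ i ∈ s, Integrable (k i)) (hQ : BoundedMeasurable Q)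
    (g : Fin 2) (x : Space d × Space d) :
    collide (fun z => ∑ i ∈ s, k i z) g Q x = ∑ i ∈ s, collide (k i) g Q x := by
  simpa using collide_sum_sum s (Finset.univ : Finset Unit) (Q := fun _ => Q) hk (fun _ _ => hQ) g x

lemma collide_sub_const_mul {k : Space d → ℂ} (hk : Integrable k) {Q Q' : Space d × Space d → ℂ}
    (hQ : BoundedMeasurable Q) (hQ' : BoundedMeasurable Q') (w : ℂ) (g : Fin 2)
    (x : Space d × Space d) :
    collide k g (fun y => w * Q y - Q' y) x = w * collide k g Q x - collide k g Q' x := by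
  simp only [collide]
  rw [← integral_const_mul, ← integral_sub ((integrable_collide hk g hQ x).const_mul w)
    (integrable_collide hk g hQ' x)]
  refine integral_congr_ae (Eventually.of_forall fun z => ?_)
  simp only
  ring

lemma TestBound.sub {κ a b : ℝ} {Q Q' : Space d × Space d → ℂ} (hQ : TestBound κ a Q)
    (hQ' : TestBound κ b Q') (hm : BoundedMeasurable Q) (hm' : BoundedMeasurable Q') :
    TestBound κ (a + b) fun x => Q x - Q' x := by
  have h1 := hQ'.const_mul (-1)
  rw [norm_neg, norm_one, one_mul] at h1
  have h2 : BoundedMeasurable fun x => -1 * Q' x := by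
    obtain ⟨h3, M, hM⟩ := hm'
    exact ⟨h3.const_mul _, M, fun x => by simpa using hM x⟩
  simpa [sub_eq_add_neg] using hQ.add h1 hm h2

lemma BoundedMeasurable.phase_mul {Q : Space d × Space d → ℂ} (hQ : BoundedMeasurable Q) (u : ℝ) :
    BoundedMeasurable fun x => phase u x * Q x :=
  (BoundedMeasurable.of_continuous (continuous_phase u) fun x => (norm_phase u x).le).mul hQ

lemma BoundedMeasurable.const_mul {Q : Space d × Space d → ℂ} (hQ : BoundedMeasurable Q) (w : ℂ) :
    BoundedMeasurable fun x => w * Q x :=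
  (BoundedMeasurable.of_continuous (C := ‖w‖) continuous_const fun _ => le_rfl).mul hQ

lemma IsMultiplier.boundedMeasurable_cutoff {ε R t : ℝ} {s : Stage} {m : Space d → ℝ}
    {M : Space d × Space d → ℂ} (h : IsMultiplier ε R t s m M) :
    BoundedMeasurable fun x : Space d × Space d => (m (x.1 - x.2) : ℂ) := by
  have hc := h.continuous
  refine BoundedMeasurable.of_continuous (C := 1) (by fun_prop) fun x => ?_
  rw [Complex.norm_real, Real.norm_of_nonneg (h.nonneg _)]
  exact h.le_one _

/-- The part of the multiplier that is supported in the strip. -/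
lemma IsMultiplier.testBound_strip {ε R t κ c : ℝ} {s : Stage} {m : Space d → ℝ}
    {M Q : Space d × Space d → ℂ} (h : IsMultiplier ε R t s m M) (hκ : 0 ≤ κ) (hε : 0 ≤ ε)
    (hR : 0 ≤ R) (hQ : ∀ x, ‖Q x‖ ≤ c) :
    TestBound κ (volume.real (Metric.closedBall (0 : Space d) R) * (ε ^ d * c))
      (fun x => phase s.time x * ((m (x.1 - x.2) : ℂ) * Q x)) := by
  have h1 := TestBound.of_strip (κ := κ) (c := c) (ρ := R * ε)
    (Q := fun x => phase s.time x * ((m (x.1 - x.2) : ℂ) * Q x)) hκ (fun x => ?_) fun x hx => ?_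
  · rw [volume_real_closedBall_mul hε hR] at h1
    convert h1 using 1
    ring
  · rw [norm_mul, norm_phase, one_mul, norm_mul, Complex.norm_real,
      Real.norm_of_nonneg (h.nonneg _)]
    calc _ ≤ 1 * c := mul_le_mul (h.le_one _) (hQ x) (norm_nonneg _) zero_le_one
      _ = c := one_mul c
  · rw [h.eq_zero _ hx]
    simp

/-- The collisions that leave the diagonal: after a collision with the scatterer `j` and through an
unmarked state, a collision with any other scatterer. The multiplier of the unmarked state is the
difference of free evolution, for which the two collisions oscillate, and of a function that is
supported in a thin strip. -/
lemma exists_leaving_le (W : SchwartzMap (Space d) ℂ) (N : ℕ) {D R : ℝ} (hD : 0 ≤ D) (hR : 0 ≤ R) :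
    ∃ C : ℝ, 0 ≤ C ∧ ∀ {ι : Type} [Fintype ι] [DecidableEq ι] {Λ κ ε δ ρ t : ℝ}
      {Q : ι → Space d} {c : ι → ℂ}, Regime d N D Λ κ ε δ ρ Q c →
      ∀ (j : ι) (g g' : Fin 2) (s : Stage) (χ : Space d → ℝ) (M G : Space d × Space d → ℂ)
        (H : Space d → ℝ) (h : ℝ), IsMultiplier ε R t s χ M → s.marked = false →
        BoundedMeasurable G → ShiftBound N (N + (d + 1)) H G → IsProfile H h →
        TestBound κ (C * Λ ^ 2 * (s.damp * (1 + s.time) ^ (2 * N)) * ((κ ^ 2)⁻¹ * δ) * h)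
          (fun x => ∑ i with i ≠ j, collide (kern W (c i) (Q i)) g
            (fun y => M y * collide (kern W (c j) (Q j)) g' G y) x) ∧
        ∀ x, ‖∑ i with i ≠ j, collide (kern W (c i) (Q i)) g
            (fun y => M y * collide (kern W (c j) (Q j)) g' G y) x‖ ≤
          κ ^ 2 * (C * Λ ^ 2 * (s.damp * (1 + s.time) ^ (2 * N)) * ((κ ^ 2)⁻¹ * δ) * h) := by
  obtain ⟨C₁, hC₁, hosc⟩ := exists_norm_collide_collide_le W N (N + (d + 1)) (by omega)
  obtain ⟨C₂, hC₂, hpot⟩ := exists_potentialBound W D hD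
  obtain ⟨C₃, hC₃, hW⟩ := exists_norm_le_decay (𝓕 W) (N + (N + (d + 1)) + (d + 1))
  set J := decayMass d with hJ
  have hJ0 : 0 ≤ J := decayMass_nonneg d
  set V := volume.real (Metric.closedBall (0 : Space d) R) with hV
  have hV0 : 0 ≤ V := measureReal_nonneg
  refine ⟨D * C₁ * (J + 1) + 2 * C₂ * (V * C₃), by positivity, ?_⟩
  intro ι _ _ Λ κ ε δ ρ t Q c hreg j g g' s χ M G H h hM hs hG hGs hH
  have hκ1 := hreg.one_le_kappa
  have hκ : 0 ≤ κ := by linarith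
  have hΛ := hreg.strength_nonneg
  have hε := hreg.eps_pos
  have hρ := hreg.one_le_rho
  have hh := hH.le_nonneg
  have he := hM.damp_nonneg
  have hu := hM.time_nonneg
  have hδ : 0 ≤ δ := le_trans (by positivity) hreg.thin_le
  have hk := fun i : ι => integrable_kern W (c i) (Q i)
  set X := collide (kern W (c j) (Q j)) g' G with hX
  have hXm : BoundedMeasurable X := hG.collide (hk j) g'
  have hkb : ∀ z, ‖kern W (c j) (Q j) z‖ ≤ Λ * C₃ * decay (N + (N + (d + 1)) + (d + 1)) z := by
    intro z
    rw [norm_kern, mul_assoc]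
    exact mul_le_mul (hreg.norm_le j) (hW z) (norm_nonneg _) hΛ
  have hXs := hGs.collide hH hG (hk j) (mul_nonneg hΛ hC₃) hkb g'
  rw [← hX] at hXs
  have hXb : ∀ x, ‖X x‖ ≤ Λ * C₃ * h := by
    intro x
    refine (hXs.norm_le (by omega) (fun _ => le_rfl) x).trans ?_
    rw [mul_assoc]
    refine mul_le_of_le_one_right (by positivity) (mul_le_one₀ (decay_le_one _ _)
      (decay_pos _ _).le (decay_le_one _ _))
  set T : Finset ι := Finset.univ.filter (· ≠ j) with hT
  -- the two parts of the multiplier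
  have hχm := hM.boundedMeasurable_cutoff
  have hP1 : BoundedMeasurable fun y => phase s.time y * X y := hXm.phase_mul _
  have hP2 : BoundedMeasurable fun y => phase s.time y * ((χ (y.1 - y.2) : ℂ) * X y) :=
    (hχm.mul hXm).phase_mul _
  have hP3 := hP2.const_mul (s.damp : ℂ)
  have hsplit : (fun x => ∑ i ∈ T, collide (kern W (c i) (Q i)) g (fun y => M y * X y) x) =
      fun x => (s.damp : ℂ) * ∑ i ∈ T, collide (kern W (c i) (Q i)) g
          (fun y => phase s.time y * X y) x -
        collide (𝓕 (∑ i ∈ T, singlePotential W (c i) (Q i)) : SchwartzMap (Space d) ℂ) g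
          (fun y => (s.damp : ℂ) * (phase s.time y * ((χ (y.1 - y.2) : ℂ) * X y))) x := by
    funext x
    rw [fourier_sum_singlePotential, collide_sum_left T (fun i _ => hk i) hP3, Finset.mul_sum,
      ← Finset.sum_sub_distrib]
    refine Finset.sum_congr rfl fun i _ => ?_
    rw [← collide_sub_const_mul (hk i) hP1 hP3]
    congr 1
    funext y
    rw [hM.eq_unmarked hs]
    push_cast
    ring
  -- free evolution: each pair of collisions oscillates
  have hcardT : (T.card : ℝ) ≤ D * κ ^ 2 := le_trans (by
    exact_mod_cast Finset.card_le_univ T) hreg.card_le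
  set c₁ := D * C₁ * Λ ^ 2 * (s.damp * (1 + s.time) ^ (2 * N)) * ((κ ^ 2)⁻¹ * δ) * h with hc₁
  have hc₁0 : 0 ≤ c₁ := by positivity
  have hb1 : ∀ x, ‖(s.damp : ℂ) * ∑ i ∈ T, collide (kern W (c i) (Q i)) g
      (fun y => phase s.time y * X y) x‖ ≤ c₁ * decay (d + 1) x.1 * decay (d + 1) x.2 := by
    intro x
    have p1 := decay_pos (d + 1) x.1
    have p2 := decay_pos (d + 1) x.2
    rw [norm_mul, Complex.norm_real, Real.norm_of_nonneg he]
    have hosc' : ((4 * ρ) ^ N)⁻¹ * κ ^ 2 ≤ (κ ^ 2)⁻¹ * δ := by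
      rw [inv_mul_eq_div (κ ^ 2), le_div_iff₀ (by positivity)]
      calc _ = κ ^ 4 * ((4 * ρ) ^ N)⁻¹ := by ring
        _ ≤ δ := hreg.oscillation_le
    calc s.damp * ‖∑ i ∈ T, collide (kern W (c i) (Q i)) g (fun y => phase s.time y * X y) x‖
        ≤ s.damp * ∑ i ∈ T, C₁ * (Λ * Λ) * (1 + s.time) ^ (2 * N) * ((4 * ρ) ^ N)⁻¹ * h *
          decay (d + 1) x.1 * decay (d + 1) x.2 := by
          refine mul_le_mul_of_nonneg_left ((norm_sum_le _ _).trans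
            (Finset.sum_le_sum fun i hi => ?_)) he
          have hij : i ≠ j := (Finset.mem_filter.1 hi).2
          refine (hosc (c i) (c j) (Q i) (Q j) g g' s.time ρ h H G hu (by linarith) hreg.order_le
            (hreg.separated i j hij) hH hGs hG x).trans ?_
          rw [Nat.add_sub_cancel_left]
          have := hreg.norm_le i
          have := hreg.norm_le j
          gcongr
      _ ≤ s.damp * (D * κ ^ 2 * (C₁ * (Λ * Λ) * (1 + s.time) ^ (2 * N) * ((4 * ρ) ^ N)⁻¹ * h *
          decay (d + 1) x.1 * decay (d + 1) x.2)) := by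
          rw [Finset.sum_const, nsmul_eq_mul]
          gcongr
      _ = D * C₁ * Λ ^ 2 * (s.damp * (1 + s.time) ^ (2 * N)) * (((4 * ρ) ^ N)⁻¹ * κ ^ 2) * h *
          decay (d + 1) x.1 * decay (d + 1) x.2 := by ring
      _ ≤ _ := by
          rw [hc₁]
          gcongr
  have ht1 := TestBound.of_decay hκ hb1
  have hs1 : ∀ x, ‖(s.damp : ℂ) * ∑ i ∈ T, collide (kern W (c i) (Q i)) g
      (fun y => phase s.time y * X y) x‖ ≤ c₁ := fun x => by
    refine (hb1 x).trans ?_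
    rw [mul_assoc]
    exact mul_le_of_le_one_right hc₁0 (mul_le_one₀ (decay_le_one _ _)
      (decay_pos _ _).le (decay_le_one _ _))
  -- the strip: the collisions with all scatterers but `j` are summed before they are estimated
  have hpb := hpot T Q c Λ κ hκ hΛ (fun i _ => hreg.norm_le i)
    (fun i _ i' _ hii => hρ.trans (hreg.separated i i' hii)) hcardT
  have hst := (hM.testBound_strip hκ hε.le hR hXb).const_mul (s.damp : ℂ)
  rw [Complex.norm_real, Real.norm_of_nonneg he] at hst
  have ht2 := hst.collide hκ hpb hP3 g
  have hs2 := norm_collide_le hκ hpb hst g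
  set c₂ := 2 * C₂ * (V * C₃) * Λ ^ 2 * (s.damp * (1 + s.time) ^ (2 * N)) * ((κ ^ 2)⁻¹ * δ) * h
    with hc₂
  have hεδ : ε ^ d ≤ (κ ^ 2)⁻¹ * δ := by
    rw [inv_mul_eq_div, le_div_iff₀ (by positivity)]
    exact hreg.thin_le
  have hpow : 1 ≤ (1 + s.time) ^ (2 * N) := one_le_pow₀ (by linarith)
  have hle : 2 * (C₂ * Λ) * (s.damp * (V * (ε ^ d * (Λ * C₃ * h)))) ≤ c₂ := by
    calc _ = 2 * C₂ * (V * C₃) * Λ ^ 2 * (s.damp * 1) * ε ^ d * h := by ring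
      _ ≤ _ := by rw [hc₂]; gcongr
  have hm1 : BoundedMeasurable fun x => (s.damp : ℂ) * ∑ i ∈ T, collide (kern W (c i) (Q i)) g
      (fun y => phase s.time y * X y) x :=
    (BoundedMeasurable.sum fun i _ => hP1.collide (hk i) g).const_mul _
  have hm2 := hP3.collide (SchwartzMap.integrable
    (𝓕 (∑ i ∈ T, singlePotential W (c i) (Q i)) : SchwartzMap (Space d) ℂ)) g
  have hκ2 : 1 ≤ κ ^ 2 := one_le_pow₀ hκ1
  have hsum : c₁ * J + c₂ ≤ (D * C₁ * (J + 1) + 2 * C₂ * (V * C₃)) * Λ ^ 2 *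
      (s.damp * (1 + s.time) ^ (2 * N)) * ((κ ^ 2)⁻¹ * δ) * h := by
    have : (D * C₁ * (J + 1) + 2 * C₂ * (V * C₃)) * Λ ^ 2 *
      (s.damp * (1 + s.time) ^ (2 * N)) * ((κ ^ 2)⁻¹ * δ) * h = c₁ * J + c₂ + c₁ := by
        rw [hc₁, hc₂]; ring
    linarith
  have hsum' : c₁ + c₂ ≤ (D * C₁ * (J + 1) + 2 * C₂ * (V * C₃)) * Λ ^ 2 *
      (s.damp * (1 + s.time) ^ (2 * N)) * ((κ ^ 2)⁻¹ * δ) * h := by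
    have : (D * C₁ * (J + 1) + 2 * C₂ * (V * C₃)) * Λ ^ 2 *
      (s.damp * (1 + s.time) ^ (2 * N)) * ((κ ^ 2)⁻¹ * δ) * h = c₁ * J + c₂ + c₁ := by
        rw [hc₁, hc₂]; ring
    linarith [mul_nonneg hc₁0 hJ0]
  constructor
  · rw [hsplit]
    exact (ht1.sub (ht2.mono hκ hle) hm1 hm2).mono hκ hsum
  · intro x
    rw [show _ = _ from congrFun hsplit x]
    refine (norm_sub_le _ _).trans ((add_le_add (hs1 x) (hs2 x)).trans ?_)
    calc c₁ + 2 * (C₂ * Λ) * κ ^ 2 * (s.damp * (V * (ε ^ d * (Λ * C₃ * h))))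
        = c₁ + κ ^ 2 * (2 * (C₂ * Λ) * (s.damp * (V * (ε ^ d * (Λ * C₃ * h))))) := by ring
      _ ≤ κ ^ 2 * c₁ + κ ^ 2 * c₂ := by
        refine add_le_add (le_mul_of_one_le_left hc₁0 hκ2) ?_
        gcongr
      _ = κ ^ 2 * (c₁ + c₂) := by ring
      _ ≤ _ := by gcongr

open Classical in
/-- The sum of the collision histories over all nondiagonal tuples of scatterers. -/
noncomputable def nondiagSum {ι : Type} [Fintype ι] (m : ℕ) (k : ι → Space d → ℂ)
    (γ : Fin (m + 1) → Fin 2) (st : Fin m → Stage) (M : Fin m → Space d × Space d → ℂ)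
    (F : Space d × Space d → ℂ) (x : Space d × Space d) : ℂ :=
  ∑ q : Fin (m + 1) → ι, if Diag m st q then 0 else chain m (fun i => k (q i)) γ M F x

lemma boundedMeasurable_nondiagSum {ι : Type} [Fintype ι] {m : ℕ} {k : ι → Space d → ℂ}
    {γ : Fin (m + 1) → Fin 2} (st : Fin m → Stage) {M : Fin m → Space d × Space d → ℂ}
    {F : Space d × Space d → ℂ} (hk : ∀ i, Integrable (k i))
    (hM : ∀ i, BoundedMeasurable (M i)) (hF : BoundedMeasurable F) :
    BoundedMeasurable (nondiagSum m k γ st M F) := by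
  classical
  refine BoundedMeasurable.sum fun q _ => ?_
  split_ifs
  · exact BoundedMeasurable.of_continuous (C := 0) continuous_const (by simp)
  · exact boundedMeasurable_chain (fun i => hk _) hM hF

open Classical in
/-- A tuple is nondiagonal either because its tail is, or because its first scatterer differs from
the second one although the state in between is unmarked. -/
lemma nondiagSum_succ {ι : Type} [Fintype ι] {m : ℕ} {k : ι → Space d → ℂ}
    {γ : Fin (m + 2) → Fin 2} (st : Fin (m + 1) → Stage)
    {M : Fin (m + 1) → Space d × Space d → ℂ}
    {F : Space d × Space d → ℂ} (hk : ∀ i, Integrable (k i))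
    (hM : ∀ i, BoundedMeasurable (M i)) (hF : BoundedMeasurable F) (x : Space d × Space d) :
    nondiagSum (m + 1) k γ st M F x =
      collide (fun z => ∑ i, k i z) (γ 0) (fun y => M 0 y *
        nondiagSum m k (Fin.tail γ) (Fin.tail st) (Fin.tail M) F y) x +
      ∑ q : Fin (m + 1) → ι, if Diag m (Fin.tail st) q ∧ (st 0).marked = false then
        ∑ i with i ≠ q 0, collide (k i) (γ 0) (fun y => M 0 y *
          chain m (fun j => k (q j)) (Fin.tail γ) (Fin.tail M) F y) x else 0 := by
  set X : (Fin (m + 1) → ι) → Space d × Space d → ℂ := fun q =>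
    chain m (fun j => k (q j)) (Fin.tail γ) (Fin.tail M) F with hX
  have hXm : ∀ q, BoundedMeasurable fun y => M 0 y * X q y := fun q =>
    (hM 0).mul (boundedMeasurable_chain (fun j => hk _) (fun j => hM j.succ) hF)
  have hzero : BoundedMeasurable fun _ : Space d × Space d => (0 : ℂ) :=
    BoundedMeasurable.of_continuous (C := 0) continuous_const (by simp)
  have h1 : (fun y => M 0 y * nondiagSum m k (Fin.tail γ) (Fin.tail st) (Fin.tail M) F y) =
      fun y => ∑ q : Fin (m + 1) → ι, if Diag m (Fin.tail st) q then 0 else M 0 y * X q y := by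
    funext y
    simp only [nondiagSum, Finset.mul_sum, mul_ite, mul_zero]
    rfl
  rw [h1, collide_sum_sum Finset.univ Finset.univ (fun i _ => hk i) (fun q _ => by
    split_ifs
    · exact hzero
    · exact hXm q), nondiagSum, sum_pi_succ, Finset.sum_comm,
    Finset.sum_comm (s := (Finset.univ : Finset ι)) (t := (Finset.univ : Finset (Fin (m + 1) → ι))),
    ← Finset.sum_add_distrib]
  refine Finset.sum_congr rfl fun q _ => ?_
  have h2 : ∀ i, chain (m + 1) (fun j => k ((Fin.cons i q : Fin (m + 2) → ι) j)) γ M F x =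
      collide (k i) (γ 0) (fun y => M 0 y * X q y) x := fun i => rfl
  simp only [h2, Diag, Fin.cons_zero, Fin.tail_cons]
  by_cases hq : Diag m (Fin.tail st) q
  · simp only [hq, if_true, and_true, true_and]
    have h3 : ∀ i, collide (k i) (γ 0) (fun _ => (0 : ℂ)) x = 0 := fun i => by simp [collide]
    simp only [h3, Finset.sum_const_zero, zero_add]
    cases hs : (st 0).marked
    · simp [Finset.sum_filter, ite_not, hX]
    · simp
  · simp [hq]

end Estimate

/-! ### The sum over all nondiagonal tuples at fixed durations -/

section Induction

open Classical in
/-- For each free choice of a scatterer in a diagonal tuple there is a factor `ε^d`. -/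
lemma sum_diag_weight_le {ι : Type} [Fintype ι] {N : ℕ} {D κ ε R t : ℝ} (hD : 1 ≤ D) (hε : 0 ≤ ε)
    (hcard : (Fintype.card ι : ℝ) ≤ D * κ ^ 2) {m : ℕ} {st : Fin m → Stage}
    {χ : Fin m → Space d → ℝ} {M : Fin m → Space d × Space d → ℂ}
    (hM : ∀ i, IsMultiplier ε R t (st i) (χ i) (M i)) :
    ∑ q : Fin (m + 1) → ι, (if Diag m st q then ε ^ d * ∏ i, (st i).weight N (ε ^ d) else 0) ≤
      D ^ (m + 1) * (ε ^ d * κ ^ 2) * ∏ i, (st i).weight N (ε ^ d * κ ^ 2) := by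
  have hD0 : 0 ≤ D := by linarith
  have hw := prod_weight_nonneg (N := N) (pow_nonneg hε d) hM
  have h1 : ∀ q : Fin (m + 1) → ι,
      (if Diag m st q then ε ^ d * ∏ i, (st i).weight N (ε ^ d) else 0) =
        (if Diag m st q then (1 : ℝ) else 0) * (ε ^ d * ∏ i, (st i).weight N (ε ^ d)) := by
    intro q
    split_ifs <;> simp
  simp only [h1]
  rw [← Finset.sum_mul]
  calc _ ≤ (D * κ ^ 2 * ∏ i, if (st i).marked then D * κ ^ 2 else 1) *
        (ε ^ d * ∏ i, (st i).weight N (ε ^ d)) := by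
        refine mul_le_mul_of_nonneg_right (card_diag_le hcard m st) (by positivity)
    _ = D * (ε ^ d * κ ^ 2) * ∏ i, ((if (st i).marked then D * κ ^ 2 else 1) *
        (st i).weight N (ε ^ d)) := by
        rw [Finset.prod_mul_distrib]
        ring
    _ ≤ D * (ε ^ d * κ ^ 2) * ∏ i, (D * (st i).weight N (ε ^ d * κ ^ 2)) := by
        refine mul_le_mul_of_nonneg_left (Finset.prod_le_prod (fun i _ => ?_) fun i _ => ?_)
          (by positivity)
        · have := Stage.weight_nonneg (N := N) (pow_nonneg hε d) (hM i).time_nonneg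
            (hM i).damp_nonneg
          split_ifs <;> positivity
        · have h2 := (hM i).time_nonneg
          have h3 := (hM i).damp_nonneg
          unfold Stage.weight
          split_ifs
          · exact le_of_eq (by ring)
          · exact mul_le_mul_of_nonneg_right hD (by positivity)
    _ = _ := by
        rw [Finset.prod_mul_distrib, Finset.prod_const, Finset.card_univ, Fintype.card_fin]
        ring

set_option maxHeartbeats 1000000 in
/-- The estimate of the sum over all nondiagonal tuples, by induction on the number of collisions.
If the tail of a tuple is nondiagonal, the first scatterer is arbitrary, and the first collision is
one with the full potential; otherwise the first collision leaves the diagonal. -/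
lemma exists_nondiagSum_le (W : SchwartzMap (Space d) ℂ) (N : ℕ) {D R t CF : ℝ} (hD : 1 ≤ D)
    (hR : 0 ≤ R) (ht : 0 ≤ t) (hCF : 0 ≤ CF) :
    ∃ B : ℝ, 0 ≤ B ∧ ∀ {ι : Type} [Fintype ι] {Λ κ ε δ ρ : ℝ}
      {Q : ι → Space d} {c : ι → ℂ}, Regime d N D Λ κ ε δ ρ Q c →
      ∀ F : Space d × Space d → ℂ, BoundedMeasurable F →
      ShiftBound N (N + (d + 1)) (fun ζ => CF * decay (d + 1) (ε⁻¹ • ζ)) F →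
      ∀ (m : ℕ) (γ : Fin (m + 1) → Fin 2) (st : Fin m → Stage) (χ : Fin m → Space d → ℝ)
        (M : Fin m → Space d × Space d → ℂ), (∀ i, IsMultiplier ε R t (st i) (χ i) (M i)) →
        TestBound κ (m * (B * Λ) ^ (m + 1) * (∏ i, (st i).weight N (ε ^ d * κ ^ 2)) *
          (ε ^ d * κ ^ 2) * ((κ ^ 2)⁻¹ * δ))
          (nondiagSum m (fun i => kern W (c i) (Q i)) γ st M F) ∧
        ∀ x, ‖nondiagSum m (fun i => kern W (c i) (Q i)) γ st M F x‖ ≤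
          κ ^ 2 * (m * (B * Λ) ^ (m + 1) * (∏ i, (st i).weight N (ε ^ d * κ ^ 2)) *
            (ε ^ d * κ ^ 2) * ((κ ^ 2)⁻¹ * δ)) := by
  classical
  have hD0 : 0 ≤ D := by linarith
  obtain ⟨C₁, hC₁, hleave⟩ := exists_leaving_le W N hD0 hR
  obtain ⟨C₂, hC₂, hpot⟩ := exists_potentialBound W D hD0
  obtain ⟨C₃, hC₃, hW⟩ := exists_norm_le_decay (𝓕 W) (N + (N + (d + 1)) + (d + 1))
  have hJ0 : 0 ≤ decayMass d := decayMass_nonneg d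
  set V := volume.real (Metric.closedBall (0 : Space d) R) with hV
  have hV0 : 0 ≤ V := measureReal_nonneg
  set A := stageConst d N R t with hA
  have hA0 : 0 ≤ A := stageConst_nonneg d N hR ht
  -- `E₀` is the constant for leaving the diagonal before the final state; the other summands of `B`
  -- pay for one collision on the diagonal and for one collision with the full potential
  set E₀ := C₁ * (CF * decayMass d) * D with hE₀
  have hE₀0 : 0 ≤ E₀ := by positivity
  set B := 1 + E₀ + D * (C₃ * A) + 2 * C₂ * (1 + V) with hB
  have hB1 : 1 ≤ B := by
    have : 0 ≤ E₀ + D * (C₃ * A) + 2 * C₂ * (1 + V) := by positivity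
    linarith
  have hBE : E₀ ≤ B := by
    have : 0 ≤ 1 + D * (C₃ * A) + 2 * C₂ * (1 + V) := by positivity
    linarith
  have hBD : D * (C₃ * A) ≤ B := by
    have : 0 ≤ 1 + E₀ + 2 * C₂ * (1 + V) := by positivity
    linarith
  have hBV : 2 * C₂ * (1 + V) ≤ B := by
    have : 0 ≤ 1 + E₀ + D * (C₃ * A) := by positivity
    linarith
  refine ⟨B, by linarith, ?_⟩
  intro ι _ Λ κ ε δ ρ Q c hreg F hF hFs
  have hκ1 := hreg.one_le_kappa
  have hκ : 0 ≤ κ := by linarith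
  have hΛ := hreg.strength_nonneg
  have hε := hreg.eps_pos
  have hρ := hreg.one_le_rho
  have hδ : 0 ≤ δ := le_trans (by positivity) hreg.thin_le
  set θ := ε ^ d * κ ^ 2 with hθ
  have hθ0 : 0 ≤ θ := by positivity
  have hk := fun i : ι => integrable_kern W (c i) (Q i)
  have hkb : ∀ i z, ‖kern W (c i) (Q i) z‖ ≤
      Λ * C₃ * decay (N + (N + (d + 1)) + (d + 1)) z := by
    intro i z
    rw [norm_kern, mul_assoc]
    exact mul_le_mul (hreg.norm_le i) (hW z) (norm_nonneg _) hΛ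
  have hpb := hpot Finset.univ Q c Λ κ hκ hΛ (fun i _ => hreg.norm_le i)
    (fun i _ i' _ hii => hρ.trans (hreg.separated i i' hii)) (by simpa using hreg.card_le)
  intro m
  induction m with
  | zero =>
    intro γ st χ M hM
    have h0 : nondiagSum 0 (fun i => kern W (c i) (Q i)) γ st M F = fun _ => 0 := by
      funext x
      simp [nondiagSum, Diag]
    rw [h0]
    simpa using TestBound.zero
  | succ m ih =>
    intro γ st χ M hM
    obtain ⟨ih1, ih2⟩ := ih (Fin.tail γ) (Fin.tail st) (Fin.tail χ) (Fin.tail M) fun i => hM i.succ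
    set Rm := nondiagSum m (fun i => kern W (c i) (Q i)) (Fin.tail γ) (Fin.tail st)
      (Fin.tail M) F with hRm
    set w := ∏ i, (Fin.tail st i).weight N θ with hw
    have hw0 : 0 ≤ w := prod_weight_nonneg hθ0 (fun i => hM i.succ)
    set w₀ := (st 0).weight N θ with hw₀
    have hw₀0 : 0 ≤ w₀ := Stage.weight_nonneg hθ0 (hM 0).time_nonneg (hM 0).damp_nonneg
    set δ' := (κ ^ 2)⁻¹ * δ with hδ'
    have hδ'0 : 0 ≤ δ' := by positivity
    set n := m * (B * Λ) ^ (m + 1) * w * θ * δ' with hn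
    have hn0 : 0 ≤ n := ih1.nonneg
    have hRmm : BoundedMeasurable Rm :=
      boundedMeasurable_nondiagSum _ hk (fun i => (hM i.succ).boundedMeasurable) hF
    have hMR : BoundedMeasurable fun y => M 0 y * Rm y := (hM 0).boundedMeasurable.mul hRmm
    have he := (hM 0).damp_nonneg
    have hu := (hM 0).time_nonneg
    -- the state between the first two collisions: where the multiplier is supported in the strip,
    -- the loss `κ²` of the supremum norm is made up for by the volume `ε^d`
    have hstep : TestBound κ ((1 + V) * w₀ * n) fun y => M 0 y * Rm y := by
      have hst := (hM 0).testBound_strip hκ hε.le hR ih2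
      have hst' : V * (ε ^ d * (κ ^ 2 * n)) = V * (θ * n) := by rw [hθ]; ring
      rw [hst'] at hst
      cases hs : (st 0).marked
      · have h1 := (ih1.phase_mul (st 0).time).const_mul ((st 0).damp : ℂ)
        have h2 := hst.const_mul ((st 0).damp : ℂ)
        rw [Complex.norm_real, Real.norm_of_nonneg he] at h1 h2
        have h3 := h1.sub h2 ((hRmm.phase_mul _).const_mul _)
          ((((hM 0).boundedMeasurable_cutoff.mul hRmm).phase_mul _).const_mul _)
        have h4 : (fun y => M 0 y * Rm y) = fun x =>
            ((st 0).damp : ℂ) * (phase (st 0).time x * Rm x) -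
            ((st 0).damp : ℂ) * (phase (st 0).time x * ((χ 0 (x.1 - x.2) : ℂ) * Rm x)) := by
          funext x
          rw [(hM 0).eq_unmarked hs]
          push_cast
          ring
        rw [h4]
        refine h3.mono hκ ?_
        have hpow : 1 ≤ (1 + (st 0).time) ^ (2 * N) := one_le_pow₀ (by linarith)
        rw [hw₀, Stage.weight, hs]
        simp only [Bool.false_eq_true, if_false]
        calc (st 0).damp * n + (st 0).damp * (V * (θ * n))
            = (1 + V * θ) * ((st 0).damp * 1) * n := by ring
          _ ≤ (1 + V * 1) * ((st 0).damp * (1 + (st 0).time) ^ (2 * N)) * n := by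
            gcongr
            exact hreg.thin_le_one
          _ = _ := by rw [mul_one]
      · have h4 : (fun y => M 0 y * Rm y) = fun x =>
            phase (st 0).time x * ((χ 0 (x.1 - x.2) : ℂ) * Rm x) := by
          funext x
          rw [(hM 0).eq_marked hs]
          ring
        rw [h4]
        refine hst.mono hκ ?_
        rw [hw₀, Stage.weight, hs]
        simp only [if_true]
        calc V * (θ * n) ≤ (1 + V) * (θ * n) := by gcongr; linarith
          _ = _ := by ring
    have hcoll := hstep.collide hκ hpb hMR (γ 0)
    have hcolls := norm_collide_le hκ hpb hstep (γ 0)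
    rw [fourier_sum_singlePotential] at hcoll hcolls
    -- the collisions that leave the diagonal
    set Λ' := C₁ * Λ ^ 2 * w₀ * δ' with hΛ'
    set h₀ := CF * decayMass d * (Λ * C₃ * A) ^ m with hh₀
    have hh₀0 : 0 ≤ h₀ := by positivity
    have hΛ'0 : 0 ≤ Λ' := by positivity
    set b : (Fin (m + 1) → ι) → ℝ := fun q => if Diag m (Fin.tail st) q then
      Λ' * h₀ * (ε ^ d * ∏ i, (Fin.tail st i).weight N (ε ^ d)) else 0 with hb
    set L : (Fin (m + 1) → ι) → Space d × Space d → ℂ := fun q x =>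
      if Diag m (Fin.tail st) q ∧ (st 0).marked = false then
        ∑ i with i ≠ q 0, collide (kern W (c i) (Q i)) (γ 0) (fun y => M 0 y *
          chain m (fun j => kern W (c (q j)) (Q (q j))) (Fin.tail γ) (Fin.tail M) F y) x else 0
      with hL
    have hzero : BoundedMeasurable fun _ : Space d × Space d => (0 : ℂ) :=
      BoundedMeasurable.of_continuous (C := 0) continuous_const (by simp)
    have hLm : ∀ q, BoundedMeasurable (L q) := by
      intro q
      simp only [hL]
      split_ifs
      · exact BoundedMeasurable.sum fun i _ => ((hM 0).boundedMeasurable.mul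
          (boundedMeasurable_chain (fun j => hk _) (fun j => (hM j.succ).boundedMeasurable)
            hF)).collide (hk i) _
      · exact hzero
    have hwp : 0 ≤ ∏ i, (Fin.tail st i).weight N (ε ^ d) :=
      prod_weight_nonneg (by positivity) (fun i => hM i.succ)
    have hb0 : ∀ q, 0 ≤ b q := fun q => by
      simp only [hb]
      split_ifs <;> positivity
    have hLb : ∀ q, TestBound κ (b q) (L q) ∧ ∀ x, ‖L q x‖ ≤ κ ^ 2 * b q := by
      intro q
      by_cases hq : Diag m (Fin.tail st) q ∧ (st 0).marked = false
      · obtain ⟨G, H, h1, h2, h3, h4⟩ := exists_chain_eq_collide hε hR ht hCF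
          (mul_nonneg hΛ hC₃) hF hFs m (fun j => kern W (c (q j)) (Q (q j))) (Fin.tail γ)
          (Fin.tail st) (Fin.tail χ) (Fin.tail M) (fun j => hk _) (fun j => hkb _)
          (fun j => hM j.succ)
        have h5 := hleave hreg (q 0) (γ 0) (Fin.tail γ 0) (st 0) (χ 0) (M 0) G H _ (hM 0)
          hq.2 h2 h3 h4
        have h6 : b q = C₁ * Λ ^ 2 * ((st 0).damp * (1 + (st 0).time) ^ (2 * N)) * δ' *
            (CF * decayMass d * (Λ * C₃ * A) ^ m * ε ^ d *
              ∏ i, (Fin.tail st i).weight N (ε ^ d)) := by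
          simp only [hb, hq.1, if_true, hΛ', hh₀, hw₀, Stage.weight, hq.2, Bool.false_eq_true,
            if_false]
          ring
        have h7 : L q = fun x => ∑ i with i ≠ q 0, collide (kern W (c i) (Q i)) (γ 0)
            (fun y => M 0 y * collide (kern W (c (q 0)) (Q (q 0))) (Fin.tail γ 0) G y) x := by
          funext x
          simp only [hL, hq, and_self, if_true, h1]
        rw [h6, h7]
        exact h5
      · have h7 : L q = fun _ => 0 := by
          funext x
          simp only [hL, hq, if_false]
        rw [h7]
        exact ⟨TestBound.zero.mono hκ (hb0 q), fun x => by
          rw [norm_zero]; exact mul_nonneg (by positivity) (hb0 q)⟩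
    have hbsum : ∑ q, b q ≤ (B * Λ) ^ (m + 2) * (w₀ * w) * θ * δ' := by
      have h1 := sum_diag_weight_le (ι := ι) (N := N) hD hε.le hreg.card_le
        (fun i => hM (Fin.succ i))
      have h2 : ∀ q, b q = Λ' * h₀ * (if Diag m (Fin.tail st) q then
          ε ^ d * ∏ i, (Fin.tail st i).weight N (ε ^ d) else 0) := fun q => by
        simp only [hb]
        split_ifs <;> simp
      simp only [h2]
      rw [← Finset.mul_sum]
      calc _ ≤ Λ' * h₀ * (D ^ (m + 1) * θ * w) :=
            mul_le_mul_of_nonneg_left h1 (by positivity)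
        _ = E₀ * (D * (C₃ * A)) ^ m * Λ ^ (m + 2) * (w₀ * w) * θ * δ' := by
            rw [hΛ', hh₀, hE₀]; ring
        _ ≤ B * B ^ m * Λ ^ (m + 2) * (w₀ * w) * θ * δ' := by gcongr
        _ ≤ B ^ 2 * B ^ m * Λ ^ (m + 2) * (w₀ * w) * θ * δ' := by
            have : B ≤ B ^ 2 := le_self_pow₀ hB1 (by norm_num)
            have : 0 ≤ B := by linarith
            gcongr
        _ = _ := by rw [mul_pow B, pow_add B m 2]; ring
    have hLsum := TestBound.sum (s := Finset.univ) (fun q _ => (hLb q).1) (fun q _ => hLm q)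
    have hLs : ∀ x, ‖∑ q, L q x‖ ≤ κ ^ 2 * ∑ q, b q := fun x => by
      rw [Finset.mul_sum]
      exact (norm_sum_le _ _).trans (Finset.sum_le_sum fun q _ => (hLb q).2 x)
    have hn' : 2 * (C₂ * Λ) * ((1 + V) * w₀ * n) ≤
        m * (B * Λ) ^ (m + 2) * (w₀ * w) * θ * δ' := by
      have hB0 : 0 ≤ B := by linarith
      calc 2 * (C₂ * Λ) * ((1 + V) * w₀ * n)
          = 2 * C₂ * (1 + V) * (Λ * (m * (B * Λ) ^ (m + 1) * (w₀ * w) * θ * δ')) := by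
            rw [hn]; ring
        _ ≤ B * (Λ * (m * (B * Λ) ^ (m + 1) * (w₀ * w) * θ * δ')) := by gcongr
        _ = _ := by ring
    have htot : 2 * (C₂ * Λ) * ((1 + V) * w₀ * n) + ∑ q, b q ≤
        ((m + 1 : ℕ) : ℝ) * (B * Λ) ^ (m + 1 + 1) * (∏ i, (st i).weight N θ) * θ * δ' := by
      rw [Fin.prod_univ_succ]
      push_cast
      calc _ ≤ m * (B * Λ) ^ (m + 2) * (w₀ * w) * θ * δ' +
            (B * Λ) ^ (m + 2) * (w₀ * w) * θ * δ' := add_le_add hn' hbsum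
        _ = (m + 1) * (B * Λ) ^ (m + 1 + 1) * (w₀ * w) * θ * δ' := by ring
        _ = _ := rfl
    have hsucc : nondiagSum (m + 1) (fun i => kern W (c i) (Q i)) γ st M F = fun x =>
        collide (fun z => ∑ i, kern W (c i) (Q i) z) (γ 0) (fun y => M 0 y * Rm y) x +
          ∑ q, L q x := by
      funext x
      rw [nondiagSum_succ st hk (fun i => (hM i).boundedMeasurable) hF]
    rw [hsucc]
    constructor
    · refine (hcoll.add hLsum ?_ (BoundedMeasurable.sum fun q _ => hLm q)).mono hκ htot
      exact hMR.collide (integrable_finsetSum _ fun i _ => hk i) _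
    · intro x
      refine (norm_add_le _ _).trans ((add_le_add (hcolls x) (hLs x)).trans ?_)
      calc _ = κ ^ 2 * (2 * (C₂ * Λ) * ((1 + V) * w₀ * n) + ∑ q, b q) := by ring
        _ ≤ _ := by gcongr

end Induction

/-! ### Collision histories as integrals over the momentum transfers -/

section Unfolding

lemma partialSum_zero {m : ℕ} (z : Fin m → Space d) : partialSum z 0 = 0 := by
  simp [partialSum]

lemma partialSum_succ {m : ℕ} (z : Fin (m + 1) → Space d) (j : Fin (m + 1)) :
    partialSum z j.succ = z 0 + partialSum (Fin.tail z) j := by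
  simp only [partialSum, Finset.sum_filter]
  rw [Fin.sum_univ_succ]
  simp [Fin.tail]

@[fun_prop]
lemma continuous_partialSum {m : ℕ} {T : Type*} [TopologicalSpace T] {z : T → Fin m → Space d}
    (hz : Continuous z) (j : Fin (m + 1)) : Continuous fun s => partialSum (z s) j := by
  unfold partialSum
  fun_prop

@[fun_prop]
lemma continuous_gammaSum {m : ℕ} (γ : Fin m → Fin 2) {T : Type*} [TopologicalSpace T]
    {z : T → Fin m → Space d} (hz : Continuous z) (j : Fin (m + 1)) :
    Continuous fun s => gammaSum γ (z s) j := by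
  unfold gammaSum
  fun_prop

@[fun_prop]
lemma continuous_gammaBarSum {m : ℕ} (γ : Fin m → Fin 2) {T : Type*} [TopologicalSpace T]
    {z : T → Fin m → Space d} (hz : Continuous z) (j : Fin (m + 1)) :
    Continuous fun s => gammaBarSum γ (z s) j := by
  unfold gammaBarSum
  fun_prop

lemma gammaBarSum_add_gammaSum {m : ℕ} (γ : Fin m → Fin 2) (z : Fin m → Space d)
    (j : Fin (m + 1)) : gammaBarSum γ z j + gammaSum γ z j = partialSum z j := by
  simp only [gammaBarSum, gammaSum, partialSum, ← Finset.sum_add_distrib]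
  refine Finset.sum_congr rfl fun i _ => ?_
  module

/-- The pair of momenta after `j` collisions with the momentum transfers `z`, starting from `x`. -/
noncomputable def state {m : ℕ} (γ : Fin m → Fin 2) (x : Space d × Space d) (z : Fin m → Space d)
    (j : Fin (m + 1)) : Space d × Space d :=
  (x.1 + gammaBarSum γ z j, x.2 - gammaSum γ z j)

@[fun_prop]
lemma continuous_state {m : ℕ} (γ : Fin m → Fin 2) {T : Type*} [TopologicalSpace T]
    {x : T → Space d × Space d} {z : T → Fin m → Space d} (hx : Continuous x) (hz : Continuous z)
    (j : Fin (m + 1)) : Continuous fun s => state γ (x s) (z s) j := by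
  unfold state
  fun_prop

lemma state_zero {m : ℕ} (γ : Fin m → Fin 2) (x : Space d × Space d) (z : Fin m → Space d) :
    state γ x z 0 = x := by
  simp [state, gammaBarSum, gammaSum, partialSum_zero]

lemma state_succ {m : ℕ} (γ : Fin (m + 1) → Fin 2) (x : Space d × Space d)
    (z : Fin (m + 1) → Space d) (j : Fin (m + 1)) :
    state γ x z j.succ = state (Fin.tail γ) (step (γ 0) x (z 0)) (Fin.tail z) j := by
  simp only [state, gammaBarSum, gammaSum, partialSum_succ, step, coeff, Prod.mk.injEq]
  constructor
  · rw [add_assoc]; rfl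
  · rw [sub_sub]; rfl

lemma integral_fin_succ {m : ℕ} (f : (Fin (m + 1) → Space d) → ℂ) :
    ∫ z, f z = ∫ p : Space d × (Fin m → Space d), f (Fin.cons p.1 p.2) := by
  have h := (volume_preserving_piFinSuccAbove (fun _ : Fin (m + 1) => Space d) 0).integral_comp'
    (fun p : Space d × (Fin m → Space d) => f (Fin.cons p.1 p.2))
  rw [← h]
  refine integral_congr_ae (Eventually.of_forall fun z => ?_)
  simp only [MeasurableEquiv.piFinSuccAbove_apply, Fin.insertNthEquiv_zero,
    Fin.consEquiv_symm_apply]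
  rw [Fin.cons_self_tail]

lemma integrable_prod_kernel_mul {m : ℕ} {k : Fin m → Space d → ℂ} (hk : ∀ i, Integrable (k i))
    {B : (Fin m → Space d) → ℂ} (hB : StronglyMeasurable B) {C : ℝ} (hC : ∀ z, ‖B z‖ ≤ C) :
    Integrable fun z : Fin m → Space d => (∏ i, k i (z i)) * B z :=
  (Integrable.fintype_prod hk).mul_bdd (c := C) hB.aestronglyMeasurable (Eventually.of_forall hC)

lemma exists_bound_prod_mul {m : ℕ} {M : Fin m → Space d × Space d → ℂ}
    {F : Space d × Space d → ℂ} (hM : ∀ i, BoundedMeasurable (M i)) (hF : BoundedMeasurable F) :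
    ∃ C, ∀ (y : Fin m → Space d × Space d) (y' : Space d × Space d),
      ‖(∏ i, M i (y i)) * F y'‖ ≤ C := by
  choose C hC using fun i => (hM i).bounded
  obtain ⟨C', hC'⟩ := hF.bounded
  refine ⟨(∏ i, C i) * C', fun y y' => ?_⟩
  rw [norm_mul, norm_prod]
  refine mul_le_mul (Finset.prod_le_prod (fun i _ => norm_nonneg _) fun i _ => hC i _) (hC' _)
    (norm_nonneg _) (Finset.prod_nonneg fun i _ => (norm_nonneg _).trans (hC i 0))

lemma stronglyMeasurable_prod_mul {m n : ℕ} {M : Fin m → Space d × Space d → ℂ}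
    {F : Space d × Space d → ℂ} (hM : ∀ i, BoundedMeasurable (M i)) (hF : BoundedMeasurable F)
    {T : Type*} [TopologicalSpace T] [MeasurableSpace T] [OpensMeasurableSpace T]
    {y : T → Fin n → Space d × Space d} (hy : ∀ i, Continuous fun s => y s i) (a : Fin m → Fin n)
    (b : Fin n) : StronglyMeasurable fun s => (∏ i, M i (y s (a i))) * F (y s b) := by
  refine StronglyMeasurable.mul ?_ (hF.stronglyMeasurable.comp_measurable (hy b).measurable)
  exact Finset.stronglyMeasurable_fun_prod _ fun i _ =>
    (hM i).stronglyMeasurable.comp_measurable (hy (a i)).measurable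

/-- The iterated integrals in `chain` as one integral over all momentum transfers. -/
lemma chain_eq_integral {m : ℕ} {k : Fin (m + 1) → Space d → ℂ} (γ : Fin (m + 1) → Fin 2)
    {M : Fin m → Space d × Space d → ℂ} {F : Space d × Space d → ℂ} (hk : ∀ i, Integrable (k i))
    (hM : ∀ i, BoundedMeasurable (M i)) (hF : BoundedMeasurable F) (x : Space d × Space d) :
    chain m k γ M F x = ∫ z : Fin (m + 1) → Space d, (∏ i, k i (z i)) *
      ((∏ i, M i (state γ x z i.castSucc.succ)) * F (state γ x z (Fin.last _))) := by
  induction m generalizing x with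
  | zero =>
    have h := (volume_preserving_funUnique (Fin 1) (Space d)).integral_comp'
      (fun z => k 0 z * F (step (γ 0) x z))
    rw [chain, collide, ← h]
    refine integral_congr_ae (Eventually.of_forall fun z => ?_)
    have h2 : state γ x z (Fin.last 1) = step (γ 0) x (z 0) := by
      rw [show Fin.last 1 = Fin.succ 0 from rfl, state_succ, state_zero]
    have h3 : (∏ i : Fin (0 + 1), k i (z i)) = k 0 (z 0) := by simp
    simp only [h3, Finset.univ_eq_empty, Finset.prod_empty, one_mul]
    rw [h2]
    rfl
  | succ m ih =>
    have hI := integrable_prod_kernel_mul hk (stronglyMeasurable_prod_mul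
      (T := Fin (m + 2) → Space d) hM hF (y := fun z => state γ x z) (fun j => by fun_prop)
      (fun i => i.castSucc.succ)
      (Fin.last _)) (fun z => (exists_bound_prod_mul hM hF).choose_spec _ _)
    have hI' := (volume_preserving_piFinSuccAbove
      (fun _ : Fin (m + 2) => Space d) 0).symm.integrable_comp_of_integrable hI
    rw [integral_fin_succ, Measure.volume_eq_prod, integral_prod]
    · rw [chain, collide]
      refine integral_congr_ae (Eventually.of_forall fun z => ?_)
      simp only
      rw [ih (k := Fin.tail k) (M := Fin.tail M) (Fin.tail γ) (fun i => hk i.succ)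
        (fun i => hM i.succ), ← integral_const_mul,
        ← integral_const_mul]
      refine integral_congr_ae (Eventually.of_forall fun z' => ?_)
      simp only
      have e1 : ∏ i, k i ((Fin.cons z z' : Fin (m + 2) → Space d) i) =
          k 0 z * ∏ i, Fin.tail k i (z' i) := by
        rw [Fin.prod_univ_succ]
        rfl
      have e2 : ∏ i : Fin (m + 1), M i (state γ x (Fin.cons z z') i.castSucc.succ) =
          M 0 (step (γ 0) x z) * ∏ i : Fin m, Fin.tail M i
            (state (Fin.tail γ) (step (γ 0) x z) z' i.castSucc.succ) := by
        rw [Fin.prod_univ_succ]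
        congr 1
        · rw [Fin.castSucc_zero, state_succ, Fin.cons_zero, state_zero]
        · refine Finset.prod_congr rfl fun i _ => ?_
          rw [← Fin.succ_castSucc, state_succ, Fin.cons_zero, Fin.tail_cons]
          rfl
      have e3 : state γ x (Fin.cons z z') (Fin.last (m + 2)) =
          state (Fin.tail γ) (step (γ 0) x z) z' (Fin.last (m + 1)) := by
        rw [← Fin.succ_last, state_succ, Fin.cons_zero, Fin.tail_cons]
      rw [e1, e2, e3]
      ring
    · rw [← Measure.volume_eq_prod]
      refine hI'.congr (Eventually.of_forall fun p => ?_)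
      have h4 : (MeasurableEquiv.piFinSuccAbove (fun _ : Fin (m + 2) => Space d) 0).symm p =
          Fin.cons p.1 p.2 := by
        simp [MeasurableEquiv.piFinSuccAbove_symm_apply]
        rfl
      simp only [Function.comp_def, h4]

end Unfolding

/-! ### The states of a collision history -/

section Histories

/-- The damping factor of a state of duration `u`, as a function of the difference `ζ` of the
momenta. -/
noncomputable def damping (Γ : Space d → ℝ) (α r u : ℝ) (ζ : Space d) : ℝ :=
  Real.exp (-(α ^ d * (1 - Γ (α • ((r ^ d)⁻¹ • ζ))) * u))

/-- The multiplier of an intermediate state of duration `u`, marked or unmarked. -/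
noncomputable def stateMultiplier (Γ χ : Space d → ℝ) (α r : ℝ) (marked : Bool) (u : ℝ)
    (x : Space d × Space d) : ℂ :=
  phase u x * ((damping Γ α r u (x.1 - x.2) * if marked then χ (α • ((r ^ d)⁻¹ • (x.1 - x.2)))
    else 1 - χ (α • ((r ^ d)⁻¹ • (x.1 - x.2))) : ℝ) : ℂ)

/-- The multiplier of the final state of duration `u`, together with the observable. -/
noncomputable def finalState (Γ : Space d → ℝ) (a : SchwartzMap (Space d × Space d) ℂ) (α r u : ℝ)
    (x : Space d × Space d) : ℂ :=
  phase u x * (damping Γ α r u (x.1 - x.2) : ℂ) *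
    tildeTransform a (-((r ^ d)⁻¹ • (x.1 - x.2))) ((1 / 2 : ℝ) • (x.1 + x.2))

/-- The multiplier of the initial state of duration `u`, together with the observable, in the
coordinates `y` and `η`. -/
noncomputable def initialState (Γ : Space d → ℝ) (b : SchwartzMap (Space d × Space d) ℂ)
    (α r u : ℝ) (p : Space d × Space d) : ℂ :=
  tildeTransform b p.2 (p.1 + (1 / 2 : ℝ) • (r ^ d • p.2)) *
    (phase u (p.1 + r ^ d • p.2, p.1) * (damping Γ α r u (r ^ d • p.2) : ℂ))

/-- The data of the intermediate states determined by the marked set `S` and the durations `u`. The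
`i`-th intermediate state is that after `i + 1` collisions. -/
noncomputable def stages (d : ℕ) {m : ℕ} (S : Finset (Fin (m + 2))) (α : ℝ) (u : Fin (m + 1) → ℝ)
    (i : Fin m) : Stage :=
  ⟨decide (i.castSucc.succ ∈ S), u i.castSucc, Real.exp (-(α ^ d * u i.castSucc))⟩

/-- The set of the durations of all states but the initial one. -/
def simplexSet (m : ℕ) (T : ℝ) : Set (Fin m → ℝ) := {u | (∀ i, 0 ≤ u i) ∧ ∑ i, u i ≤ T}

variable {Γ χ : Space d → ℝ} {α r t : ℝ}

lemma damping_pos (u : ℝ) (ζ : Space d) : 0 < damping Γ α r u ζ := Real.exp_pos _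

lemma damping_le_one (hΓ : IsDampingProfile Γ) (hα : 0 ≤ α) {u : ℝ} (hu : 0 ≤ u) (ζ : Space d) :
    damping Γ α r u ζ ≤ 1 := by
  rw [damping, Real.exp_le_one_iff, neg_nonpos]
  have := hΓ.le_one (α • ((r ^ d)⁻¹ • ζ))
  exact mul_nonneg (mul_nonneg (pow_nonneg hα _) (by linarith)) hu

@[fun_prop]
lemma IsDampingProfile.continuous_damping (hΓ : IsDampingProfile Γ) {T : Type*}
    [TopologicalSpace T] {u : T → ℝ} {ζ : T → Space d} (hu : Continuous u) (hζ : Continuous ζ) :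
    Continuous fun s => damping Γ α r (u s) (ζ s) := by
  have h1 := hΓ.smooth.continuous
  unfold damping
  fun_prop

lemma continuous_tildeTransform_comp (a : SchwartzMap (Space d × Space d) ℂ) {T : Type*}
    [TopologicalSpace T] {ξ y : T → Space d} (hξ : Continuous ξ) (hy : Continuous y) :
    Continuous fun s => tildeTransform a (ξ s) (y s) :=
  Continuous.comp (g := fun p : Space d × Space d => tildeTransform a p.1 p.2)
    (f := fun s => (ξ s, y s)) (continuous_tildeTransform a) (hξ.prodMk hy)

lemma continuous_phase_comp {T : Type*} [TopologicalSpace T] {u : T → ℝ} {x : T → Space d × Space d}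
    (hu : Continuous u) (hx : Continuous x) : Continuous fun s => phase (u s) (x s) := by
  have h := continuous_expi
  unfold phase
  fun_prop

lemma continuous_stateMultiplier (hΓ : IsDampingProfile Γ) (hχ : IsRegionCutoff χ) (σ : Bool)
    {T : Type*} [TopologicalSpace T] {u : T → ℝ} {x : T → Space d × Space d} (hu : Continuous u)
    (hx : Continuous x) : Continuous fun s => stateMultiplier Γ χ α r σ (u s) (x s) := by
  have h1 := hχ.smooth.continuous
  have h2 : Continuous fun s => damping Γ α r (u s) ((x s).1 - (x s).2) :=
    hΓ.continuous_damping hu (by fun_prop)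
  unfold stateMultiplier
  refine (continuous_phase_comp hu hx).mul ?_
  cases σ <;> simp only [Bool.false_eq_true, if_false, if_true] <;> fun_prop

lemma continuous_finalState (hΓ : IsDampingProfile Γ) (a : SchwartzMap (Space d × Space d) ℂ)
    {T : Type*} [TopologicalSpace T] {u : T → ℝ} {x : T → Space d × Space d} (hu : Continuous u)
    (hx : Continuous x) : Continuous fun s => finalState Γ a α r (u s) (x s) := by
  have h2 : Continuous fun s => damping Γ α r (u s) ((x s).1 - (x s).2) :=
    hΓ.continuous_damping hu (by fun_prop)
  unfold finalState
  exact ((continuous_phase_comp hu hx).mul (by fun_prop)).mul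
    (continuous_tildeTransform_comp a (by fun_prop) (by fun_prop))

lemma continuous_initialState (hΓ : IsDampingProfile Γ) (b : SchwartzMap (Space d × Space d) ℂ)
    {T : Type*} [TopologicalSpace T] {u : T → ℝ} {p : T → Space d × Space d} (hu : Continuous u)
    (hp : Continuous p) : Continuous fun s => initialState Γ b α r (u s) (p s) := by
  have h2 : Continuous fun s => damping Γ α r (u s) (r ^ d • (p s).2) :=
    hΓ.continuous_damping hu (by fun_prop)
  unfold initialState
  exact (continuous_tildeTransform_comp b (by fun_prop) (by fun_prop)).mul
    ((continuous_phase_comp hu (by fun_prop)).mul (by fun_prop))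

lemma IsRegionCutoff.nonneg (hχ : IsRegionCutoff χ) (z : Space d) : 0 ≤ χ z := by
  rcases lt_or_ge 2 ‖z‖ with h | h
  · exact (hχ.eq_zero z h).ge
  · rcases eq_or_ne z 0 with rfl | hz
    · rw [hχ.eq_one 0 (by simp)]
      exact zero_le_one
    · have hz' : 0 < ‖z‖ := norm_pos_iff.2 hz
      have h3 : ‖(3 / ‖z‖) • z‖ = 3 := by
        rw [norm_smul, Real.norm_of_nonneg (by positivity), div_mul_cancel₀ _ hz'.ne']
      have h1 := hχ.antitone z ((3 / ‖z‖) • z) (by rw [h3]; linarith)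
      rwa [hχ.eq_zero _ (by rw [h3]; norm_num)] at h1

lemma IsRegionCutoff.le_one (hχ : IsRegionCutoff χ) (z : Space d) : χ z ≤ 1 := by
  have := hχ.antitone 0 z (by simp)
  rwa [hχ.eq_one 0 (by simp)] at this

/-- Where the region cut-off differs from one, the damping is not switched off. -/
lemma IsDampingProfile.eq_zero_or_eq_one (hΓ : IsDampingProfile Γ) (hχ : IsRegionCutoff χ)
    (z : Space d) : Γ z = 0 ∨ χ z = 1 := by
  rcases lt_trichotomy ‖z‖ 1 with h | h | h
  · exact Or.inr (hχ.eq_one z h)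
  · left
    -- on the unit sphere `Γ` vanishes by continuity
    have h1 : Tendsto (fun s : ℝ => Γ (s • z)) (𝓝[>] 1) (𝓝 (Γ ((1 : ℝ) • z))) := by
      have := hΓ.smooth.continuous
      exact (Continuous.tendsto (by fun_prop) 1).mono_left nhdsWithin_le_nhds
    have h2 : (fun s : ℝ => Γ (s • z)) =ᶠ[𝓝[>] 1] fun _ => 0 := by
      filter_upwards [self_mem_nhdsWithin] with s hs
      have hs : (1 : ℝ) < s := hs
      refine hΓ.eq_zero _ ?_
      rwa [norm_smul, h, mul_one, Real.norm_of_nonneg (by linarith)]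
    have h3 := tendsto_nhds_unique h1 (tendsto_const_nhds.congr' h2.symm)
    rwa [one_smul] at h3
  · exact Or.inl (hΓ.eq_zero z h)

/-- Where `χ ≠ 1` the damping rate is `α^d`, so that in an unmarked state the damping is a constant
factor. -/
lemma isMultiplier_stateMultiplier (hΓ : IsDampingProfile Γ) (hχ : IsRegionCutoff χ) (hα : 0 < α)
    (hr : 0 < r) (σ : Bool) {u : ℝ} (hu : 0 ≤ u) (hut : u * r ^ d ≤ t) :
    IsMultiplier (r ^ d) (2 / α) t ⟨σ, u, Real.exp (-(α ^ d * u))⟩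
      (fun ζ => (if σ then damping Γ α r u ζ else 1) * χ (α • ((r ^ d)⁻¹ • ζ)))
      (stateMultiplier Γ χ α r σ u) where
  time_nonneg := hu
  damp_nonneg := (Real.exp_pos _).le
  continuous := by
    have h1 := hχ.smooth.continuous
    have h2 : Continuous fun ζ : Space d => damping Γ α r u ζ :=
      hΓ.continuous_damping (by fun_prop) (by fun_prop)
    cases σ <;> simp only [Bool.false_eq_true, if_false, if_true] <;> fun_prop
  nonneg ζ := by
    have h2 : 0 < damping Γ α r u ζ := damping_pos _ _
    refine mul_nonneg ?_ (hχ.nonneg _)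
    split_ifs <;> positivity
  le_one ζ := by
    refine mul_le_one₀ ?_ (hχ.nonneg _) (hχ.le_one _)
    split_ifs
    · exact damping_le_one hΓ hα.le hu ζ
    · exact le_rfl
  eq_zero ζ hζ := by
    rw [hχ.eq_zero, mul_zero]
    rw [norm_smul, norm_smul, Real.norm_of_nonneg hα.le, norm_inv, norm_pow,
      Real.norm_of_nonneg hr.le]
    have hε : 0 < r ^ d := by positivity
    rw [← div_eq_inv_mul, mul_div_assoc', lt_div_iff₀ hε]
    have := mul_lt_mul_of_pos_left hζ hα
    calc 2 * r ^ d = α * (2 / α * r ^ d) := by field_simp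
      _ < _ := this
  time_le _ := hut
  eq_marked hs x := by
    have hs : σ = true := hs
    subst hs
    simp [stateMultiplier]
  eq_unmarked hs x := by
    have hs : σ = false := hs
    subst hs
    simp only [stateMultiplier, Bool.false_eq_true, if_false, one_mul]
    rcases hΓ.eq_zero_or_eq_one hχ (α • ((r ^ d)⁻¹ • (x.1 - x.2))) with h | h
    · rw [damping, h, sub_zero, mul_one]
    · rw [h, sub_self, mul_zero, mul_zero]

lemma exists_norm_initialState_le (b : SchwartzMap (Space d × Space d) ℂ) : ∃ C : ℝ, 0 ≤ C ∧
    ∀ (Γ : Space d → ℝ) (α r u : ℝ), IsDampingProfile Γ → 0 ≤ α → 0 ≤ r → r ≤ 1 → 0 ≤ u →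
      ∀ p, ‖initialState Γ b α r u p‖ ≤ C * (decay (d + 1) p.1 * decay (d + 1) p.2) := by
  obtain ⟨C, hC, h⟩ := exists_tildeTransform_diffBound b 0 (d + 1) ((d + 1) + (d + 1))
  refine ⟨C, hC, fun Γ α r u hΓ hα hr hr1 hu p => ?_⟩
  have h1 := (h p.2 (p.1 + (1 / 2 : ℝ) • (r ^ d • p.2)) 0 (by simp)).norm_zero_le
  simp only [smul_zero, add_zero] at h1
  rw [initialState, norm_mul, norm_mul, norm_phase, one_mul, Complex.norm_real,
    Real.norm_of_nonneg (damping_pos _ _).le]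
  have h2 : ‖(1 / 2 : ℝ) • (r ^ d • p.2)‖ ≤ ‖p.2‖ := by
    rw [smul_smul, norm_smul, Real.norm_of_nonneg (by positivity)]
    have : r ^ d ≤ 1 := pow_le_one₀ hr hr1
    exact mul_le_of_le_one_left (norm_nonneg _) (by linarith)
  have h3 : decay (d + 1) (p.1 + (1 / 2 : ℝ) • (r ^ d • p.2)) ≤
      decay (d + 1) p.1 * (1 + ‖p.2‖) ^ (d + 1) := by
    refine (decay_add_le _ _ _).trans ?_
    have := decay_pos (d + 1) p.1
    gcongr
  have p1 := decay_pos (d + 1) p.1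
  have p2 := decay_pos ((d + 1) + (d + 1)) p.2
  calc _ ≤ C * decay ((d + 1) + (d + 1)) p.2 *
        decay (d + 1) (p.1 + (1 / 2 : ℝ) • (r ^ d • p.2)) * 1 :=
        mul_le_mul h1 (damping_le_one hΓ hα hu _) (damping_pos _ _).le
          ((norm_nonneg _).trans h1)
    _ ≤ C * decay ((d + 1) + (d + 1)) p.2 * (decay (d + 1) p.1 * (1 + ‖p.2‖) ^ (d + 1)) := by
        rw [mul_one]
        gcongr
    _ = C * (decay (d + 1) p.1 * (decay (d + 1) p.2 * (decay (d + 1) p.2 *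
          (1 + ‖p.2‖) ^ (d + 1)))) := by rw [decay_add]; ring
    _ = _ := by rw [decay_mul_pow, mul_one]

lemma norm_stateMultiplier_le (hΓ : IsDampingProfile Γ) (hχ : IsRegionCutoff χ) (hα : 0 ≤ α)
    (σ : Bool) {u : ℝ} (hu : 0 ≤ u) (x : Space d × Space d) :
    ‖stateMultiplier Γ χ α r σ u x‖ ≤ 1 := by
  rw [stateMultiplier, norm_mul, norm_phase, one_mul, Complex.norm_real, norm_mul,
    Real.norm_of_nonneg (damping_pos _ _).le]
  refine mul_le_one₀ (damping_le_one hΓ hα hu _) (norm_nonneg _) ?_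
  have h1 := hχ.nonneg (α • ((r ^ d)⁻¹ • (x.1 - x.2)))
  have h2 := hχ.le_one (α • ((r ^ d)⁻¹ • (x.1 - x.2)))
  rw [Real.norm_eq_abs, abs_le]
  split_ifs <;> constructor <;> linarith

lemma exists_norm_finalState_le (a : SchwartzMap (Space d × Space d) ℂ) : ∃ C : ℝ, 0 ≤ C ∧
    ∀ (Γ : Space d → ℝ) (α r u : ℝ), IsDampingProfile Γ → 0 ≤ α → 0 ≤ u →
      ∀ x, ‖finalState Γ a α r u x‖ ≤ C := by
  obtain ⟨C, hC, h⟩ := exists_tildeTransform_diffBound a 0 0 0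
  refine ⟨C, hC, fun Γ α r u hΓ hα hu x => ?_⟩
  have h1 := (h (-((r ^ d)⁻¹ • (x.1 - x.2))) ((1 / 2 : ℝ) • (x.1 + x.2)) 0
    (by simp)).norm_zero_le
  simp only [smul_zero, add_zero, decay, pow_zero, inv_one, mul_one] at h1
  rw [finalState, norm_mul, norm_mul, norm_phase, one_mul, Complex.norm_real,
    Real.norm_of_nonneg (damping_pos _ _).le]
  calc _ ≤ 1 * C := mul_le_mul (damping_le_one hΓ hα hu _) h1 (norm_nonneg _) zero_le_one
    _ = C := one_mul C

end Histories

section Combinatorics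

lemma chiSet_eq_prod {m : ℕ} (χ : Space d → ℝ) {S : Finset (Fin (m + 2))} (h0 : 0 ∈ S)
    (hl : Fin.last _ ∈ S) (v : Fin (m + 2) → Space d) :
    chiSet χ S v = ∏ i : Fin m, if i.castSucc.succ ∈ S then χ (v i.castSucc.succ)
      else 1 - χ (v i.castSucc.succ) := by
  classical
  have h1 : (∏ j ∈ S \ {0, Fin.last (m + 1)}, χ (v j)) = ∏ j : Fin (m + 2),
      if j ∈ S ∧ j ≠ 0 ∧ j ≠ Fin.last (m + 1) then χ (v j) else 1 := by
    rw [← Finset.prod_filter]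
    refine Finset.prod_congr ?_ fun _ _ => rfl
    ext j
    simp
  have h2 : (∏ j ∈ Sᶜ, (1 - χ (v j))) = ∏ j : Fin (m + 2), if j ∈ S then 1 else 1 - χ (v j) := by
    rw [Finset.prod_ite, Finset.prod_const_one, one_mul]
    refine Finset.prod_congr ?_ fun _ _ => rfl
    ext j
    simp
  rw [chiSet, h1, h2, ← Finset.prod_mul_distrib, Fin.prod_univ_succ, Fin.prod_univ_castSucc]
  have h3 : (Fin.last m).succ = Fin.last (m + 1) := rfl
  simp only [h3, h0, hl, ne_eq, not_true_eq_false, and_false, false_and, if_false, if_true,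
    mul_one, one_mul]
  refine Finset.prod_congr rfl fun i _ => ?_
  have h4 : i.castSucc.succ ≠ Fin.last (m + 1) := by
    rw [← h3, Ne, Fin.succ_inj]
    exact i.castSucc_lt_last.ne
  have h5 : i.castSucc.succ ≠ 0 := Fin.succ_ne_zero _
  by_cases h : i.castSucc.succ ∈ S
  · rw [if_pos h, if_pos h, if_pos ⟨h, h5, h4⟩, mul_one]
  · rw [if_neg h, if_neg h, if_neg (fun h' => h h'.1), one_mul]

lemma diag_iff_forall {ι : Type} {m : ℕ} (st : Fin m → Stage) (q : Fin (m + 1) → ι) :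
    Diag m st q ↔ ∀ i : Fin m, (st i).marked = true ∨ q i.castSucc = q i.succ := by
  induction m with
  | zero => simp [Diag]
  | succ m ih =>
    rw [Diag, ih, Fin.forall_fin_succ]
    rfl

/-- Comparison of each scatterer with that at the next marked state amounts to comparison of
neighbours. -/
lemma isDiagonal_iff {ι : Type} {m : ℕ} {S : Finset (Fin (m + 2))} (hl : Fin.last _ ∈ S)
    {f : ι → Space d} (hf : Function.Injective f) (α : ℝ) (u : Fin (m + 1) → ℝ)
    (q : Fin (m + 1) → ι) :
    IsDiagonal S (fun i => f (q i)) ↔ Diag m (stages d S α u) q := by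
  classical
  rw [diag_iff_forall]
  simp only [stages, decide_eq_true_eq]
  constructor
  · intro h i
    by_contra hi
    rw [not_or] at hi
    obtain ⟨hS, hq⟩ := hi
    -- the first marked state after the `i`-th intermediate state
    have hex : ∃ n : ℕ, ∃ l : Fin (m + 1), l.val = n ∧ i.succ ≤ l ∧ l.succ ∈ S :=
      ⟨m, Fin.last m, rfl, Fin.le_last _, hl⟩
    obtain ⟨l, hln, hil, hlS⟩ := Nat.find_spec hex
    have hmin : ∀ n : Fin (m + 1), i.castSucc ≤ n → n < l → n.succ ∉ S := by
      intro n hin hnl hnS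
      rcases hin.eq_or_lt with h1 | h1
      · exact hS (h1 ▸ hnS)
      · have h2 : i.succ ≤ n := Fin.castSucc_lt_iff_succ_le.1 h1
        have h3 := Nat.find_min' hex ⟨n, rfl, h2, hnS⟩
        have : n.val < l.val := hnl
        omega
    have e1 := hf (h i.castSucc l (i.castSucc_lt_succ.le.trans hil) hlS hmin)
    have e2 := hf (h i.succ l hil hlS fun n hn => hmin n (i.castSucc_lt_succ.le.trans hn))
    exact hq (e1.trans e2.symm)
  · intro h k l hkl hlS hn
    -- the scatterers agree step by step
    have key : ∀ n : ℕ, ∀ hn' : n < m + 1, k.val ≤ n → n ≤ l.val → q k = q ⟨n, hn'⟩ := by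
      intro n hn' hkn
      induction n, hkn using Nat.le_induction with
      | base => intro _; rfl
      | succ n hkn ih =>
        intro hnl
        rw [ih (by omega) (by omega)]
        rcases h ⟨n, by omega⟩ with h1 | h1
        · exact absurd h1 (hn ⟨n, by omega⟩ hkn (by
            rw [Fin.lt_def]
            exact hnl))
        · exact h1
    exact congrArg f (key l.val l.isLt hkl le_rfl)

end Combinatorics

/-! ### The order of integration -/

section Fubini

variable {Γ χ : Space d → ℝ} {α r t : ℝ}

lemma expi_sum {ι : Type*} (s : Finset ι) (f : ι → ℝ) :
    expi (∑ i ∈ s, f i) = ∏ i ∈ s, expi (f i) := by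
  classical
  induction s using Finset.induction_on with
  | empty => simp [expi]
  | insert i s hi ih => rw [Finset.sum_insert hi, Finset.prod_insert hi, expi_add, ih]

/-- The integrand of a collision history, in terms of the sequence of states. -/
noncomputable def historyIntegrand (Γ χ : Space d → ℝ) (a b : SchwartzMap (Space d × Space d) ℂ)
    (α r T : ℝ) {m : ℕ} (γ : Fin (m + 1) → Fin 2) (S : Finset (Fin (m + 2)))
    (k : Fin (m + 1) → Space d → ℂ) (u : Fin (m + 1) → ℝ) (p : Space d × Space d)
    (z : Fin (m + 1) → Space d) : ℂ :=
  initialState Γ b α r (T - ∑ i, u i) p * ((∏ i, k i (z i)) *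
    ((∏ i : Fin m, stateMultiplier Γ χ α r (decide (i.castSucc.succ ∈ S)) (u i.castSucc)
      (state γ (p.1 + r ^ d • p.2, p.1) z i.castSucc.succ)) *
        finalState Γ a α r (u (Fin.last m)) (state γ (p.1 + r ^ d • p.2, p.1) z (Fin.last _))))

lemma state_fst_sub_snd {m : ℕ} (γ : Fin m → Fin 2) (x : Space d × Space d) (z : Fin m → Space d)
    (j : Fin (m + 1)) : (state γ x z j).1 - (state γ x z j).2 = x.1 - x.2 + partialSum z j := by
  rw [← gammaBarSum_add_gammaSum γ]
  simp only [state]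
  abel

lemma smul_state_sub {m : ℕ} (hr : 0 < r) (γ : Fin m → Fin 2) (y η : Space d) (z : Fin m → Space d)
    (j : Fin (m + 1)) : (r ^ d)⁻¹ • ((state γ (y + r ^ d • η, y) z j).1 -
      (state γ (y + r ^ d • η, y) z j).2) = momentumDiff r η z j := by
  have hε : r ^ d ≠ 0 := by positivity
  rw [state_fst_sub_snd, momentumDiff, add_sub_cancel_left, smul_add, inv_smul_smul₀ hε]

lemma phase_state {m : ℕ} (γ : Fin m → Fin 2) (y η : Space d) (z : Fin m → Space d)
    (j : Fin (m + 1)) (u : ℝ) :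
    phase u (state γ (y + r ^ d • η, y) z j) = expi (xi r γ y η z j * u) := by
  rw [phase, xi]
  simp only [state]
  rw [add_right_comm y]

lemma damping_state {m : ℕ} (hr : 0 < r) (γ : Fin m → Fin 2) (y η : Space d)
    (z : Fin m → Space d) (j : Fin (m + 1)) (u : ℝ) :
    damping Γ α r u ((state γ (y + r ^ d • η, y) z j).1 - (state γ (y + r ^ d • η, y) z j).2) =
      Real.exp (-(α ^ d * (1 - Γ (α • momentumDiff r η z j)) * u)) := by
  rw [damping, smul_state_sub hr]

/-- The initial pair of momenta is `(y + r^d η, y)`. -/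
lemma historyIntegrand_eq (hr : 0 < r) (W : SchwartzMap (Space d) ℂ)
    (a b : SchwartzMap (Space d × Space d) ℂ) (lam : Space d → ℝ) (T : ℝ) {m : ℕ}
    (γ : Fin (m + 1) → Fin 2) {S : Finset (Fin (m + 2))} (h0 : 0 ∈ S) (hl : Fin.last _ ∈ S)
    (q : Fin (m + 1) → Space d) (u : Fin (m + 1) → ℝ) (y η : Space d) (z : Fin (m + 1) → Space d) :
    historyIntegrand Γ χ a b α r T γ S
        (fun i => kern W (lam (r ^ (d - 1) • q i) : ℂ) (r⁻¹ • q i)) u (y, η) z =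
      (∏ i, (lam (r ^ (d - 1) • q i) : ℂ)) *
        ((∏ i, 𝓕 (W : Space d → ℂ) (z i)) * expi (-∑ i, r⁻¹ * inner ℝ (q i) (z i)) *
        (∏ j : Fin (m + 2),
          expi (xi r γ y η z j * (Fin.cons (T - ∑ i, u i) u : Fin (m + 2) → ℝ) j) *
          (Real.exp (-(α ^ d * (1 - Γ (α • momentumDiff r η z j)) *
            (Fin.cons (T - ∑ i, u i) u : Fin (m + 2) → ℝ) j)) : ℂ)) *
        (chiSet χ S (fun j => α • momentumDiff r η z j) : ℂ) *
        tildeTransform a (-momentumDiff r η z (Fin.last _))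
          (y - gammaSum γ z (Fin.last _)
            + (1 / 2 : ℝ) • (r ^ d • η + partialSum z (Fin.last _))) *
        tildeTransform b η (y + (1 / 2 : ℝ) • (r ^ d • η))) := by
  have hk : ∏ i, kern W (lam (r ^ (d - 1) • q i) : ℂ) (r⁻¹ • q i) (z i) =
      (∏ i, (lam (r ^ (d - 1) • q i) : ℂ)) *
        ((∏ i, 𝓕 (W : Space d → ℂ) (z i)) * expi (-∑ i, r⁻¹ * inner ℝ (q i) (z i))) := by
    simp only [kern_apply, Finset.prod_mul_distrib]
    rw [← Finset.sum_neg_distrib, expi_sum]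
    simp only [real_inner_smul_left]
    ring
  have hF : finalState Γ a α r (u (Fin.last m)) (state γ (y + r ^ d • η, y) z (Fin.last _)) =
      (expi (xi r γ y η z (Fin.last _) * u (Fin.last m)) *
        (Real.exp (-(α ^ d * (1 - Γ (α • momentumDiff r η z (Fin.last _))) *
            u (Fin.last m))) : ℂ)) *
        tildeTransform a (-momentumDiff r η z (Fin.last _))
          (y - gammaSum γ z (Fin.last _)
            + (1 / 2 : ℝ) • (r ^ d • η + partialSum z (Fin.last _))) := by
    rw [finalState, phase_state, damping_state hr, smul_state_sub hr]
    congr 2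
    have h1 := state_fst_sub_snd γ (y + r ^ d • η, y) z (Fin.last (m + 1))
    simp only [add_sub_cancel_left] at h1
    rw [← h1]
    simp only [state]
    module
  have hM : ∏ i : Fin m, stateMultiplier Γ χ α r (decide (i.castSucc.succ ∈ S)) (u i.castSucc)
      (state γ (y + r ^ d • η, y) z i.castSucc.succ) =
      (∏ i : Fin m, (expi (xi r γ y η z i.castSucc.succ * u i.castSucc) *
        (Real.exp (-(α ^ d * (1 - Γ (α • momentumDiff r η z i.castSucc.succ)) *
            u i.castSucc)) : ℂ))) *
        (chiSet χ S (fun j => α • momentumDiff r η z j) : ℂ) := by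
    rw [chiSet_eq_prod χ h0 hl, Complex.ofReal_prod, ← Finset.prod_mul_distrib]
    refine Finset.prod_congr rfl fun i _ => ?_
    rw [stateMultiplier, phase_state, damping_state hr, smul_state_sub hr]
    simp only [decide_eq_true_eq, Complex.ofReal_mul]
    ring
  have hI : initialState Γ b α r (T - ∑ i, u i) (y, η) =
      (expi (xi r γ y η z 0 * (T - ∑ i, u i)) *
        (Real.exp (-(α ^ d * (1 - Γ (α • momentumDiff r η z 0)) * (T - ∑ i, u i))) : ℂ)) *
        tildeTransform b η (y + (1 / 2 : ℝ) • (r ^ d • η)) := by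
    have h1 := phase_state (r := r) γ y η z 0 (T - ∑ i, u i)
    have h2 := damping_state (Γ := Γ) (α := α) hr γ y η z 0 (T - ∑ i, u i)
    rw [state_zero] at h1 h2
    simp only [add_sub_cancel_left] at h2
    rw [initialState, h1, h2]
    ring
  have hprod : ∀ f : Fin (m + 2) → ℂ,
      ∏ j, f j = f 0 * ((∏ i : Fin m, f i.castSucc.succ) * f (Fin.last _)) := fun f => by
    rw [Fin.prod_univ_succ, Fin.prod_univ_castSucc, Fin.succ_last]
  rw [historyIntegrand, hk, hF, hM, hI, hprod]
  simp only [Fin.cons_zero, ← Fin.succ_last, Fin.cons_succ]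
  ring

lemma isClosed_simplexSet (m : ℕ) (T : ℝ) : IsClosed (simplexSet m T) := by
  have h1 : simplexSet m T = (⋂ i, {u : Fin m → ℝ | 0 ≤ u i}) ∩ {u | ∑ i, u i ≤ T} := by
    ext u
    simp [simplexSet]
  rw [h1]
  exact (isClosed_iInter fun i => isClosed_le (by fun_prop) (by fun_prop)).inter
    (isClosed_le (by fun_prop) (by fun_prop))

lemma simplexSet_subset (m : ℕ) (T : ℝ) :
    simplexSet m T ⊆ Set.pi Set.univ fun _ => Set.Icc 0 T := fun u hu i _ =>
  ⟨hu.1 i, (Finset.single_le_sum (f := u) (fun j _ => hu.1 j) (Finset.mem_univ i)).trans hu.2⟩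

lemma volume_simplexSet_lt_top (m : ℕ) (T : ℝ) : volume (simplexSet m T) < ⊤ :=
  (measure_mono (simplexSet_subset m T)).trans_lt
    (isCompact_univ_pi fun _ => isCompact_Icc).measure_lt_top

lemma continuous_historyIntegrand (hΓ : IsDampingProfile Γ) (hχ : IsRegionCutoff χ)
    (a b : SchwartzMap (Space d × Space d) ℂ) (T : ℝ) {m : ℕ}
    (γ : Fin (m + 1) → Fin 2) (S : Finset (Fin (m + 2))) {k : Fin (m + 1) → Space d → ℂ}
    (hk : ∀ i, Continuous (k i)) {X : Type*} [TopologicalSpace X] {u : X → Fin (m + 1) → ℝ}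
    {p : X → Space d × Space d} {z : X → Fin (m + 1) → Space d} (hu : Continuous u)
    (hp : Continuous p) (hz : Continuous z) : Continuous fun s =>
      historyIntegrand Γ χ a b α r T γ S k (u s) (p s) (z s) := by
  unfold historyIntegrand
  refine (continuous_initialState hΓ b (by fun_prop) hp).mul (Continuous.mul ?_ (Continuous.mul ?_
    (continuous_finalState hΓ a (by fun_prop) (by fun_prop))))
  · exact continuous_finsetProd _ fun i _ => (hk i).comp (by fun_prop)
  · exact continuous_finsetProd _ fun i _ =>
      continuous_stateMultiplier hΓ hχ _ (by fun_prop) (by fun_prop)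

lemma integrable_decay_prod :
    Integrable fun p : Space d × Space d => decay (d + 1) p.1 * decay (d + 1) p.2 :=
  integrable_decay_succ.mul_prod integrable_decay_succ

lemma measurePreserving_prodAssoc {A B C : Type*} [MeasureSpace A] [MeasureSpace B]
    [MeasureSpace C] [SFinite (volume : Measure A)] [SFinite (volume : Measure B)]
    [SFinite (volume : Measure C)] :
    MeasurePreserving (MeasurableEquiv.prodAssoc : (A × B) × C ≃ᵐ A × B × C) volume volume :=
  ⟨MeasurableEquiv.prodAssoc.measurable, Measure.prodAssoc_prod⟩

lemma integrable_historyIntegrand (hΓ : IsDampingProfile Γ) (hχ : IsRegionCutoff χ) (hα : 0 ≤ α)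
    (hr : 0 ≤ r) (hr1 : r ≤ 1) (a b : SchwartzMap (Space d × Space d) ℂ) (T : ℝ) {m : ℕ}
    (γ : Fin (m + 1) → Fin 2) (S : Finset (Fin (m + 2))) {k : Fin (m + 1) → Space d → ℂ}
    (hk : ∀ i, Continuous (k i)) (hki : ∀ i, Integrable (k i)) :
    Integrable (fun s : ((Space d × Space d) × (Fin (m + 1) → Space d)) × (Fin (m + 1) → ℝ) =>
      historyIntegrand Γ χ a b α r T γ S k s.2 s.1.1 s.1.2)
      (volume.prod (volume.restrict (simplexSet (m + 1) T))) := by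
  obtain ⟨C₁, hC₁, h1⟩ := exists_norm_initialState_le b
  obtain ⟨C₂, hC₂, h2⟩ := exists_norm_finalState_le a
  have hms : MeasurableSet (simplexSet (m + 1) T) := (isClosed_simplexSet _ _).measurableSet
  have : IsFiniteMeasure (volume.restrict (simplexSet (m + 1) T)) :=
    ⟨by rw [Measure.restrict_apply_univ]; exact volume_simplexSet_lt_top _ _⟩
  have hdom : Integrable (fun s : ((Space d × Space d) × (Fin (m + 1) → Space d)) ×
      (Fin (m + 1) → ℝ) => ((decay (d + 1) s.1.1.1 * decay (d + 1) s.1.1.2) *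
        ∏ i, ‖k i (s.1.2 i)‖) * (C₁ * C₂))
      (volume.prod (volume.restrict (simplexSet (m + 1) T))) := by
    have h3 := (integrable_decay_prod (d := d)).mul_prod
      (Integrable.fintype_prod (f := fun i z => ‖k i z‖) (fun i => (hki i).norm))
    exact h3.mul_prod (ν := volume.restrict (simplexSet (m + 1) T)) (integrable_const (C₁ * C₂))
  refine hdom.mono' ?_ ?_
  · exact (continuous_historyIntegrand hΓ hχ a b T γ S hk (by fun_prop) (by fun_prop)
      (by fun_prop)).aestronglyMeasurable
  · rw [← Measure.restrict_univ (μ := (volume : Measure ((Space d × Space d) ×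
      (Fin (m + 1) → Space d)))), Measure.prod_restrict,
      ae_restrict_iff' (MeasurableSet.univ.prod hms)]
    refine Eventually.of_forall fun s hs => ?_
    obtain ⟨hu, huT⟩ := hs.2
    rw [historyIntegrand, norm_mul, norm_mul, norm_mul, norm_prod, norm_prod]
    have e1 := h1 Γ α r (T - ∑ i, s.2 i) hΓ hα hr hr1 (by linarith) s.1.1
    have e2 := h2 Γ α r (s.2 (Fin.last m)) hΓ hα (hu _)
      (state γ (s.1.1.1 + r ^ d • s.1.1.2, s.1.1.1) s.1.2 (Fin.last _))
    have e3 : ∏ i : Fin m, ‖stateMultiplier Γ χ α r (decide (i.castSucc.succ ∈ S))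
        (s.2 i.castSucc)
        (state γ (s.1.1.1 + r ^ d • s.1.1.2, s.1.1.1) s.1.2 i.castSucc.succ)‖ ≤ 1 :=
      Finset.prod_le_one (fun _ _ => norm_nonneg _) fun i _ =>
        norm_stateMultiplier_le hΓ hχ hα _ (hu _) _
    have e4 : 0 ≤ ∏ i, ‖k i (s.1.2 i)‖ := Finset.prod_nonneg fun _ _ => norm_nonneg _
    have p1 := decay_pos (d + 1) s.1.1.1
    have p2 := decay_pos (d + 1) s.1.1.2
    calc _ ≤ (C₁ * (decay (d + 1) s.1.1.1 * decay (d + 1) s.1.1.2)) *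
          ((∏ i, ‖k i (s.1.2 i)‖) * (1 * C₂)) := by
          refine mul_le_mul e1 (mul_le_mul_of_nonneg_left (mul_le_mul e3 e2 (norm_nonneg _)
            zero_le_one) e4) ?_ (by positivity)
          exact mul_nonneg e4 (mul_nonneg (Finset.prod_nonneg fun _ _ => norm_nonneg _)
            (norm_nonneg _))
      _ = _ := by ring

lemma boundedMeasurable_stateMultiplier (hΓ : IsDampingProfile Γ) (hχ : IsRegionCutoff χ)
    (hα : 0 ≤ α) (σ : Bool) {u : ℝ} (hu : 0 ≤ u) :
    BoundedMeasurable (stateMultiplier Γ χ α r σ u) :=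
  BoundedMeasurable.of_continuous (continuous_stateMultiplier hΓ hχ σ (by fun_prop) (by fun_prop))
    (norm_stateMultiplier_le hΓ hχ hα σ hu)

lemma boundedMeasurable_finalState (hΓ : IsDampingProfile Γ)
    (a : SchwartzMap (Space d × Space d) ℂ) (hα : 0 ≤ α) {u : ℝ} (hu : 0 ≤ u) :
    BoundedMeasurable (finalState Γ a α r u) := by
  obtain ⟨C, _, h⟩ := exists_norm_finalState_le a
  exact BoundedMeasurable.of_continuous (continuous_finalState hΓ a (by fun_prop) (by fun_prop))
    (h Γ α r u hΓ hα hu)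

/-- The collision history with the kernels `k` at fixed durations `u`, paired with the initial
state. -/
noncomputable def fixedTimeTerm (Γ χ : Space d → ℝ) (a b : SchwartzMap (Space d × Space d) ℂ)
    (α r T : ℝ) {m : ℕ} (γ : Fin (m + 1) → Fin 2) (S : Finset (Fin (m + 2)))
    (k : Fin (m + 1) → Space d → ℂ) (u : Fin (m + 1) → ℝ) : ℂ :=
  ∫ p : Space d × Space d, initialState Γ b α r (T - ∑ i, u i) p * chain m k γ
    (fun i => stateMultiplier Γ χ α r (decide (i.castSucc.succ ∈ S)) (u i.castSucc))
    (finalState Γ a α r (u (Fin.last m))) (p.1 + r ^ d • p.2, p.1)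

lemma integral_historyIntegrand (hΓ : IsDampingProfile Γ) (hχ : IsRegionCutoff χ) (hα : 0 ≤ α)
    (a b : SchwartzMap (Space d × Space d) ℂ) (T : ℝ) {m : ℕ}
    (γ : Fin (m + 1) → Fin 2) (S : Finset (Fin (m + 2))) {k : Fin (m + 1) → Space d → ℂ}
    (hki : ∀ i, Integrable (k i)) {u : Fin (m + 1) → ℝ} (hu : ∀ i, 0 ≤ u i)
    (hint : Integrable fun s : (Space d × Space d) × (Fin (m + 1) → Space d) =>
      historyIntegrand Γ χ a b α r T γ S k u s.1 s.2) :
    ∫ s : (Space d × Space d) × (Fin (m + 1) → Space d),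
      historyIntegrand Γ χ a b α r T γ S k u s.1 s.2 = fixedTimeTerm Γ χ a b α r T γ S k u := by
  rw [Measure.volume_eq_prod, integral_prod _ (by rw [← Measure.volume_eq_prod]; exact hint),
    fixedTimeTerm]
  refine integral_congr_ae (Eventually.of_forall fun p => ?_)
  simp only [historyIntegrand, integral_const_mul]
  rw [chain_eq_integral γ hki (fun i => boundedMeasurable_stateMultiplier hΓ hχ hα _ (hu _))
    (boundedMeasurable_finalState hΓ a hα (hu _))]

/-- The order of integration is exchanged: the durations are kept for last. -/
lemma collisionTerm_eq (hΓ : IsDampingProfile Γ) (hχ : IsRegionCutoff χ) (hα : 0 ≤ α)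
    (hr : 0 < r) (hr1 : r ≤ 1) (W : SchwartzMap (Space d) ℂ)
    (a b : SchwartzMap (Space d × Space d) ℂ) (lam : Space d → ℝ) {m : ℕ}
    (γ : Fin (m + 1) → Fin 2) {S : Finset (Fin (m + 2))} (h0 : 0 ∈ S) (hl : Fin.last _ ∈ S)
    (q : Fin (m + 1) → Space d) :
    IntegrableOn (fixedTimeTerm Γ χ a b α r ((r ^ d)⁻¹ * t) γ S
        (fun i => kern W (lam (r ^ (d - 1) • q i) : ℂ) (r⁻¹ • q i)))
        (simplexSet (m + 1) ((r ^ d)⁻¹ * t)) ∧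
      collisionTerm Γ χ W a b lam α r t γ S q = ∫ u in simplexSet (m + 1) ((r ^ d)⁻¹ * t),
        fixedTimeTerm Γ χ a b α r ((r ^ d)⁻¹ * t) γ S
          (fun i => kern W (lam (r ^ (d - 1) • q i) : ℂ) (r⁻¹ • q i)) u := by
  set T := (r ^ d)⁻¹ * t with hT
  set k : Fin (m + 1) → Space d → ℂ :=
    fun i => kern W (lam (r ^ (d - 1) • q i) : ℂ) (r⁻¹ • q i) with hk
  have hkc : ∀ i, Continuous (k i) := fun i => continuous_kern _ _ _
  have hki : ∀ i, Integrable (k i) := fun i => integrable_kern _ _ _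
  have hms : MeasurableSet (simplexSet (m + 1) T) := (isClosed_simplexSet _ _).measurableSet
  have hI := integrable_historyIntegrand hΓ hχ hα hr.le hr1 a b T γ S hkc hki
  have hae : ∀ᵐ u ∂(volume.restrict (simplexSet (m + 1) T)),
      ∫ s : (Space d × Space d) × (Fin (m + 1) → Space d),
        historyIntegrand Γ χ a b α r T γ S k u s.1 s.2 = fixedTimeTerm Γ χ a b α r T γ S k u := by
    filter_upwards [hI.prod_left_ae, ae_restrict_mem hms] with u h1 h2
    exact integral_historyIntegrand hΓ hχ hα a b T γ S hki h2.1 h1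
  constructor
  · exact hI.integral_prod_right.congr hae
  · rw [← integral_congr_ae hae, ← integral_integral_swap
      (f := fun (s : (Space d × Space d) × (Fin (m + 1) → Space d)) u =>
        historyIntegrand Γ χ a b α r T γ S k u s.1 s.2) hI, collisionTerm]
    have h1 := (measurePreserving_prodAssoc (A := Space d) (B := Space d)
      (C := Fin (m + 1) → Space d)).integral_comp'
      (fun p : Space d × Space d × (Fin (m + 1) → Space d) =>
        (∏ i, (lam (r ^ (d - 1) • q i) : ℂ)) *
        ((∏ i, 𝓕 (W : Space d → ℂ) (p.2.2 i)) * expi (-∑ i, r⁻¹ * inner ℝ (q i) (p.2.2 i)) *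
        timeFactor Γ α r t γ p.1 p.2.1 p.2.2 *
        (chiSet χ S (fun j => α • momentumDiff r p.2.1 p.2.2 j) : ℂ) *
        tildeTransform a (-momentumDiff r p.2.1 p.2.2 (Fin.last _))
          (p.1 - gammaSum γ p.2.2 (Fin.last _)
            + (1 / 2 : ℝ) • (r ^ d • p.2.1 + partialSum p.2.2 (Fin.last _))) *
        tildeTransform b p.2.1 (p.1 + (1 / 2 : ℝ) • (r ^ d • p.2.1))))
    rw [← integral_const_mul]
    refine h1.symm.trans (integral_congr_ae (Eventually.of_forall fun s => ?_))
    obtain ⟨⟨y, η⟩, z⟩ := s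
    simp only [hk, historyIntegrand_eq hr W a b lam T γ h0 hl q]
    rw [integral_const_mul]
    change (∏ i, (lam (r ^ (d - 1) • q i) : ℂ)) *
        ((∏ i, 𝓕 (W : Space d → ℂ) (z i)) * expi (-∑ i, r⁻¹ * inner ℝ (q i) (z i)) *
        timeFactor Γ α r t γ y η z * _ * _ * _) = _
    congr 1
    rw [timeFactor, simplexIntegral]
    simp only [integral_mul_const, integral_const_mul]
    rfl

end Fubini

/-! ### Integration over the durations, and summation over the scatterers -/

section Time

lemma integrableOn_exp_neg_mul_pow {c : ℝ} (hc : 0 < c) (n : ℕ) :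
    IntegrableOn (fun v : ℝ => Real.exp (-(c * v)) * (1 + v) ^ n) (Set.Ioi 0) := by
  refine integrable_of_isBigO_exp_neg (b := c / 2) (by positivity) (by fun_prop) ?_
  have h1 : (fun v : ℝ => (1 + v) ^ n) =O[atTop] fun v : ℝ => v ^ n := by
    refine IsBigO.of_bound (2 ^ n) ?_
    filter_upwards [eventually_ge_atTop 1] with v hv
    rw [Real.norm_of_nonneg (by positivity), Real.norm_of_nonneg (by positivity), ← mul_pow]
    gcongr
    linarith
  have h2 : (fun v : ℝ => v ^ n) =O[atTop] fun v => Real.exp (c / 2 * v) :=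
    (isLittleO_pow_exp_pos_mul_atTop n (by positivity)).isBigO
  have h3 := (isBigO_refl (fun v : ℝ => Real.exp (-(c * v))) atTop).mul (h1.trans h2)
  refine h3.trans_eventuallyEq ?_
  refine Eventually.of_forall fun v => ?_
  simp only
  rw [← Real.exp_add]
  congr 1
  ring

/-- The integral over all durations, one factor for each state but the initial one: a marked state
contributes `θ T ≤ t`, an unmarked one a convergent integral. -/
lemma setIntegral_weight_le {m N : ℕ} {S : Finset (Fin (m + 2))} (hl : Fin.last _ ∈ S)
    {α θ T t : ℝ} (hα : 0 < α) (hθ : 0 ≤ θ) (hT : 0 ≤ T) (ht : 0 ≤ t) (hθT : θ * T ≤ t) :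
    IntegrableOn (fun u => (∏ i, (stages d S α u i).weight N θ) * θ) (simplexSet (m + 1) T) ∧
    ∫ u in simplexSet (m + 1) T, (∏ i, (stages d S α u i).weight N θ) * θ ≤
      (t + ∫ v in Set.Ioi (0 : ℝ), Real.exp (-(α ^ d * v)) * (1 + v) ^ (2 * N)) ^ (m + 1) := by
  set G : Fin (m + 1) → ℝ → ℝ := fun j v =>
    Stage.weight N θ ⟨decide (j.succ ∈ S), v, Real.exp (-(α ^ d * v))⟩ with hG
  have hGc : ∀ j, Continuous (G j) := by
    intro j
    simp only [hG, Stage.weight]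
    split_ifs <;> fun_prop
  have hG0 : ∀ j, ∀ v, 0 ≤ v → 0 ≤ G j v := fun j v hv =>
    Stage.weight_nonneg hθ hv (Real.exp_pos _).le
  have hprod : (fun u : Fin (m + 1) → ℝ => (∏ i, (stages d S α u i).weight N θ) * θ) =
      fun u => ∏ j, G j (u j) := by
    funext u
    rw [Fin.prod_univ_castSucc]
    congr 1
    simp only [hG, Stage.weight, Fin.succ_last, hl, decide_true, if_true]
  have hcont : Continuous fun u : Fin (m + 1) → ℝ => ∏ j, G j (u j) :=
    continuous_finsetProd _ fun j _ => (hGc j).comp (by fun_prop)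
  rw [hprod]
  have hbox : IntegrableOn (fun u : Fin (m + 1) → ℝ => ∏ j, G j (u j))
      (Set.pi Set.univ fun _ => Set.Icc 0 T) :=
    hcont.continuousOn.integrableOn_compact (isCompact_univ_pi fun _ => isCompact_Icc)
  refine ⟨hbox.mono_set (simplexSet_subset _ _), ?_⟩
  have hexp := integrableOn_exp_neg_mul_pow (c := α ^ d) (by positivity) (2 * N)
  have hexp0 : 0 ≤ ∫ v in Set.Ioi (0 : ℝ), Real.exp (-(α ^ d * v)) * (1 + v) ^ (2 * N) :=
    setIntegral_nonneg measurableSet_Ioi fun v hv => by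
      have : (0 : ℝ) < v := hv
      positivity
  calc ∫ u in simplexSet (m + 1) T, ∏ j, G j (u j)
      ≤ ∫ u in Set.pi Set.univ fun _ => Set.Icc 0 T, ∏ j, G j (u j) := by
        refine setIntegral_mono_set hbox ?_ (simplexSet_subset _ _).eventuallyLE
        refine (ae_restrict_iff' (MeasurableSet.univ_pi fun _ => measurableSet_Icc)).2
          (Eventually.of_forall fun u hu => Finset.prod_nonneg fun j _ => hG0 j _ ?_)
        exact (hu j (Set.mem_univ j)).1
    _ = ∏ j, ∫ v in Set.Icc 0 T, G j v := by
        rw [volume_pi, Measure.restrict_pi_pi]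
        exact integral_fintype_prod_eq_prod (μ := fun _ => volume.restrict (Set.Icc 0 T)) G
    _ ≤ ∏ _j : Fin (m + 1),
        (t + ∫ v in Set.Ioi (0 : ℝ), Real.exp (-(α ^ d * v)) * (1 + v) ^ (2 * N)) := by
        refine Finset.prod_le_prod (fun j _ => setIntegral_nonneg measurableSet_Icc
          fun v hv => hG0 j v hv.1) fun j _ => ?_
        by_cases hj : j.succ ∈ S
        · simp only [hG, Stage.weight, hj, decide_true, if_true]
          rw [setIntegral_const, Real.volume_real_Icc_of_le hT, smul_eq_mul]
          linarith
        · simp only [hG, Stage.weight, hj, decide_false, Bool.false_eq_true, if_false]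
          rw [integral_Icc_eq_integral_Ioc]
          refine le_trans (setIntegral_mono_set hexp ?_ Set.Ioc_subset_Ioi_self.eventuallyLE)
            (le_add_of_nonneg_left ht)
          refine (ae_restrict_iff' measurableSet_Ioi).2 (Eventually.of_forall fun v hv => ?_)
          have : (0 : ℝ) < v := hv
          simp only [Pi.zero_apply]
          positivity
    _ = _ := by rw [Finset.prod_const, Finset.card_univ, Fintype.card_fin]

end Time

section Sum

variable {Γ χ : Space d → ℝ} {α r t : ℝ}

lemma IsMacroscopicCutoff.eq_zero {lam : Space d → ℝ} (h : IsMacroscopicCutoff lam) {x : Space d}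
    (hx : 1 < ‖x‖) : lam x = 0 := by
  by_contra h0
  have h1 := h.support (subset_tsupport _ h0)
  rw [Metric.mem_closedBall, dist_zero_right] at h1
  linarith

lemma IsMacroscopicCutoff.abs_le_norm1inf {lam : Space d → ℝ} (h : IsMacroscopicCutoff lam)
    (x : Space d) : |lam x| ≤ norm1inf lam := by
  have hc := h.smooth.continuous
  have hcs : HasCompactSupport lam :=
    HasCompactSupport.of_support_subset_isCompact (isCompact_closedBall (0 : Space d) 1)
      ((subset_tsupport _).trans h.support)
  refine le_trans ?_ (le_max_right _ _)
  have hfin : eLpNorm lam ⊤ volume < ⊤ := (hc.memLp_of_hasCompactSupport (p := ⊤) hcs).2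
  set M := (eLpNorm lam ⊤ volume).toReal with hM
  have hae : ∀ᵐ y ∂(volume : Measure (Space d)), |lam y| ≤ M := by
    rw [eLpNorm_exponent_top] at hfin hM
    filter_upwards [ae_le_eLpNormEssSup (f := lam) (μ := volume)] with y hy
    have := (ENNReal.toReal_le_toReal (by simp) hfin.ne).2 hy
    simpa [hM] using this
  -- the set on which a continuous function exceeds its essential supremum is open
  have hopen : IsOpen {y | M < |lam y|} := isOpen_lt (by fun_prop) (by fun_prop)
  have h0 : volume {y | M < |lam y|} = 0 := by
    rw [ae_iff] at hae
    simpa using hae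
  have hempty := hopen.measure_eq_zero_iff (μ := volume) |>.1 h0
  by_contra hx
  have : x ∈ {y | M < |lam y|} := not_le.1 hx
  rw [hempty] at this
  exact this

lemma collisionTerm_eq_zero {m : ℕ} (W : SchwartzMap (Space d) ℂ)
    (a b : SchwartzMap (Space d × Space d) ℂ) {lam : Space d → ℝ} (h : IsMacroscopicCutoff lam)
    (γ : Fin m → Fin 2) (S : Finset (Fin (m + 1))) {q : Fin m → Space d} {i : Fin m}
    (hi : 1 < ‖r ^ (d - 1) • q i‖) : collisionTerm Γ χ W a b lam α r t γ S q = 0 := by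
  rw [collisionTerm, Finset.prod_eq_zero (Finset.mem_univ i) (by simp [h.eq_zero hi]), zero_mul]

open Classical in
/-- Only the finitely many scatterers in the support of the potential contribute. -/
lemma nondiagonalTerm_eq_sum {m : ℕ} (W : SchwartzMap (Space d) ℂ)
    (a b : SchwartzMap (Space d × Space d) ℂ) {lam : Space d → ℝ} (h : IsMacroscopicCutoff lam)
    (P : Set (Space d)) (γ : Fin m → Fin 2) (S : Finset (Fin (m + 1))) {F : Finset (Space d)}
    (hF : ∀ q, q ∈ F ↔ q ∈ P ∧ ‖r ^ (d - 1) • q‖ ≤ 1) :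
    nondiagonalTerm Γ χ W a b P lam α r t γ S = ∑ q : Fin m → F,
      if IsDiagonal S (fun i => (q i : Space d)) then 0
        else collisionTerm Γ χ W a b lam α r t γ S (fun i => (q i : Space d)) := by
  rw [nondiagonalTerm, tsum_subtype]
  have hinj : Function.Injective fun (q : Fin m → F) (i : Fin m) => (q i : Space d) := by
    intro q q' hqq
    funext i
    exact Subtype.ext (congrFun hqq i)
  rw [← hinj.tsum_eq, tsum_fintype]
  · refine Finset.sum_congr rfl fun q _ => ?_
    by_cases hq : IsDiagonal S (fun i => (q i : Space d))
    · rw [if_pos hq, Set.indicator_of_notMem (fun hmem => hmem.2 hq)]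
    · rw [if_neg hq, Set.indicator_of_mem]
      exact ⟨fun i => ((hF _).1 (q i).2).1, hq⟩
  · intro q hq
    rw [Function.mem_support] at hq
    have hmem : q ∈ nondiagonalTuples P S := by
      by_contra hn
      exact hq (Set.indicator_of_notMem hn _)
    rw [Set.indicator_of_mem hmem] at hq
    refine ⟨fun i => ⟨q i, (hF _).2 ⟨hmem.1 i, ?_⟩⟩, rfl⟩
    by_contra hi
    exact hq (collisionTerm_eq_zero W a b h γ S (not_le.1 hi))

lemma integrable_initialState (hΓ : IsDampingProfile Γ) (hα : 0 ≤ α) (hr : 0 ≤ r) (hr1 : r ≤ 1)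
    (b : SchwartzMap (Space d × Space d) ℂ) {u : ℝ} (hu : 0 ≤ u) :
    Integrable (initialState Γ b α r u) := by
  obtain ⟨C, hC, h⟩ := exists_norm_initialState_le b
  exact (integrable_decay_prod.const_mul C).mono'
    (continuous_initialState hΓ b (by fun_prop) (by fun_prop)).aestronglyMeasurable
    (Eventually.of_forall fun p => h Γ α r u hΓ hα hr hr1 hu p)

open Classical in
/-- At fixed durations, the nondiagonal terms sum up to the pairing of `nondiagSum` with the initial
state. -/
lemma sum_fixedTimeTerm (hΓ : IsDampingProfile Γ) (hχ : IsRegionCutoff χ) (hα : 0 ≤ α)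
    (hr : 0 ≤ r) (hr1 : r ≤ 1) (a b : SchwartzMap (Space d × Space d) ℂ) {T : ℝ} {m : ℕ}
    (γ : Fin (m + 1) → Fin 2) {S : Finset (Fin (m + 2))} (hl : Fin.last _ ∈ S) {ι : Type}
    [Fintype ι] {f : ι → Space d} (hf : Function.Injective f) {k : ι → Space d → ℂ}
    (hk : ∀ i, Integrable (k i)) {u : Fin (m + 1) → ℝ} (hu : u ∈ simplexSet (m + 1) T) :
    ∑ q : Fin (m + 1) → ι, (if IsDiagonal S (fun i => f (q i)) then 0 else
        fixedTimeTerm Γ χ a b α r T γ S (fun i => k (q i)) u) =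
      ∫ p : Space d × Space d, initialState Γ b α r (T - ∑ i, u i) p *
        nondiagSum m k γ (stages d S α u)
          (fun i => stateMultiplier Γ χ α r (decide (i.castSucc.succ ∈ S)) (u i.castSucc))
          (finalState Γ a α r (u (Fin.last m))) (p.1 + r ^ d • p.2, p.1) := by
  have hI := integrable_initialState hΓ hα hr hr1 b (u := T - ∑ i, u i) (by linarith [hu.2])
  have hmap : Measurable fun p : Space d × Space d => (p.1 + r ^ d • p.2, p.1) := by fun_prop
  simp only [nondiagSum, Finset.mul_sum]
  rw [integral_finsetSum]
  · refine Finset.sum_congr rfl fun q _ => ?_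
    by_cases hq : IsDiagonal S (fun i => f (q i))
    · have hq' := (isDiagonal_iff hl hf α u q).1 hq
      simp [hq, hq']
    · have hq' := fun h' => hq ((isDiagonal_iff hl hf α u q).2 h')
      rw [if_neg hq, fixedTimeTerm]
      refine integral_congr_ae (Eventually.of_forall fun p => ?_)
      simp only [if_neg hq']
  · intro q _
    split_ifs
    · simp
    · have hm := boundedMeasurable_chain (γ := γ) (fun i => hk (q i)) (fun i : Fin m =>
        boundedMeasurable_stateMultiplier (r := r) hΓ hχ hα (decide (i.castSucc.succ ∈ S))
          (hu.1 i.castSucc))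
        (boundedMeasurable_finalState (r := r) hΓ a hα (hu.1 (Fin.last m)))
      obtain ⟨M, hM⟩ := hm.bounded
      exact hI.mul_bdd (c := M) (hm.stronglyMeasurable.comp_measurable hmap).aestronglyMeasurable
        (Eventually.of_forall fun p => hM _)

end Sum

/-! ### Small scales, and the series over the orders -/

section Scaling

/-- The scatterers in the support of the potential form an admissible family, for all small scales:
with `κ² = r^{-d(d-1)}` the order of their number, the strip of width `ε = r^d` has
`ε^d κ² = r^d`, and the separation is `b / r`. The order `2 d²` of the differences is chosen so that
`κ⁴ (r / b)^{2 d²}` is `O(r^{2 d})`. -/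
lemma exists_eventually_regime (d : ℕ) (hd : 2 ≤ d) : ∃ D : ℝ, 1 ≤ D ∧
    ∀ (P : Set (Space d)) (b : ℝ), IsScattererConfiguration P b →
      ∀ lam : Space d → ℝ, IsMacroscopicCutoff lam →
      ∀ᶠ r : ℝ in 𝓝[>] 0, ∃ F : Finset (Space d), (∀ q, q ∈ F ↔ q ∈ P ∧ ‖r ^ (d - 1) • q‖ ≤ 1) ∧
        Regime d (2 * d ^ 2) D (norm1inf lam) (√(r ^ (d * (d - 1)))⁻¹) (r ^ d) r (b / r)
          (fun q : F => r⁻¹ • (q : Space d))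
          (fun q : F => (lam (r ^ (d - 1) • (q : Space d)) : ℂ)) := by
  obtain ⟨D, hD, hcard⟩ := exists_card_scatterers_le d hd
  refine ⟨D, hD, fun P b hP lam hlam => ?_⟩
  have hb := hP.sep_pos
  have hlam0 : 0 ≤ norm1inf lam := (abs_nonneg _).trans (hlam.abs_le_norm1inf 0)
  have hosc : ∀ᶠ r : ℝ in 𝓝[>] 0, r * ((4 * b) ^ (2 * d ^ 2))⁻¹ ≤ 1 := by
    have h : Tendsto (fun r : ℝ => r * ((4 * b) ^ (2 * d ^ 2))⁻¹) (𝓝[>] 0)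
        (𝓝 (0 * ((4 * b) ^ (2 * d ^ 2))⁻¹)) :=
      (Continuous.tendsto (by fun_prop) 0).mono_left nhdsWithin_le_nhds
    rw [zero_mul] at h
    exact h.eventually_le_const zero_lt_one
  have hsmall : ∀ c : ℝ, 0 < c → ∀ᶠ r : ℝ in 𝓝[>] 0, r < c := fun c hc =>
    eventually_nhdsWithin_of_eventually_nhds (eventually_lt_nhds hc)
  have hdn : (0 : ℝ) < 2 * d ^ 2 := by
    have : (0 : ℝ) < d := by exact_mod_cast (by omega : 0 < d)
    positivity
  filter_upwards [hcard P b hP, hosc, hsmall 1 zero_lt_one, hsmall b hb,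
    hsmall (2 * b / (2 * d ^ 2)) (by positivity), self_mem_nhdsWithin] with r h1 h2 hr1 hrb hrN hr
  have hr : 0 < r := hr
  have hfin : {q : Space d | q ∈ P ∧ ‖r ^ (d - 1) • q‖ ≤ 1}.Finite := by
    refine (hP.finite_inter_ball (r ^ (d - 1))⁻¹).subset fun q hq => ⟨hq.1, ?_⟩
    have h3 := hq.2
    rw [norm_smul, Real.norm_of_nonneg (by positivity)] at h3
    rwa [← one_div, le_div_iff₀ (by positivity), mul_comm]
  have hF : ∀ q, q ∈ hfin.toFinset ↔ q ∈ P ∧ ‖r ^ (d - 1) • q‖ ≤ 1 := fun q => by simp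
  have hκ : √(r ^ (d * (d - 1)))⁻¹ ^ 2 = (r ^ (d * (d - 1)))⁻¹ := Real.sq_sqrt (by positivity)
  have hθ : (r ^ d) ^ d * (r ^ (d * (d - 1)))⁻¹ = r ^ d := by
    rw [← pow_mul, ← div_eq_mul_inv, div_eq_iff (by positivity), ← pow_add]
    congr 1
    obtain ⟨e, rfl⟩ : ∃ e, d = e + 1 := ⟨d - 1, by omega⟩
    simp only [Nat.add_sub_cancel]
    ring
  refine ⟨hfin.toFinset, hF, ?_, by positivity, pow_le_one₀ hr.le hr1.le, hlam0, fun q => ?_, ?_,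
    ?_, fun q q' hq => ?_, ?_, ?_, ?_, ?_⟩
  · rw [Real.one_le_sqrt]
    exact (one_le_inv₀ (by positivity)).2 (pow_le_one₀ hr.le hr1.le)
  · rw [Complex.norm_real]
    exact hlam.abs_le_norm1inf _
  · rw [one_le_div hr]
    exact hrb.le
  · rw [lt_div_iff₀ hdn] at hrN
    push_cast
    rw [mul_div_assoc', le_div_iff₀ hr]
    linarith
  · rw [← smul_sub, norm_smul, norm_inv, Real.norm_of_nonneg hr.le, ← div_eq_inv_mul]
    exact div_le_div_of_nonneg_right (hP.separated _ ((hF _).1 q.2).1 _ ((hF _).1 q'.2).1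
      fun h => hq (Subtype.ext h)).le hr.le
  · rw [hκ, Fintype.card_coe]
    exact h1 _ fun q hq => (hF q).1 hq
  · rw [hκ, hθ]
    exact pow_le_one₀ hr.le hr1.le
  · rw [hκ, hθ]
    exact pow_le_of_le_one hr.le hr1.le (by omega)
  · have e1 : √(r ^ (d * (d - 1)))⁻¹ ^ 4 = (r ^ (2 * (d * (d - 1))))⁻¹ := by
      rw [show 4 = 2 * 2 from rfl, pow_mul, hκ, inv_pow, ← pow_mul, mul_comm 2]
    have e2 : 2 * d ^ 2 = 2 * (d * (d - 1)) + ((2 * d - 2) + 1 + 1) := by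
      obtain ⟨e, rfl⟩ : ∃ e, d = e + 1 := ⟨d - 1, by omega⟩
      simp only [Nat.add_sub_cancel]
      rw [show 2 * (e + 1) - 2 = 2 * e by omega]
      ring
    have e3 : r ^ (2 * d ^ 2) = r ^ (2 * (d * (d - 1))) * (r ^ (2 * d - 2) * r * r) := by
      rw [e2, pow_add, pow_succ, pow_succ]
    have hb4 : 0 < ((4 * b) ^ (2 * d ^ 2))⁻¹ := by positivity
    rw [e1, mul_div_assoc', div_pow, inv_div, e3]
    calc (r ^ (2 * (d * (d - 1))))⁻¹ *
          (r ^ (2 * (d * (d - 1))) * (r ^ (2 * d - 2) * r * r) / (4 * b) ^ (2 * d ^ 2))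
        = r ^ (2 * d - 2) * (r * ((4 * b) ^ (2 * d ^ 2))⁻¹) * r := by
          field_simp
      _ ≤ 1 * 1 * r := by
          gcongr
          exact pow_le_one₀ hr.le hr1.le
      _ = r := by ring

/-- All orders in the potential at once, with constants that depend on neither the order nor the
scatterers. The factor `κ²` of the supremum norm cancels against the gain `κ⁻² r`. -/
lemma exists_nondiagonalTerm_le (hd : 2 ≤ d) (W : SchwartzMap (Space d) ℂ)
    (a b : SchwartzMap (Space d × Space d) ℂ) {α t : ℝ} (hα : 0 < α) (ht : 0 ≤ t) :
    ∃ C B : ℝ, 0 ≤ C ∧ 0 ≤ B ∧ ∀ Γ χ : Space d → ℝ, IsDampingProfile Γ → IsRegionCutoff χ →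
      ∀ (P : Set (Space d)) (bP : ℝ), IsScattererConfiguration P bP →
      ∀ lam : Space d → ℝ, IsMacroscopicCutoff lam → ∀ᶠ r : ℝ in 𝓝[>] 0,
        ∀ (m : ℕ) (γ : Fin (m + 1) → Fin 2), ∀ S ∈ markedSets (m + 1),
          ‖nondiagonalTerm Γ χ W a b P lam α r t γ S‖ ≤
            C * m * (B * norm1inf lam) ^ (m + 1) * r := by
  classical
  obtain ⟨D, hD, hreg⟩ := exists_eventually_regime d hd
  obtain ⟨CF, hCF, hshift⟩ :=
    exists_shiftBound_tildeTransform a (2 * d ^ 2) (2 * d ^ 2 + (d + 1)) t ht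
  obtain ⟨B, hB, hmain⟩ := exists_nondiagSum_le W (2 * d ^ 2) hD (R := 2 / α) (by positivity) ht hCF
  obtain ⟨Cb, hCb, hinit⟩ := exists_norm_initialState_le b
  set J := ∫ v in Set.Ioi (0 : ℝ), Real.exp (-(α ^ d * v)) * (1 + v) ^ (2 * (2 * d ^ 2)) with hJ
  have hJ0 : 0 ≤ J := setIntegral_nonneg measurableSet_Ioi fun v hv => by
    have : (0 : ℝ) < v := hv
    positivity
  set I := ∫ p : Space d × Space d, decay (d + 1) p.1 * decay (d + 1) p.2 with hI
  have hI0 : 0 ≤ I := integral_nonneg fun p =>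
    mul_nonneg (decay_pos _ _).le (decay_pos _ _).le
  refine ⟨Cb * I, B * (t + J), by positivity, by positivity, ?_⟩
  intro Γ χ hΓ hχ P bP hP lam hlam
  filter_upwards [hreg P bP hP lam hlam, self_mem_nhdsWithin,
    eventually_nhdsWithin_of_eventually_nhds (eventually_lt_nhds zero_lt_one)]
    with r hr0 hr hr1 m γ S hS
  have hr : 0 < r := hr
  obtain ⟨F, hF, hR⟩ := hr0
  have h0 : 0 ∈ S := (Finset.mem_filter.1 hS).2.1
  have hl : Fin.last _ ∈ S := (Finset.mem_filter.1 hS).2.2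
  set T := (r ^ d)⁻¹ * t with hT
  have hε : 0 < r ^ d := by positivity
  have hT0 : 0 ≤ T := by positivity
  have hTt : T * r ^ d = t := by rw [hT]; field_simp
  set κ := √(r ^ (d * (d - 1)))⁻¹ with hκ
  have hκ1 := hR.one_le_kappa
  have hκ0 : 0 < κ := by linarith
  have hΛ := hR.strength_nonneg
  set θ := (r ^ d) ^ d * κ ^ 2 with hθ
  have hθr : θ * T ≤ t := by
    have e : θ = r ^ d := by
      rw [hθ, hκ, Real.sq_sqrt (by positivity), ← pow_mul, ← div_eq_mul_inv,
        div_eq_iff (by positivity), ← pow_add]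
      congr 1
      obtain ⟨e, rfl⟩ : ∃ e, d = e + 1 := ⟨d - 1, by omega⟩
      simp only [Nat.add_sub_cancel]
      ring
    rw [e, mul_comm, hTt]
  have hθ0 : 0 ≤ θ := by positivity
  set Λ := norm1inf lam with hΛdef
  have hms : MeasurableSet (simplexSet (m + 1) T) := (isClosed_simplexSet _ _).measurableSet
  set k : F → Space d → ℂ := fun q =>
    kern W (lam (r ^ (d - 1) • (q : Space d)) : ℂ) (r⁻¹ • (q : Space d)) with hk
  have hki : ∀ q, Integrable (k q) := fun q => integrable_kern _ _ _
  have hct := fun q : Fin (m + 1) → F =>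
    collisionTerm_eq (t := t) hΓ hχ hα.le hr hr1.le W a b lam γ h0 hl (fun i => (q i : Space d))
  -- the sum over the scatterers is taken inside the integral over the durations
  have hsum : nondiagonalTerm Γ χ W a b P lam α r t γ S =
      ∫ u in simplexSet (m + 1) T, ∑ q : Fin (m + 1) → F,
        if IsDiagonal S (fun i => (q i : Space d)) then 0
          else fixedTimeTerm Γ χ a b α r T γ S (fun i => k (q i)) u := by
    rw [nondiagonalTerm_eq_sum W a b hlam P γ S hF, integral_finsetSum]
    · refine Finset.sum_congr rfl fun q _ => ?_
      split_ifs
      · simp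
      · exact (hct q).2
    · intro q _
      split_ifs
      · simp
      · exact (hct q).1
  have hbound : ∀ u ∈ simplexSet (m + 1) T,
      ‖∑ q : Fin (m + 1) → F, if IsDiagonal S (fun i => (q i : Space d)) then 0
          else fixedTimeTerm Γ χ a b α r T γ S (fun i => k (q i)) u‖ ≤
        (Cb * I * (m * (B * Λ) ^ (m + 1) * r)) *
          ((∏ i, (stages d S α u i).weight (2 * d ^ 2) θ) * θ) := by
    intro u hu
    have hule : ∀ i, u i ≤ T := fun i =>
      (Finset.single_le_sum (fun j _ => hu.1 j) (Finset.mem_univ i)).trans hu.2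
    have hut : ∀ i, u i * r ^ d ≤ t := fun i => by
      rw [← hTt]
      exact mul_le_mul_of_nonneg_right (hule i) hε.le
    rw [sum_fixedTimeTerm hΓ hχ hα.le hr.le hr1.le a b γ hl Subtype.val_injective hki hu]
    have hn := (hmain hR (finalState Γ a α r (u (Fin.last m)))
      (boundedMeasurable_finalState hΓ a hα.le (hu.1 _))
      (hshift (r ^ d) (u (Fin.last m)) (fun ζ => (damping Γ α r (u (Fin.last m)) ζ : ℂ)) hε
        (pow_le_one₀ hr.le hr1.le) (hu.1 _) (hut _) fun ζ => by
          rw [Complex.norm_real, Real.norm_of_nonneg (damping_pos _ _).le]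
          exact damping_le_one hΓ hα.le (hu.1 _) ζ) m γ (stages d S α u) _ _
      (fun i => isMultiplier_stateMultiplier hΓ hχ hα hr (decide (i.castSucc.succ ∈ S))
        (hu.1 i.castSucc) (hut i.castSucc))).2
    set n := κ ^ 2 * (m * (B * Λ) ^ (m + 1) *
      (∏ i, (stages d S α u i).weight (2 * d ^ 2) θ) * θ * ((κ ^ 2)⁻¹ * r)) with hndef
    have hn0 : 0 ≤ n := (norm_nonneg _).trans (hn 0)
    have e1 : ∀ p : Space d × Space d, ‖initialState Γ b α r (T - ∑ i, u i) p *
        nondiagSum m k γ (stages d S α u)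
          (fun i => stateMultiplier Γ χ α r (decide (i.castSucc.succ ∈ S)) (u i.castSucc))
          (finalState Γ a α r (u (Fin.last m))) (p.1 + r ^ d • p.2, p.1)‖ ≤
        Cb * n * (decay (d + 1) p.1 * decay (d + 1) p.2) := by
      intro p
      rw [norm_mul]
      have h1 := hinit Γ α r (T - ∑ i, u i) hΓ hα.le hr.le hr1.le (by linarith [hu.2]) p
      calc _ ≤ Cb * (decay (d + 1) p.1 * decay (d + 1) p.2) * n :=
            mul_le_mul h1 (hn _) (norm_nonneg _) ((norm_nonneg _).trans h1)
        _ = _ := by ring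
    refine (norm_integral_le_of_norm_le (integrable_decay_prod.const_mul _)
      (Eventually.of_forall e1)).trans (le_of_eq ?_)
    rw [integral_const_mul, ← hI, hndef]
    field_simp
  obtain ⟨hw, hwle⟩ := setIntegral_weight_le (d := d) (N := 2 * d ^ 2) hl hα hθ0 hT0 ht hθr
  rw [hsum]
  refine (norm_integral_le_of_norm_le (hw.const_mul (Cb * I * (m * (B * Λ) ^ (m + 1) * r)))
    ((ae_restrict_iff' hms).2 (Eventually.of_forall hbound))).trans ?_
  rw [integral_const_mul]
  refine (mul_le_mul_of_nonneg_left hwle (by positivity)).trans (le_of_eq ?_)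
  rw [← hJ, mul_right_comm B, mul_pow (B * Λ)]
  ring

end Scaling

section Series

/-- There are `2^{m+1}` choices of `γ` and at most `2^{m+2}` of the marked set. -/
lemma exists_nondiagonalOrder_le (hd : 2 ≤ d) (W : SchwartzMap (Space d) ℂ)
    (a b : SchwartzMap (Space d × Space d) ℂ) {α t : ℝ} (hα : 0 < α) (ht : 0 ≤ t) :
    ∃ C B : ℝ, 0 ≤ C ∧ 0 ≤ B ∧ ∀ Γ χ : Space d → ℝ, IsDampingProfile Γ → IsRegionCutoff χ →
      ∀ (P : Set (Space d)) (bP : ℝ), IsScattererConfiguration P bP →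
      ∀ lam : Space d → ℝ, IsMacroscopicCutoff lam → ∀ᶠ r : ℝ in 𝓝[>] 0, ∀ m : ℕ,
        ‖nondiagonalOrder Γ χ W a b P lam α r t (m + 1)‖ ≤
          C * r * (m * (B * norm1inf lam) ^ (m + 1)) := by
  obtain ⟨C, B, hC, hB, h⟩ := exists_nondiagonalTerm_le hd W a b hα ht
  refine ⟨2 * C, (2 * Real.pi) * 2 * 2 * B, by positivity, by positivity, ?_⟩
  intro Γ χ hΓ hχ P bP hP lam hlam
  filter_upwards [h Γ χ hΓ hχ P bP hP lam hlam, self_mem_nhdsWithin] with r hr hr0 m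
  have hr0 : 0 < r := hr0
  set Λ := norm1inf lam with hΛ
  have hΛ0 : 0 ≤ Λ := (abs_nonneg _).trans (hlam.abs_le_norm1inf 0)
  set β := C * m * (B * Λ) ^ (m + 1) * r with hβ
  have hβ0 : 0 ≤ β := by positivity
  have hS : ∀ γ : Fin (m + 1) → Fin 2, ‖(-1 : ℂ) ^ (∑ i, (γ i : ℕ)) *
      ∑ S ∈ markedSets (m + 1), nondiagonalTerm Γ χ W a b P lam α r t γ S‖ ≤
        2 ^ (m + 2) * β := by
    intro γ
    rw [norm_mul, norm_pow, norm_neg, norm_one, one_pow, one_mul]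
    refine (norm_sum_le_of_le _ fun S hS => hr m γ S hS).trans ?_
    rw [Finset.sum_const, nsmul_eq_mul]
    refine mul_le_mul_of_nonneg_right ?_ hβ0
    have h1 : (markedSets (m + 1)).card ≤ 2 ^ (m + 2) := by
      refine (Finset.card_filter_le _ _).trans ?_
      simp
    exact_mod_cast h1
  rw [nondiagonalOrder, norm_mul, norm_pow]
  have h2 : ‖(2 * Real.pi * Complex.I : ℂ)‖ = 2 * Real.pi := by
    simp [abs_of_pos Real.pi_pos]
  rw [h2]
  calc _ ≤ (2 * Real.pi) ^ (m + 1) * (2 ^ (m + 1) * (2 ^ (m + 2) * β)) := by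
        gcongr
        refine (norm_sum_le_of_le _ fun γ _ => hS γ).trans (le_of_eq ?_)
        rw [Finset.sum_const, nsmul_eq_mul]
        simp
    _ = _ := by
        rw [hβ, mul_assoc _ B Λ, mul_pow _ (B * Λ), mul_pow _ (2 : ℝ) (m + 1),
          mul_pow _ (2 : ℝ) (m + 1), pow_succ 2 (m + 1)]
        ring

end Series

end LorentzGas

theorem mainTheorem3 (d : ℕ) (hd : 3 ≤ d)
    (W : SchwartzMap (LorentzGas.Space d) ℂ)
    (a b : SchwartzMap (LorentzGas.Space d × LorentzGas.Space d) ℂ)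
    (α t : ℝ) (hα : 0 < α) (ht : 0 < t) :
    ∃ lam₀ : ℝ, 0 < lam₀ ∧
      ∀ Γ χ : LorentzGas.Space d → ℝ,
        LorentzGas.IsDampingProfile Γ → LorentzGas.IsRegionCutoff χ →
      ∀ (P : Set (LorentzGas.Space d)) (bP : ℝ), LorentzGas.IsScattererConfiguration P bP →
      ∀ lam : LorentzGas.Space d → ℝ, LorentzGas.IsMacroscopicCutoff lam →
        LorentzGas.norm1inf lam < lam₀ →
        (∀ᶠ r : ℝ in 𝓝[>] 0,
          Summable fun m : ℕ => LorentzGas.nondiagonalOrder Γ χ W a b P lam α r t (m + 1)) ∧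
        ((fun r : ℝ => ∑' m : ℕ, LorentzGas.nondiagonalOrder Γ χ W a b P lam α r t (m + 1))
          =O[𝓝[>] 0] fun r : ℝ => r * Real.logb 2 (1 + r ^ (1 - (d : ℤ)) * bP⁻¹)) ∧
        Tendsto
          (fun r : ℝ => ∑' m : ℕ, LorentzGas.nondiagonalOrder Γ χ W a b P lam α r t (m + 1))
          (𝓝[>] 0) (𝓝 0) := by
  obtain ⟨C, B, hC, hB, h⟩ := LorentzGas.exists_nondiagonalOrder_le (by omega) W a b hα ht.le
  -- the ratio of the series is then at most `1 / 2`
  refine ⟨1 / (2 * (B + 1)), by positivity, ?_⟩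
  intro Γ χ hΓ hχ P bP hP lam hlam hsmall
  set Λ := LorentzGas.norm1inf lam with hΛ
  have hΛ0 : 0 ≤ Λ := (abs_nonneg _).trans (hlam.abs_le_norm1inf 0)
  have hBΛ : B * Λ ≤ 1 / 2 := by
    rw [lt_div_iff₀ (by positivity)] at hsmall
    nlinarith
  have hBΛ0 : 0 ≤ B * Λ := by positivity
  have hgeom : Summable fun m : ℕ => (m : ℝ) * (B * Λ) ^ (m + 1) := by
    have h1 := (summable_pow_mul_geometric_of_norm_lt_one 1 (r := B * Λ)
      (by rw [Real.norm_of_nonneg hBΛ0]; linarith)).mul_right (B * Λ)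
    refine h1.congr fun m => ?_
    rw [pow_one, pow_succ, mul_assoc]
  have hr := h Γ χ hΓ hχ P bP hP lam hlam
  have hpos : ∀ᶠ r : ℝ in 𝓝[>] 0, 0 < r := self_mem_nhdsWithin
  have hOr : (fun r : ℝ => ∑' m : ℕ, LorentzGas.nondiagonalOrder Γ χ W a b P lam α r t (m + 1))
      =O[𝓝[>] 0] fun r : ℝ => r := by
    refine IsBigO.of_bound (C * ∑' m : ℕ, (m : ℝ) * (B * Λ) ^ (m + 1)) ?_
    filter_upwards [hr, hpos] with r h1 h2
    refine (tsum_of_norm_bounded (hgeom.hasSum.mul_left (C * r)) h1).trans (le_of_eq ?_)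
    rw [Real.norm_of_nonneg h2.le]
    ring
  -- for `r ≤ 1 / bP` the logarithm is at least one
  have hlog : (fun r : ℝ => r) =O[𝓝[>] 0]
      fun r : ℝ => r * Real.logb 2 (1 + r ^ (1 - (d : ℤ)) * bP⁻¹) := by
    refine IsBigO.of_bound 1 ?_
    filter_upwards [hpos, eventually_nhdsWithin_of_eventually_nhds (eventually_lt_nhds zero_lt_one),
      eventually_nhdsWithin_of_eventually_nhds (eventually_lt_nhds (inv_pos.2 hP.sep_pos))]
      with r h1 h2 h3
    have h4 : 1 ≤ r ^ (1 - (d : ℤ)) * bP⁻¹ := by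
      have h5 : r⁻¹ ≤ r ^ (1 - (d : ℤ)) := by
        rw [← zpow_neg_one]
        exact zpow_le_zpow_right_of_le_one₀ h1 h2.le (by omega)
      have h7 : 1 ≤ r⁻¹ * bP⁻¹ := by
        rw [← mul_inv]
        refine (one_le_inv₀ (mul_pos h1 hP.sep_pos)).2 ?_
        rw [← inv_mul_cancel₀ hP.sep_pos.ne']
        exact mul_le_mul_of_nonneg_right h3.le hP.sep_pos.le
      exact h7.trans (mul_le_mul_of_nonneg_right h5 (inv_nonneg.2 hP.sep_pos.le))
    have h6 : 1 ≤ Real.logb 2 (1 + r ^ (1 - (d : ℤ)) * bP⁻¹) := by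
      rw [Real.le_logb_iff_rpow_le (by norm_num) (by linarith), Real.rpow_one]
      linarith
    rw [one_mul, norm_mul]
    refine le_mul_of_one_le_right (norm_nonneg _) ?_
    rwa [Real.norm_of_nonneg (by linarith)]
  refine ⟨?_, hOr.trans hlog, hOr.trans_tendsto ?_⟩
  · filter_upwards [hr] with r h1
    exact Summable.of_norm_bounded (hgeom.mul_left (C * r)) h1
  · exact tendsto_id.mono_left nhdsWithin_le_nhds
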